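/- Let $\Gamma\subset\mathbf C$ be a bounded open set with $C^\infty$ boundary $\gamma=\partial\Gamma$. Let $N\ge 1$, let $\varphi_1,\dots,\varphi_N$ be holomorphic functions, independent of $h$, on an open set $U\supset\gamma$, and put $\psi_j=\operatorname{Re}\varphi_j$ and $\Psi=\max_j\psi_j$. Assume that (i) for every $x\in\gamma$, the maximum $\Psi(x)=\max_j\psi_j(x)$ is attained for at most two different values of $j$; (ii) if $x\in\gamma$, $j\ne k$ and $\Psi(x)=\psi_j(x)=\psi_k(x)$, then $\partial_\nu(\psi_j-\psi_k)(x)\ne0$, where $\nu$ is a unit tangent vector to $\gamma$ at $x$. Zeros are counted with multiplicity and $L(dz)$ denotes Lebesgue measure. (a) Suppose that $\overline\Gamma\subset U$, and let $u(z;h)=\sum_{j=1}^N e^{\varphi_j(z)/h}$. Then the distribution $\Delta\Psi$ is a positive measure on $U$, finite on compact subsets of $U$, and there are constants $C$ and $h_0>0$ such that for all $0<h\le h_0$ the function $u(\cdot;h)$ has only finitely many zeros in $\Gamma$ and $$\Big|\#\big(u(\cdot;h)^{-1}(0)\cap\Gamma\big)-\frac1{2\pi h}\int_\Gamma\Delta\Psi(z)\,L(dz)\Big|\le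 C .$$ (b) More generally, let $\Omega$ be an open set containing $\overline\Gamma\cup U$, let $h_1>0$, and for $0<h\le h_1$ let $u(\cdot;h)$ be holomorphic in $\Omega$ with $u(z;h)=\sum_{j=1}^N e^{\varphi_j(z)/h}$ for $z\in U$. Let $T$ be any real distribution on $\Omega$ that is equal to $\Psi$ on $U$. Then $\Delta T$ is a positive measure, finite on compact sets, on a neighbourhood $V$ of $\gamma$, so that $$\int_\Gamma\Delta T\,L(dz):=\langle \Delta T,\chi\rangle+\int_{\Gamma}(1-\chi)\,\Delta T\,L(dz)$$ is well defined, where $\chi\in C_0^\infty(\Gamma)$ is equal to $1$ near $\Gamma\setminus V$, and there are constants $C$ and $0<h_0\le h_1$ such that for all $0<h\le h_0$ the function $u(\cdot;h)$ has only finitely many zeros in $\Gamma$ and $$\Big|\#\big(u(\cdot;h)^{-1}(0)\cap\Gamma\big)-\frac1{2\pi h}\int_\Gamma\Delta T\,L(dz)\Big|\le C .$$ -/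

import Mathlib

open Set Filter Topology MeasureTheory TopologicalSpace
open scoped ContDiff Distributions LineDeriv

/-- `ρ` is a smooth defining function of `Γ` near `x`: it is `C^∞` on a neighbourhood `V` of `x`,
`Γ ∩ V = {ρ < 0} ∩ V`, and `dρ(x) ≠ 0`. -/
def IsLocalDefiningFunction (Γ : Set ℂ) (x : ℂ) (ρ : ℂ → ℝ) : Prop :=
  ∃ V : Set ℂ, IsOpen V ∧ x ∈ V ∧ ContDiffOn ℝ ∞ ρ V ∧
    (∀ y ∈ V, y ∈ Γ ↔ ρ y < 0) ∧ fderiv ℝ ρ x ≠ 0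

/-- The open set `Γ` has `C^∞` boundary. -/
def HasSmoothBoundary (Γ : Set ℂ) : Prop :=
  ∀ x ∈ frontier Γ, ∃ ρ : ℂ → ℝ, IsLocalDefiningFunction Γ x ρ

/-- `τ` is one of the two unit vectors tangent to the boundary of `Γ` at the boundary point `x`. -/
def IsUnitTangent (Γ : Set ℂ) (x τ : ℂ) : Prop :=
  ‖τ‖ = 1 ∧ ∃ ρ : ℂ → ℝ, IsLocalDefiningFunction Γ x ρ ∧ fderiv ℝ ρ x τ = 0

/-- The upper envelope `Ψ = max_j Re φ_j` of finitely many functions. -/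
noncomputable def maxRe {N : ℕ} (φ : Fin N → ℂ → ℂ) (z : ℂ) : ℝ :=
  ⨆ j, (φ j z).re

/-- The number of zeros of `f` in `Γ`, counted with multiplicity. It is meaningful when `f` has
only finitely many zeros in `Γ`. -/
noncomputable def zeroCount (f : ℂ → ℂ) (Γ : Set ℂ) : ℕ :=
  ∑ᶠ z ∈ {z ∈ Γ | f z = 0}, analyticOrderNatAt f z

/-- The Laplacian of a test function. -/
noncomputable def testLaplacian {Ω : Opens ℂ} (χ : 𝓓(Ω, ℝ)) : 𝓓(Ω, ℝ) :=
  ∂_{(1 : ℂ)} (∂_{(1 : ℂ)} χ) + ∂_{Complex.I} (∂_{Complex.I} χ)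

/-- The Laplacian of a distribution. -/
noncomputable def distLaplacian {Ω : Opens ℂ} (T : 𝓓'(Ω, ℝ)) : 𝓓'(Ω, ℝ) :=
  ∂_{(1 : ℂ)} (∂_{(1 : ℂ)} T) + ∂_{Complex.I} (∂_{Complex.I} T)

/-- The distribution `T` coincides with the function `f` on `V`. -/
def Distribution.EqFunctionOn {Ω : Opens ℂ} (T : 𝓓'(Ω, ℝ)) (V : Set ℂ) (f : ℂ → ℝ) : Prop :=
  ∀ χ : 𝓓(Ω, ℝ), tsupport χ ⊆ V → T χ = ∫ z, f z * χ z

/-- The distribution `T` coincides on `V` with the positive measure `μ`, which is finite on the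
compact subsets of `V`. -/
def Distribution.EqMeasureOn {Ω : Opens ℂ} (T : 𝓓'(Ω, ℝ)) (V : Set ℂ) (μ : Measure ℂ) : Prop :=
  (∀ K : Set ℂ, IsCompact K → K ⊆ V → μ K < ⊤) ∧
    ∀ χ : 𝓓(Ω, ℝ), tsupport χ ⊆ V → T χ = ∫ z, χ z ∂μ

/-- `ΔΨ = μ` in the sense of distributions on `Ω`, where `μ` is a positive measure that is finite
on the compact subsets of `Ω`. -/
def IsLaplacianMeasure (Ω : Opens ℂ) (Ψ : ℂ → ℝ) (μ : Measure ℂ) : Prop :=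
  (∀ K : Set ℂ, IsCompact K → K ⊆ Ω → μ K < ⊤) ∧
    ∀ χ : 𝓓(Ω, ℝ), ∫ z, Ψ z * testLaplacian χ z = ∫ z, χ z ∂μ

/-- `m = ∫_Γ S(dz)` for a distribution `S` on a neighbourhood `Ω` of the closure of `Γ` that is a
positive measure `μ` on a neighbourhood `V` of the boundary of `Γ`: writing the indicator function
of `Γ` as `χ + (1 - χ) 1_Γ`, with a cutoff function `χ` that has compact support in `Γ` and is
equal to `1` near `Γ \ V`, the first term is paired with `S` and the second one with `μ`. The
value `m` does not depend on the choice of `V`, `μ` and `χ`. -/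
def Distribution.HasMassOn {Ω : Opens ℂ} (S : 𝓓'(Ω, ℝ)) (Γ : Set ℂ) (m : ℝ) : Prop :=
  ∃ (V : Set ℂ) (μ : Measure ℂ) (χ : 𝓓(Ω, ℝ)),
    IsOpen V ∧ frontier Γ ⊆ V ∧ V ⊆ Ω ∧ S.EqMeasureOn V μ ∧
    tsupport χ ⊆ Γ ∧ (∀ᶠ z in 𝓝ˢ (Γ \ V), χ z = 1) ∧
    m = S χ + ∫ z in Γ, (1 - χ z) ∂μ

/-! The distribution `Δ log|u| / 2π` is the sum of the point masses at the zeros of `u`, counted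
with multiplicity. Pair it with a cutoff `χ` of `Γ` that drops from `1` to `0` inside a collar of
width `3h` around `γ`, so that `Δχ = O(h⁻²)` is supported in the collar. There `u` is the
exponential sum and `log|u| = Ψ/h + E`, where `E` is `logDefect`. Hence the zeros weighted by `χ`
number `(2πh)⁻¹ ∫ Ψ Δχ + (2π)⁻¹ ∫ E Δχ`.

With `μ = ΔΨ`, three collar bounds finish the proof (`exists_collar_bounds`): `∫ |E| = O(h²)`; `μ`
of the collar is `O(h)`, so replacing `∫ Ψ Δχ` by the mass of `Γ` changes the main term by `O(1)`;
and only `O(1)` zeros lie in the collar. The interior of `Γ` enters only through the pairing with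
`χ`, so `u` and `T` may be arbitrary extensions there.

By compactness the bounds are local near each `x ∈ γ`. By transversality one exponent dominates all
others on `γ` near `x`, with a margin linear in the distance to `x`; the Lipschitz property carries
this into the collar (`HasDominance`). Beyond distance `Kh` from `x` there are then no zeros, `μ`
vanishes, and `|E| ≤ B exp(-c|z - x|/h)`, whose integral is `O(h²)`. In the disc of radius `Kh` two
exponents may compete. But some point at distance `O(h)` has `|E| ≤ 1`, and Jensen's inequality
around it turns the trivial upper bound for `|u|` into `∫ |E| = O(h²)`
(`lintegral_ball_logDefect_le`). A bump function at scale `h` then bounds the zeros in the disc by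
`O(1)` and, as `Ψ` is Lipschitz, its `μ`-mass by `O(h)`.

Positivity of `ΔΨ` follows from the approximation of `Ψ` by `h log ∑ exp(Re φ_j / h)`, which is
subharmonic by Cauchy–Schwarz; the measure comes from the extension theorem of M. Riesz and the
Riesz–Markov–Kakutani theorem. -/

/-- The Laplacian of a function on the plane. -/
noncomputable def planeLaplacian (f : ℂ → ℝ) (z : ℂ) : ℝ :=
  fderiv ℝ (fun w => fderiv ℝ f w 1) z 1 + fderiv ℝ (fun w => fderiv ℝ f w Complex.I) z Complex.I

/-! ### Calculus of the Laplacian in the plane. -/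

section LaplacianBasics

theorem tsupport_planeLaplacian_subset (f : ℂ → ℝ) : tsupport (planeLaplacian f) ⊆ tsupport f := by
  have h := tsupport_add (fun z => fderiv ℝ (fun w => fderiv ℝ f w 1) z 1)
    (fun z => fderiv ℝ (fun w => fderiv ℝ f w Complex.I) z Complex.I)
  refine h.trans (union_subset ?_ ?_)
  · exact (tsupport_fderiv_apply_subset ℝ _).trans (tsupport_fderiv_apply_subset ℝ _)
  · exact (tsupport_fderiv_apply_subset ℝ _).trans (tsupport_fderiv_apply_subset ℝ _)

theorem planeLaplacian_congr {f g : ℂ → ℝ} {z : ℂ} (h : f =ᶠ[𝓝 z] g) :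
    planeLaplacian f z = planeLaplacian g z := by
  have key (v : ℂ) : (fun w => fderiv ℝ f w v) =ᶠ[𝓝 z] (fun w => fderiv ℝ g w v) := by
    filter_upwards [h.fderiv (𝕜 := ℝ)] with w hw
    rw [hw]
  simp only [planeLaplacian]
  rw [(key 1).fderiv_eq, (key Complex.I).fderiv_eq]

theorem contDiffAt_fderiv_apply {f : ℂ → ℝ} {z : ℂ} {m n : ℕ∞ω} (hf : ContDiffAt ℝ n f z)
    (hmn : m + 1 ≤ n) (v : ℂ) : ContDiffAt ℝ m (fun w => fderiv ℝ f w v) z :=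
  (hf.fderiv_right hmn).clm_apply contDiffAt_const

theorem continuous_planeLaplacian {f : ℂ → ℝ} (hf : ContDiff ℝ ∞ f) :
    Continuous (planeLaplacian f) := by
  have key (v : ℂ) : Continuous (fun z => fderiv ℝ (fun w => fderiv ℝ f w v) z v) := by
    rw [continuous_iff_continuousAt]
    intro z
    refine (contDiffAt_fderiv_apply (m := 0) (n := 1) ?_ (by simp) v).continuousAt
    exact contDiffAt_fderiv_apply (contDiff_infty.1 hf 2).contDiffAt (by norm_num : (1:ℕ∞ω) + 1 ≤ 2) v
  exact (key 1).add (key Complex.I)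

theorem planeLaplacian_const (c : ℝ) : planeLaplacian (fun _ => c) = 0 := by
  ext z
  simp [planeLaplacian]

theorem planeLaplacian_eq_laplacian {f : ℂ → ℝ} {z : ℂ} (hf : ContDiffAt ℝ 2 f z) :
    planeLaplacian f z = Laplacian.laplacian f z := by
  rw [InnerProductSpace.laplacian_eq_iteratedFDeriv_complexPlane]
  have key (v : ℂ) : fderiv ℝ (fun w => fderiv ℝ f w v) z v = fderiv ℝ (fderiv ℝ f) z v v := by
    have hd : DifferentiableAt ℝ (fderiv ℝ f) z :=
      (hf.fderiv_right (m := 1) (by norm_num)).differentiableAt (by norm_num)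
    rw [fderiv_clm_apply hd (by fun_prop)]
    simp
  simp [planeLaplacian, key, iteratedFDeriv_two_apply]

theorem planeLaplacian_eq_zero_of_harmonicAt {f : ℂ → ℝ} {z : ℂ}
    (hf : InnerProductSpace.HarmonicAt f z) : planeLaplacian f z = 0 := by
  rw [planeLaplacian_eq_laplacian hf.1, hf.2.self_of_nhds]
  rfl

/-- The dilation gives the factor `h⁻²` for cutoffs at scale `h`; the case `c = 1` is translation
invariance. -/
theorem planeLaplacian_comp_smul_sub {f : ℂ → ℝ} (hf : ContDiff ℝ ∞ f) (c : ℝ) (a z : ℂ) :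
    planeLaplacian (fun w => f (c • (w - a))) z = c ^ 2 * planeLaplacian f (c • (z - a)) := by
  have key (g : ℂ → ℝ) (hg : ContDiff ℝ 1 g) (w v : ℂ) :
      fderiv ℝ (fun w => g (c • (w - a))) w v = c * fderiv ℝ g (c • (w - a)) v := by
    have h1 : HasFDerivAt (fun w : ℂ => c • (w - a)) (c • ContinuousLinearMap.id ℝ ℂ) w :=
      ((hasFDerivAt_id w).sub_const a).const_smul c
    have h2 := ((hg.differentiable (by norm_num)).differentiableAt (x := c • (w - a))).hasFDerivAt
    have := (h2.comp w h1).fderiv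
    simp only [Function.comp_def] at this
    rw [this]
    simp
  have key2 (v : ℂ) : fderiv ℝ (fun w => fderiv ℝ (fun w => f (c • (w - a))) w v) z v
      = c ^ 2 * fderiv ℝ (fun w => fderiv ℝ f w v) (c • (z - a)) v := by
    have hf2 : ContDiff ℝ 1 (fun w => fderiv ℝ f w v) :=
      contDiff_iff_contDiffAt.2 fun w => contDiffAt_fderiv_apply (n := 2)
        (contDiff_infty.1 hf 2).contDiffAt (by norm_num) v
    have e : (fun w => fderiv ℝ (fun w => f (c • (w - a))) w v)
        = fun w => c • (fun w => fderiv ℝ f w v) (c • (w - a)) := by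
      ext w
      rw [key f (contDiff_infty.1 hf 1) w v]
      simp
    rw [e, fderiv_fun_const_smul]
    · rw [_root_.smul_apply, key _ hf2]
      simp
      ring
    · have := hf2.differentiable (by norm_num)
      fun_prop
  simp only [planeLaplacian, key2]
  ring

end LaplacianBasics

/-! ### Green's identity against test functions. -/

section IntegrationByParts

/-- The values of `f` off `U` are arbitrary; the product is still continuous everywhere because it
vanishes near every point outside the closed support of `g`. -/
theorem continuous_mul_of_tsupport_subset {U : Set ℂ} {f g : ℂ → ℝ} (hU : IsOpen U)
    (hf : ContinuousOn f U) (hg : Continuous g) (hgU : tsupport g ⊆ U) :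
    Continuous (fun z => f z * g z) := by
  apply continuous_of_tsupport
  intro x hx
  have hx' : x ∈ U := hgU (tsupport_mul_subset_right hx)
  exact (hf.continuousAt (hU.mem_nhds hx')).mul hg.continuousAt

theorem integrable_mul_of_tsupport_subset {U : Set ℂ} {f g : ℂ → ℝ} (hU : IsOpen U)
    (hf : ContinuousOn f U) (hg : Continuous g) (hgc : HasCompactSupport g) (hgU : tsupport g ⊆ U) :
    Integrable (fun z => f z * g z) :=
  (continuous_mul_of_tsupport_subset hU hf hg hgU).integrable_of_hasCompactSupport hgc.mul_left

theorem integral_mul_fderiv_eq_neg {U : Set ℂ} {f χ : ℂ → ℝ} (hU : IsOpen U)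
    (hf : ContDiffOn ℝ 1 f U) (hχ : ContDiff ℝ 1 χ) (hc : HasCompactSupport χ)
    (hχU : tsupport χ ⊆ U) (v : ℂ) :
    ∫ z, f z * fderiv ℝ χ z v = - ∫ z, fderiv ℝ f z v * χ z := by
  have hχ' : Continuous (fun z => fderiv ℝ χ z v) :=
    (hχ.continuous_fderiv (by norm_num)).clm_apply continuous_const
  apply integral_mul_fderiv_eq_neg_fderiv_mul_of_integrable
  · refine integrable_mul_of_tsupport_subset hU ?_ hχ.continuous hc hχU
    exact (hf.continuousOn_fderiv_of_isOpen hU (by norm_num)).clm_apply continuousOn_const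
  · exact integrable_mul_of_tsupport_subset hU hf.continuousOn hχ'
      (hc.fderiv_apply ℝ v) ((tsupport_fderiv_apply_subset ℝ _).trans hχU)
  · exact integrable_mul_of_tsupport_subset hU hf.continuousOn hχ.continuous hc hχU
  · intro x hx
    exact (hf.contDiffAt (hU.mem_nhds (hχU hx))).differentiableAt (by norm_num)
  · intro x _
    exact (hχ.differentiable (by norm_num)) x

/-- Green's identity for a `C^2` function and a test function. -/
theorem integral_mul_planeLaplacian {U : Set ℂ} {f χ : ℂ → ℝ} (hU : IsOpen U)
    (hf : ContDiffOn ℝ 2 f U) (hχ : ContDiff ℝ ∞ χ) (hc : HasCompactSupport χ)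
    (hχU : tsupport χ ⊆ U) :
    ∫ z, f z * planeLaplacian χ z = ∫ z, planeLaplacian f z * χ z := by
  have hχ2 : ContDiff ℝ 2 χ := contDiff_infty.1 hχ 2
  have hd (v : ℂ) : ContDiff ℝ 1 (fun w => fderiv ℝ χ w v) :=
    contDiff_iff_contDiffAt.2 fun w => contDiffAt_fderiv_apply (n := 2)
      hχ2.contDiffAt (by norm_num) v
  have hfd (v : ℂ) : ContDiffOn ℝ 1 (fun w => fderiv ℝ f w v) U := fun z hz =>
    (contDiffAt_fderiv_apply (hf.contDiffAt (hU.mem_nhds hz)) (by norm_num) v).contDiffWithinAt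
  have hs (v : ℂ) : tsupport (fun w => fderiv ℝ χ w v) ⊆ U :=
    (tsupport_fderiv_apply_subset ℝ _).trans hχU
  have key (v : ℂ) : ∫ z, f z * fderiv ℝ (fun w => fderiv ℝ χ w v) z v
      = ∫ z, fderiv ℝ (fun w => fderiv ℝ f w v) z v * χ z := by
    rw [integral_mul_fderiv_eq_neg hU (hf.of_le (by norm_num)) (hd v) (hc.fderiv_apply ℝ v) (hs v) v,
      integral_mul_fderiv_eq_neg hU (hfd v) (hχ2.of_le (by norm_num)) hc hχU v, neg_neg]
  have hi1 (v : ℂ) : Integrable (fun z => f z * fderiv ℝ (fun w => fderiv ℝ χ w v) z v) := by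
    refine integrable_mul_of_tsupport_subset hU hf.continuousOn ?_
      ((hc.fderiv_apply ℝ v).fderiv_apply ℝ v) ((tsupport_fderiv_apply_subset ℝ _).trans (hs v))
    exact ((hd v).continuous_fderiv (by norm_num)).clm_apply continuous_const
  have hi2 (v : ℂ) : Integrable (fun z => fderiv ℝ (fun w => fderiv ℝ f w v) z v * χ z) := by
    refine integrable_mul_of_tsupport_subset hU ?_ hχ.continuous hc hχU
    exact ((hfd v).continuousOn_fderiv_of_isOpen hU (by norm_num)).clm_apply continuousOn_const
  simp only [planeLaplacian, mul_add, add_mul]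
  rw [integral_add (hi1 _) (hi1 _), integral_add (hi2 _) (hi2 _), key, key]

theorem integral_mul_planeLaplacian_eq_zero {U : Set ℂ} {f χ : ℂ → ℝ} (hU : IsOpen U)
    (hf : InnerProductSpace.HarmonicOnNhd f U) (hχ : ContDiff ℝ ∞ χ) (hc : HasCompactSupport χ)
    (hχU : tsupport χ ⊆ U) :
    ∫ z, f z * planeLaplacian χ z = 0 := by
  rw [integral_mul_planeLaplacian hU hf.contDiffOn hχ hc hχU]
  rw [← integral_zero ℂ ℝ]
  congr 1
  ext z
  by_cases hz : z ∈ tsupport χ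
  · rw [planeLaplacian_eq_zero_of_harmonicAt (hf z (hχU hz)), zero_mul]
  · rw [image_eq_zero_of_notMem_tsupport hz, mul_zero]

end IntegrationByParts

/-! ### Laplacians of test functions and of distributions. -/

section TestFunctions

theorem testLaplacian_apply {Ω : Opens ℂ} (χ : 𝓓(Ω, ℝ)) (z : ℂ) :
    testLaplacian χ z = planeLaplacian χ z := by
  have h1 (χ : 𝓓(Ω, ℝ)) (v z : ℂ) : (∂_{v} χ : 𝓓(Ω, ℝ)) z = fderiv ℝ χ z v := by
    rw [TestFunction.lineDerivOp_eq_lineDerivCLM (𝕜 := ℝ),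
      TestFunction.lineDerivCLM_apply_of_le (by simp)]
    exact ((χ.contDiff.differentiable (by simp)) z).lineDeriv_eq_fderiv
  have h2 (χ : 𝓓(Ω, ℝ)) (v : ℂ) : ⇑(∂_{v} χ : 𝓓(Ω, ℝ)) = fun z => fderiv ℝ χ z v := funext (h1 χ v)
  change (∂_{(1 : ℂ)} (∂_{(1 : ℂ)} χ : 𝓓(Ω, ℝ)) : 𝓓(Ω, ℝ)) z +
    (∂_{Complex.I} (∂_{Complex.I} χ : 𝓓(Ω, ℝ)) : 𝓓(Ω, ℝ)) z = _
  rw [h1, h1, h2, h2]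
  rfl

theorem distLaplacian_apply {Ω : Opens ℂ} (T : 𝓓'(Ω, ℝ)) (χ : 𝓓(Ω, ℝ)) :
    distLaplacian T χ = T (testLaplacian χ) := by
  have h (v : ℂ) : (∂_{v} (∂_{v} T : 𝓓'(Ω, ℝ)) : 𝓓'(Ω, ℝ)) χ =
      T (∂_{v} (∂_{v} χ : 𝓓(Ω, ℝ)) : 𝓓(Ω, ℝ)) := by
    rw [Distribution.lineDerivOp_apply_apply, map_neg, Distribution.lineDerivOp_apply_apply,
      map_neg, neg_neg]
  change (∂_{(1 : ℂ)} (∂_{(1 : ℂ)} T : 𝓓'(Ω, ℝ)) : 𝓓'(Ω, ℝ)) χ +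
    (∂_{Complex.I} (∂_{Complex.I} T : 𝓓'(Ω, ℝ)) : 𝓓'(Ω, ℝ)) χ = _
  rw [h, h, ← map_add]
  rfl

end TestFunctions

/-! ### The fundamental solution `log|z| / 2π`. -/

section FundamentalSolution

/-- The integrand is the Laplacian of `log √(|w|² + 1)`; its total mass is the source of the `2π` in
the fundamental solution. -/
theorem integral_two_div_one_add_norm_sq_sq :
    ∫ w : ℂ, 2 / (1 + ‖w‖ ^ 2) ^ 2 = 2 * Real.pi := by
  have h := integral_fun_norm_addHaar (E := ℂ) volume (fun y : ℝ => 2 / (1 + y ^ 2) ^ 2)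
  rw [h, Complex.finrank_real_complex]
  have h2 : ∫ y in Ioi (0 : ℝ), y ^ (2 - 1) • (2 / (1 + y ^ 2) ^ 2) = 1 := by
    have := integral_Ioi_of_hasDerivAt_of_nonneg (a := 0) (l := 0)
      (g := fun y : ℝ => -(1 + y ^ 2)⁻¹) (g' := fun y => y ^ (2 - 1) • (2 / (1 + y ^ 2) ^ 2))
      ?_ ?_ ?_ ?_
    · rw [this]
      norm_num
    · have : Continuous (fun y : ℝ => -(1 + y ^ 2)⁻¹) := by
        refine Continuous.neg (Continuous.inv₀ (by fun_prop) fun y => by positivity)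
      exact this.continuousWithinAt
    · intro y _
      have hy : (1 + y ^ 2) ≠ 0 := by positivity
      have : HasDerivAt (fun y : ℝ => -(1 + y ^ 2)⁻¹) _ y :=
        (((hasDerivAt_pow 2 y).const_add 1).inv hy).neg
      refine this.congr_deriv ?_
      simp only [smul_eq_mul]
      push_cast
      ring
    · intro y hy
      have : 0 < y := hy
      simp only [smul_eq_mul]
      positivity
    · rw [← neg_zero]
      refine Tendsto.neg (tendsto_inv_atTop_zero.comp ?_)
      exact tendsto_atTop_add_const_left _ _ (tendsto_pow_atTop (by norm_num))
  rw [h2]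
  simp [Measure.real, Complex.volume_ball]

theorem integrable_two_div_one_add_norm_sq_sq :
    Integrable (fun w : ℂ => 2 / (1 + ‖w‖ ^ 2) ^ 2) := by
  -- A non-integrable function has integral `0` by convention, so the nonzero value just computed
  -- proves integrability.
  apply Integrable.of_integral_ne_zero
  rw [integral_two_div_one_add_norm_sq_sq]
  positivity

/-- The regularised logarithm `log √(|z|² + ε²)`. -/
noncomputable def regLog (ε : ℝ) (z : ℂ) : ℝ := Real.log (‖z‖ ^ 2 + ε ^ 2) / 2

theorem contDiff_regLog {ε : ℝ} (hε : 0 < ε) : ContDiff ℝ ∞ (regLog ε) := by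
  unfold regLog
  refine ContDiff.div_const (ContDiff.log ?_ fun z => by positivity) _
  exact (contDiff_norm_sq ℝ).add contDiff_const

theorem planeLaplacian_regLog {ε : ℝ} (hε : 0 < ε) (z : ℂ) :
    planeLaplacian (regLog ε) z = 2 * ε ^ 2 / (‖z‖ ^ 2 + ε ^ 2) ^ 2 := by
  have hn (w : ℂ) : ‖w‖ ^ 2 = w.re ^ 2 + w.im ^ 2 := by
    rw [← Complex.normSq_eq_norm_sq, Complex.normSq_apply]; ring
  set g : ℂ → ℝ := fun w => w.re ^ 2 + w.im ^ 2 + ε ^ 2 with hg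
  have hgpos (w : ℂ) : g w ≠ 0 := by simp only [hg]; positivity
  have hre (w : ℂ) : HasFDerivAt (fun w : ℂ => w.re) Complex.reCLM w := Complex.reCLM.hasFDerivAt
  have him (w : ℂ) : HasFDerivAt (fun w : ℂ => w.im) Complex.imCLM w := Complex.imCLM.hasFDerivAt
  have hgd (w : ℂ) : HasFDerivAt g
      ((2 * w.re) • Complex.reCLM + (2 * w.im) • Complex.imCLM) w := by
    convert! (((hre w).pow 2).add ((him w).pow 2)).add_const (ε ^ 2) using 1
    simp
  have h1 (v w : ℂ) : fderiv ℝ (regLog ε) w v = (w.re * v.re + w.im * v.im) / g w := by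
    have e : regLog ε = fun w => (1 / 2 : ℝ) • Real.log (g w) := by
      ext w; simp only [regLog, hn, hg, smul_eq_mul]; ring
    have hd : HasFDerivAt (fun w => (1 / 2 : ℝ) • Real.log (g w)) _ w :=
      ((hgd w).log (hgpos w)).const_smul (1 / 2 : ℝ)
    rw [e, hd.fderiv]
    simp
    field_simp
  have h2 : fderiv ℝ (fun w => fderiv ℝ (regLog ε) w 1) z 1
      = 1 / g z - 2 * z.re ^ 2 / g z ^ 2 := by
    have e : (fun w => fderiv ℝ (regLog ε) w 1) = fun w => w.re * (g w)⁻¹ := by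
      ext w; rw [h1]; simp [div_eq_mul_inv]
    have hi : HasFDerivAt (fun w => (g w)⁻¹) _ z :=
      (hasDerivAt_inv (hgpos z)).comp_hasFDerivAt z (hgd z)
    have hd : HasFDerivAt (fun w => w.re * (g w)⁻¹) _ z := (hre z).mul hi
    rw [e, hd.fderiv]
    have := hgpos z
    simp
    field_simp
    ring
  have h3 : fderiv ℝ (fun w => fderiv ℝ (regLog ε) w Complex.I) z Complex.I
      = 1 / g z - 2 * z.im ^ 2 / g z ^ 2 := by
    have e : (fun w => fderiv ℝ (regLog ε) w Complex.I) = fun w => w.im * (g w)⁻¹ := by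
      ext w; rw [h1]; simp [div_eq_mul_inv]
    have hi : HasFDerivAt (fun w => (g w)⁻¹) _ z :=
      (hasDerivAt_inv (hgpos z)).comp_hasFDerivAt z (hgd z)
    have hd : HasFDerivAt (fun w => w.im * (g w)⁻¹) _ z := (him z).mul hi
    rw [e, hd.fderiv]
    have := hgpos z
    simp
    field_simp
    ring
  rw [planeLaplacian, h2, h3, hn]
  have := hgpos z
  change _ = 2 * ε ^ 2 / g z ^ 2
  field_simp
  simp only [hg]
  ring

/-- The bounds `1 - 1/t ≤ log t ≤ t - 1` give `|log t| ≤ (1 + r²)/t` for `0 < t < r`, and `1/|z|` is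
locally integrable in the plane. -/
theorem integrableOn_log_norm_ball (r : ℝ) :
    IntegrableOn (fun z : ℂ => Real.log ‖z‖) (Metric.ball 0 r) := by
  refine integrableOn_ball_of_norm_le_rpow (C := 1 + r ^ 2) (α := 1) ?_ ?_ ?_ ?_
  · simp
  · simp
  · filter_upwards [ae_restrict_mem Metric.isOpen_ball.measurableSet,
      ae_restrict_of_ae (Measure.ae_ne volume (0 : ℂ))] with z hz hz0
    have hpos : 0 < ‖z‖ := norm_pos_iff.2 hz0
    have hr : ‖z‖ < r := by simpa using hz
    rw [Real.rpow_neg_one, Real.norm_eq_abs, abs_le, ← div_eq_mul_inv, le_div_iff₀ hpos,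
      ← neg_div, div_le_iff₀ hpos]
    have h1 := Real.log_le_sub_one_of_pos hpos
    have h2 := Real.one_sub_inv_le_log_of_pos hpos
    have h3 : ‖z‖ * ‖z‖⁻¹ = 1 := mul_inv_cancel₀ hpos.ne'
    constructor <;> nlinarith
  · exact (Real.measurable_log.comp measurable_norm).aestronglyMeasurable

theorem integrableOn_log_norm_sub {K : Set ℂ} (hK : IsCompact K) (a : ℂ) :
    IntegrableOn (fun z : ℂ => Real.log ‖z - a‖) K := by
  obtain ⟨r, hr⟩ := hK.isBounded.subset_ball a
  refine IntegrableOn.mono_set ?_ hr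
  have h := integrableOn_log_norm_ball r
  have hm : MeasurePreserving (fun z : ℂ => z - a) volume volume := measurePreserving_sub_right _ a
  have h2 := (hm.integrableOn_comp_preimage (measurableEmbedding_subRight a)).2 h
  have e : Metric.ball a r = (fun z : ℂ => z - a) ⁻¹' Metric.ball 0 r := by
    ext z
    simp only [Metric.mem_ball, mem_preimage, dist_eq_norm, sub_zero]
  rw [e]
  exact h2

theorem integrable_mul_of_integrableOn {f g : ℂ → ℝ} (hg : Continuous g) (hc : HasCompactSupport g)
    (hf : IntegrableOn f (tsupport g)) : Integrable (fun z => f z * g z) := by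
  have h : Integrable (fun z => (tsupport g).indicator f z * g z) := by
    obtain ⟨C, hC⟩ := hc.exists_bound_of_continuous hg
    exact (hf.integrable_indicator (isClosed_tsupport g).measurableSet).mul_bdd (c := C)
      hg.aestronglyMeasurable (Eventually.of_forall hC)
  refine h.congr (Eventually.of_forall fun z => ?_)
  by_cases hz : z ∈ tsupport g
  · simp [hz]
  · simp [image_eq_zero_of_notMem_tsupport hz]

/-- After Green's identity, the substitution `z = εw` removes `ε` from the kernel and leaves it only
in the argument of `χ`. -/
theorem integral_regLog_mul_planeLaplacian {χ : ℂ → ℝ} (hχ : ContDiff ℝ ∞ χ)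
    (hc : HasCompactSupport χ) {ε : ℝ} (hε : 0 < ε) :
    ∫ z, regLog ε z * planeLaplacian χ z = ∫ w : ℂ, 2 / (1 + ‖w‖ ^ 2) ^ 2 * χ (ε • w) := by
  rw [integral_mul_planeLaplacian isOpen_univ (contDiff_infty.1 (contDiff_regLog hε) 2).contDiffOn hχ hc
    (subset_univ _)]
  have h := Measure.integral_comp_smul (volume : Measure ℂ)
    (fun z => planeLaplacian (regLog ε) z * χ z) ε
  rw [Complex.finrank_real_complex, eq_comm, abs_of_pos (by positivity),
    inv_smul_eq_iff₀ (by positivity)] at h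
  rw [h, smul_eq_mul, ← integral_const_mul]
  congr 1
  ext w
  rw [planeLaplacian_regLog hε, norm_smul, Real.norm_of_nonneg hε.le]
  have : (1 + ‖w‖ ^ 2) ≠ 0 := by positivity
  have : (ε * ‖w‖) ^ 2 + ε ^ 2 ≠ 0 := by positivity
  field_simp
  ring

/-- A majorant independent of `ε`, for dominated convergence as `ε → 0`. -/
theorem abs_regLog_le {ε : ℝ} (hε : 0 < ε) (hε1 : ε ≤ 1) {z : ℂ} (hz : z ≠ 0) :
    |regLog ε z| ≤ |Real.log ‖z‖| + regLog 1 z := by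
  have hpos : 0 < ‖z‖ := norm_pos_iff.2 hz
  have h1 : Real.log ‖z‖ ≤ regLog ε z := by
    have : Real.log ‖z‖ = Real.log (‖z‖ ^ 2) / 2 := by rw [Real.log_pow]; push_cast; ring
    rw [this, regLog]
    gcongr
    nlinarith
  have h2 : regLog ε z ≤ regLog 1 z := by
    simp only [regLog]
    gcongr
  have h3 : 0 ≤ regLog 1 z := by
    simp only [regLog]
    have := Real.log_nonneg (x := ‖z‖ ^ 2 + 1 ^ 2) (by nlinarith)
    positivity
  rw [abs_le]
  constructor
  · linarith [neg_abs_le (Real.log ‖z‖)]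
  · linarith [abs_nonneg (Real.log ‖z‖)]

/-- Both sides of `integral_regLog_mul_planeLaplacian` converge as `ε = 1/(n+1) → 0`; on the right
the kernel concentrates at the origin. -/
theorem integral_log_norm_mul_planeLaplacian {χ : ℂ → ℝ} (hχ : ContDiff ℝ ∞ χ)
    (hc : HasCompactSupport χ) :
    ∫ z, Real.log ‖z‖ * planeLaplacian χ z = 2 * Real.pi * χ 0 := by
  have hlc : Continuous (planeLaplacian χ) := continuous_planeLaplacian hχ
  have hls : HasCompactSupport (planeLaplacian χ) :=
    hc.mono' (subset_closure.trans (tsupport_planeLaplacian_subset χ))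
  have hlog : Integrable (fun z => Real.log ‖z‖ * planeLaplacian χ z) := by
    refine integrable_mul_of_integrableOn hlc hls ?_
    simpa using integrableOn_log_norm_sub hls.isCompact 0
  have hseq : Tendsto (fun n : ℕ => 1 / ((n : ℝ) + 1)) atTop (𝓝 0) :=
    tendsto_one_div_add_atTop_nhds_zero_nat
  have hp (n : ℕ) : 0 < 1 / ((n : ℝ) + 1) := by positivity
  have hp1 (n : ℕ) : 1 / ((n : ℝ) + 1) ≤ 1 := by
    rw [div_le_one (by positivity)]; linarith [(Nat.cast_nonneg n : (0 : ℝ) ≤ n)]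
  have t1 : Tendsto (fun n : ℕ => ∫ z, regLog (1 / ((n : ℝ) + 1)) z * planeLaplacian χ z) atTop
      (𝓝 (∫ z, Real.log ‖z‖ * planeLaplacian χ z)) := by
    refine tendsto_integral_of_dominated_convergence
      (fun z => |Real.log ‖z‖ * planeLaplacian χ z| + |regLog 1 z * planeLaplacian χ z|) ?_ ?_ ?_ ?_
    · intro n
      exact ((contDiff_regLog (hp n)).continuous.mul hlc).aestronglyMeasurable
    · refine hlog.abs.add (Integrable.abs ?_)
      exact integrable_mul_of_tsupport_subset isOpen_univ
        (contDiff_regLog one_pos).continuous.continuousOn hlc hls (subset_univ _)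
    · intro n
      filter_upwards [Measure.ae_ne volume (0 : ℂ)] with z hz
      rw [Real.norm_eq_abs, abs_mul, abs_mul, abs_mul, ← add_mul]
      gcongr
      exact (abs_regLog_le (hp n) (hp1 n) hz).trans (by gcongr; exact le_abs_self _)
    · filter_upwards [Measure.ae_ne volume (0 : ℂ)] with z hz
      refine Tendsto.mul_const _ ?_
      have hpos : 0 < ‖z‖ := norm_pos_iff.2 hz
      have : Real.log ‖z‖ = Real.log (‖z‖ ^ 2 + 0 ^ 2) / 2 := by
        rw [zero_pow two_ne_zero, add_zero, Real.log_pow]; push_cast; ring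
      rw [this]
      refine Tendsto.div_const (Tendsto.log ?_ (by positivity)) _
      exact tendsto_const_nhds.add (hseq.pow 2)
  have t2 : Tendsto (fun n : ℕ => ∫ z, regLog (1 / ((n : ℝ) + 1)) z * planeLaplacian χ z) atTop
      (𝓝 (∫ w : ℂ, 2 / (1 + ‖w‖ ^ 2) ^ 2 * χ 0)) := by
    simp_rw [fun n : ℕ => integral_regLog_mul_planeLaplacian hχ hc (hp n)]
    obtain ⟨C, hC⟩ := hc.exists_bound_of_continuous hχ.continuous
    refine tendsto_integral_of_dominated_convergence
      (fun w => 2 / (1 + ‖w‖ ^ 2) ^ 2 * C) ?_ ?_ ?_ ?_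
    · intro n
      refine Continuous.aestronglyMeasurable (Continuous.mul ?_ (hχ.continuous.comp (by fun_prop)))
      exact Continuous.div continuous_const (by fun_prop) fun w => by positivity
    · exact integrable_two_div_one_add_norm_sq_sq.mul_const C
    · intro n
      refine Eventually.of_forall fun w => ?_
      rw [norm_mul, Real.norm_of_nonneg (by positivity)]
      gcongr
      exact hC _
    · refine Eventually.of_forall fun w => Tendsto.const_mul _ ?_
      have : Tendsto (fun n : ℕ => (1 / ((n : ℝ) + 1)) • w) atTop (𝓝 0) := by
        simpa using hseq.smul_const w
      exact (hχ.continuous.tendsto 0).comp this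
  rw [tendsto_nhds_unique t1 t2, integral_mul_const, integral_two_div_one_add_norm_sq_sq]

/-- `log |z - a| / 2π` is a fundamental solution of the Laplacian. -/
theorem integral_log_norm_sub_mul_planeLaplacian {χ : ℂ → ℝ} (hχ : ContDiff ℝ ∞ χ)
    (hc : HasCompactSupport χ) (a : ℂ) :
    ∫ z, Real.log ‖z - a‖ * planeLaplacian χ z = 2 * Real.pi * χ a := by
  have h := integral_log_norm_mul_planeLaplacian (χ := fun z => χ (z + a))
    (hχ.comp (by fun_prop)) (hc.comp_homeomorph (Homeomorph.addRight a))
  rw [zero_add] at h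
  rw [← h, ← integral_add_right_eq_self _ a]
  congr 1
  ext z
  have := planeLaplacian_comp_smul_sub hχ 1 (-a) z
  simp only [one_smul, sub_neg_eq_add, one_pow, one_mul] at this
  rw [this, add_sub_cancel_right]

end FundamentalSolution

/-! ### Zeros as the Laplacian of `log|u|`. -/

section ZeroCounting

/-- Away from a null set, `log |u|` is on a compact set the sum of the logarithms of the distances
to the zeros and of a harmonic function. -/
theorem exists_log_norm_ae_eq {K : Set ℂ} (hK : IsCompact K) {u : ℂ → ℂ}
    (hu : AnalyticOnNhd ℂ u K) (hord : ∀ z ∈ K, analyticOrderAt u z ≠ ⊤) :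
    ∃ (Z : Finset ℂ) (g : ℂ → ℂ), (∀ a, a ∈ Z ↔ a ∈ K ∧ u a = 0) ∧ AnalyticOnNhd ℂ g K ∧
      (∀ z ∈ K, g z ≠ 0) ∧ ∀ᵐ z ∂(volume.restrict K), Real.log ‖u z‖ =
        ∑ a ∈ Z, (analyticOrderNatAt u a : ℝ) * Real.log ‖z - a‖ + Real.log ‖g z‖ := by
  have hfin := (MeromorphicOn.divisor u K).finiteSupport hK
  have hmer (z : ℂ) (hz : z ∈ K) : meromorphicOrderAt u z ≠ ⊤ := by
    rw [(hu z hz).meromorphicOrderAt_eq]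
    simpa using hord z hz
  have hdiv (z : ℂ) (hz : z ∈ K) :
      MeromorphicOn.divisor u K z = (analyticOrderNatAt u z : ℤ) := by
    rw [MeromorphicOn.AnalyticOnNhd.divisor_apply hu hz]
    have := hord z hz
    rw [← Nat.cast_analyticOrderNatAt this]
    simp
  obtain ⟨g, hg, hg0, hfg⟩ := hu.meromorphicOn.extract_zeros_poles (fun z => hmer z z.2) hfin
  have hlog := MeromorphicOn.extract_zeros_poles_log hg0 hfg
  refine ⟨hfin.toFinset, g, ?_, hg, fun z hz => hg0 ⟨z, hz⟩, ?_⟩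
  · intro a
    rw [Set.Finite.mem_toFinset, Function.mem_support]
    constructor
    · intro ha
      have haK : a ∈ K := (MeromorphicOn.divisor u K).supportWithinDomain ha
      refine ⟨haK, ?_⟩
      by_contra h0
      rw [hdiv a haK, analyticOrderNatAt, (hu a haK).analyticOrderAt_eq_zero.2 h0] at ha
      simp at ha
    · rintro ⟨haK, h0⟩ ha
      rw [hdiv a haK] at ha
      have h1 : analyticOrderAt u a = 0 := by
        rw [← Nat.cast_analyticOrderNatAt (hord a haK)]
        exact_mod_cast ha
      exact (hu a haK).analyticOrderAt_eq_zero.1 h1 h0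
  -- The factorisation of `log|u|` holds on a codiscrete subset of `K`, whose complement in `K` is a
  -- null set.
  · have := ae_restrict_le_codiscreteWithin (μ := (volume : Measure ℂ)) hK.measurableSet hlog
    filter_upwards [this] with z hz
    rw [hz, Pi.add_apply]
    congr 1
    rw [finsum_eq_sum_of_support_subset (s := hfin.toFinset), Finset.sum_apply]
    · refine Finset.sum_congr rfl fun a ha => ?_
      have haK : a ∈ K := (MeromorphicOn.divisor u K).supportWithinDomain (by simpa using ha)
      rw [hdiv a haK]
      simp
    · intro a ha
      rw [Set.Finite.coe_toFinset, Function.mem_support]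
      intro h0
      apply ha
      ext w
      simp [h0]

theorem analyticOnNhd_log_norm {K : Set ℂ} {g : ℂ → ℂ} (hg : AnalyticOnNhd ℂ g K)
    (hg0 : ∀ z ∈ K, g z ≠ 0) : ∃ W, IsOpen W ∧ K ⊆ W ∧
      InnerProductSpace.HarmonicOnNhd (fun z => Real.log ‖g z‖) W := by
  refine ⟨{z | InnerProductSpace.HarmonicAt (fun z => Real.log ‖g z‖) z},
    InnerProductSpace.isOpen_setOfPred_harmonicAt _, fun z hz => ?_, fun z hz => hz⟩
  exact (hg z hz).harmonicAt_log_norm (hg0 z hz)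

theorem integrableOn_log_norm {K : Set ℂ} (hK : IsCompact K) {u : ℂ → ℂ}
    (hu : AnalyticOnNhd ℂ u K) (hord : ∀ z ∈ K, analyticOrderAt u z ≠ ⊤) :
    IntegrableOn (fun z => Real.log ‖u z‖) K := by
  obtain ⟨Z, g, -, hg, hg0, hlog⟩ := exists_log_norm_ae_eq hK hu hord
  obtain ⟨W, -, hKW, hW⟩ := analyticOnNhd_log_norm hg hg0
  refine Integrable.congr ?_ (EventuallyEq.symm hlog)
  refine Integrable.add (integrable_finsetSum _ fun a _ => ?_) ?_
  · exact (integrableOn_log_norm_sub hK a).const_mul _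
  · exact (hW.continuousOn.mono hKW).integrableOn_compact hK

/-- The zeros of a holomorphic function are given by the distribution `Δ log |u| / 2π`. -/
theorem integral_log_norm_mul_planeLaplacian_eq_sum {u : ℂ → ℂ} {χ : ℂ → ℝ} (hχ : ContDiff ℝ ∞ χ)
    (hc : HasCompactSupport χ) (hu : AnalyticOnNhd ℂ u (tsupport χ))
    (hord : ∀ z ∈ tsupport χ, analyticOrderAt u z ≠ ⊤) (Z : Finset ℂ)
    (hZ : ∀ a ∈ tsupport χ, u a = 0 → a ∈ Z) :
    ∫ z, Real.log ‖u z‖ * planeLaplacian χ z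
      = 2 * Real.pi * ∑ a ∈ Z, (analyticOrderNatAt u a : ℝ) * χ a := by
  have hK : IsCompact (tsupport χ) := hc
  obtain ⟨Z', g, hZ', hg, hg0, hlog⟩ := exists_log_norm_ae_eq hK hu hord
  obtain ⟨W, hWo, hKW, hW⟩ := analyticOnNhd_log_norm hg hg0
  have hlc : Continuous (planeLaplacian χ) := continuous_planeLaplacian hχ
  have hlt := tsupport_planeLaplacian_subset χ
  have hls : HasCompactSupport (planeLaplacian χ) := hc.mono' (subset_closure.trans hlt)
  have h1 : ∫ z, Real.log ‖u z‖ * planeLaplacian χ z =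
      ∫ z, (∑ a ∈ Z', (analyticOrderNatAt u a : ℝ) * (Real.log ‖z - a‖ * planeLaplacian χ z)
        + Real.log ‖g z‖ * planeLaplacian χ z) := by
    refine integral_congr_ae ?_
    filter_upwards [(ae_restrict_iff' hK.measurableSet).1 hlog] with z hz
    by_cases hzK : z ∈ tsupport χ
    · simp only [hz hzK, add_mul, Finset.sum_mul, mul_assoc]
    · simp [image_eq_zero_of_notMem_tsupport (fun h => hzK (hlt h))]
  have hi (a : ℂ) : Integrable (fun z => Real.log ‖z - a‖ * planeLaplacian χ z) :=
    integrable_mul_of_integrableOn hlc hls (integrableOn_log_norm_sub hls a)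
  rw [h1, integral_add (integrable_finsetSum _ fun a _ => (hi a).const_mul _)
    (integrable_mul_of_tsupport_subset hWo hW.continuousOn hlc hls (hlt.trans hKW)),
    integral_finsetSum _ fun a _ => (hi a).const_mul _,
    integral_mul_planeLaplacian_eq_zero hWo hW hχ hc hKW, add_zero]
  simp_rw [integral_const_mul, integral_log_norm_sub_mul_planeLaplacian hχ hc]
  -- The other points of `Z` contribute nothing: off the support `χ` vanishes, and on it such a
  -- point is not a zero and has order `0`.
  have hsub : Z' ⊆ Z := fun a ha => hZ a ((hZ' a).1 ha).1 ((hZ' a).1 ha).2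
  rw [Finset.mul_sum, ← Finset.sum_subset hsub]
  · exact Finset.sum_congr rfl fun a _ => by ring
  · intro a _ ha
    by_cases haK : a ∈ tsupport χ
    · have h0 : u a ≠ 0 := fun h => ha ((hZ' a).2 ⟨haK, h⟩)
      simp [analyticOrderNatAt, (hu a haK).analyticOrderAt_eq_zero.2 h0]
    · simp [image_eq_zero_of_notMem_tsupport haK]

end ZeroCounting

/-! ### Jensen's inequality on circles and discs. -/

section Jensen

/-- In Jensen's formula each zero contributes its multiplicity times `log(R/|z - c|)`, and this is
nonnegative in the disc. -/
theorem log_norm_le_circleAverage {c : ℂ} {R : ℝ} {u : ℂ → ℂ} (hR : 0 < R)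
    (hu : AnalyticOnNhd ℂ u (Metric.closedBall c R)) (hc : u c ≠ 0) :
    Real.log ‖u c‖ ≤ Real.circleAverage (fun z => Real.log ‖u z‖) c R := by
  have hu' : AnalyticOnNhd ℂ u (Metric.closedBall c |R|) := by rwa [abs_of_pos hR]
  rw [hu'.circleAverage_log_norm hR.ne' hc]
  refine le_add_of_nonneg_left (finsum_nonneg fun z => ?_)
  by_cases hz : z ∈ Metric.closedBall c |R|
  · have h1 : 0 ≤ MeromorphicOn.divisor u (Metric.closedBall c |R|) z := by
      rw [MeromorphicOn.AnalyticOnNhd.divisor_apply hu' hz]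
      cases h : analyticOrderAt u z <;> simp
    -- At the centre the term is zero by the conventions `0⁻¹ = 0` and `log 0 = 0`.
    by_cases hzc : z = c
    · simp [hzc]
    refine mul_nonneg (by exact_mod_cast h1) (Real.log_nonneg ?_)
    rw [← div_eq_mul_inv, one_le_div (norm_pos_iff.2 (sub_ne_zero.2 (Ne.symm hzc)))]
    rw [abs_of_pos hR, Metric.mem_closedBall, dist_comm, dist_eq_norm] at hz
    exact hz
  · rw [Function.locallyFinsuppWithin.apply_eq_zero_of_notMem _ hz]
    simp

/-- The interval `(-π, π)` is that of polar coordinates. As `M - log|u| ≥ 0`, lower integrals can be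
used, so integrability over the disc need not be known beforehand. -/
theorem setLIntegral_circle_le {c : ℂ} {R M : ℝ} {u : ℂ → ℂ} (hR : 0 < R)
    (hu : AnalyticOnNhd ℂ u (Metric.closedBall c R)) (hc : u c ≠ 0)
    (hM : ∀ z ∈ Metric.closedBall c R, Real.log ‖u z‖ ≤ M) :
    ∫⁻ θ in Ioo (-Real.pi) Real.pi, ENNReal.ofReal (M - Real.log ‖u (circleMap c R θ)‖)
      ≤ ENNReal.ofReal (2 * Real.pi * (M - Real.log ‖u c‖)) := by
  have hpi := Real.pi_pos
  have hci : CircleIntegrable (fun z => Real.log ‖u z‖) c R := by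
    apply MeromorphicOn.circleIntegrable_log_norm
    intro z hz
    refine (hu z ?_).meromorphicAt
    rw [abs_of_pos hR] at hz
    exact Metric.sphere_subset_closedBall hz
  have hper : Function.Periodic (fun θ => Real.log ‖u (circleMap c R θ)‖) (2 * Real.pi) :=
    fun θ => by simp only [periodic_circleMap c R θ]
  have hii : IntervalIntegrable (fun θ => Real.log ‖u (circleMap c R θ)‖) volume (-Real.pi) Real.pi := by
    exact hper.intervalIntegrable (t := 0) (by positivity) (by simpa [CircleIntegrable] using hci) _ _
  have hint : IntegrableOn (fun θ => M - Real.log ‖u (circleMap c R θ)‖) (Ioo (-Real.pi) Real.pi) := by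
    refine Integrable.sub (by simp) ?_
    exact ((intervalIntegrable_iff_integrableOn_Ioo_of_le (by linarith)).1 hii)
  rw [← ofReal_integral_eq_lintegral_ofReal hint (Eventually.of_forall fun θ => ?_)]
  · apply ENNReal.ofReal_le_ofReal
    rw [← integral_Ioc_eq_integral_Ioo, ← intervalIntegral.integral_of_le (by linarith),
      intervalIntegral.integral_sub (by simp) hii]
    have h1 : ∫ θ in (-Real.pi)..Real.pi, Real.log ‖u (circleMap c R θ)‖
        = 2 * Real.pi * Real.circleAverage (fun z => Real.log ‖u z‖) c R := by
      rw [Real.circleAverage_def, smul_eq_mul, mul_inv_cancel_left₀ (by positivity)]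
      have := hper.intervalIntegral_add_eq (-Real.pi) 0
      rw [zero_add] at this
      rw [← this]
      congr 1
      ring
    rw [h1]
    have := log_norm_le_circleAverage hR hu hc
    simp only [intervalIntegral.integral_const, smul_eq_mul]
    nlinarith
  · exact sub_nonneg.2 (hM _ (circleMap_mem_closedBall c hR.le θ))

/-- The sub-mean value property of `log |u|` on discs. -/
theorem setLIntegral_ball_sub_log_norm_le {c : ℂ} {R M : ℝ} {u : ℂ → ℂ} (hR : 0 < R)
    (hu : AnalyticOnNhd ℂ u (Metric.closedBall c R)) (hc : u c ≠ 0)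
    (hM : ∀ z ∈ Metric.closedBall c R, Real.log ‖u z‖ ≤ M) :
    ∫⁻ z in Metric.ball c R, ENNReal.ofReal (M - Real.log ‖u z‖)
      ≤ ENNReal.ofReal (Real.pi * R ^ 2 * (M - Real.log ‖u c‖)) := by
  classical
  have hpi := Real.pi_pos
  have hMc : 0 ≤ M - Real.log ‖u c‖ := sub_nonneg.2 (hM c (Metric.mem_closedBall_self hR.le))
  -- Nothing is known about `u` off the disc, not even measurability; `v` agrees with `u` on the
  -- disc and is measurable on the whole plane.
  set v : ℂ → ℂ := (Metric.ball c R).piecewise u 1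
  have hvm : Measurable v :=
    (hu.continuousOn.mono Metric.ball_subset_closedBall).measurable_piecewise continuousOn_const
      Metric.isOpen_ball.measurableSet
  have hvu (z : ℂ) (hz : z ∈ Metric.ball c R) : v z = u z := piecewise_eq_of_mem _ _ _ hz
  clear_value v
  set F : ℂ → ENNReal := fun z => (Metric.ball 0 R).indicator
    (fun z => ENNReal.ofReal (M - Real.log ‖v (c + z)‖)) z with hF
  have hFm : Measurable F := by
    refine Measurable.indicator ?_ Metric.isOpen_ball.measurableSet
    fun_prop
  have h1 : ∫⁻ z in Metric.ball c R, ENNReal.ofReal (M - Real.log ‖u z‖) = ∫⁻ z, F z := by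
    rw [← lintegral_indicator Metric.isOpen_ball.measurableSet,
      ← lintegral_add_left_eq_self _ c]
    refine lintegral_congr fun z => ?_
    by_cases hz : z ∈ Metric.ball (0 : ℂ) R
    · have hz' : c + z ∈ Metric.ball c R := by simpa using hz
      simp [hF, indicator_of_mem hz, indicator_of_mem hz', hvu _ hz']
    · have hz' : c + z ∉ Metric.ball c R := by simpa using hz
      simp [hF, indicator_of_notMem hz, indicator_of_notMem hz']
  rw [h1, ← Complex.lintegral_comp_polarCoord_symm, polarCoord_target, Measure.volume_eq_prod,
    ← Measure.prod_restrict, lintegral_prod]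
  · have h2 : ∀ r ∈ Ioi (0 : ℝ), ∫⁻ θ in Ioo (-Real.pi) Real.pi,
        ENNReal.ofReal (r, θ).1 • F (Complex.polarCoord.symm (r, θ))
        ≤ (Ioo 0 R).indicator (fun r => ENNReal.ofReal (2 * Real.pi * (M - Real.log ‖u c‖) * r)) r := by
      intro r hr
      have hr : 0 < r := hr
      have e (θ : ℝ) : c + Complex.polarCoord.symm (r, θ) = circleMap c r θ := by
        rw [Complex.polarCoord_symm_apply, circleMap, Complex.exp_mul_I]
        push_cast
        ring
      have en (θ : ℝ) : ‖Complex.polarCoord.symm (r, θ)‖ = r := by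
        rw [Complex.norm_polarCoord_symm, abs_of_pos hr]
      by_cases hrR : r < R
      · rw [indicator_of_mem (by exact ⟨hr, hrR⟩)]
        have hsub : Metric.closedBall c r ⊆ Metric.closedBall c R :=
          Metric.closedBall_subset_closedBall hrR.le
        have h3 := setLIntegral_circle_le hr (hu.mono hsub) hc fun z hz => hM z (hsub hz)
        calc _ = ∫⁻ θ in Ioo (-Real.pi) Real.pi, ENNReal.ofReal r *
              ENNReal.ofReal (M - Real.log ‖u (circleMap c r θ)‖) := by
              refine lintegral_congr fun θ => ?_
              have hz : Complex.polarCoord.symm (r, θ) ∈ Metric.ball (0 : ℂ) R := by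
                rw [mem_ball_zero_iff, en]; exact hrR
              have hz' : circleMap c r θ ∈ Metric.ball c R := by
                rw [← e]; simpa using hz
              have hF' : F (Complex.polarCoord.symm (r, θ)) =
                  ENNReal.ofReal (M - Real.log ‖u (circleMap c r θ)‖) := by
                simp only [hF, indicator_of_mem hz]
                rw [e, hvu _ hz']
              rw [hF', smul_eq_mul]
          _ ≤ ENNReal.ofReal r * ENNReal.ofReal (2 * Real.pi * (M - Real.log ‖u c‖)) := by
              rw [lintegral_const_mul' _ _ ENNReal.ofReal_ne_top]
              gcongr
          _ = _ := by rw [← ENNReal.ofReal_mul hr.le, mul_comm]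
      · have : ∀ θ, F (Complex.polarCoord.symm (r, θ)) = 0 := by
          intro θ
          refine indicator_of_notMem ?_ _
          rw [mem_ball_zero_iff, en]
          exact hrR
        simp only [this, smul_zero, lintegral_zero, zero_le]
    refine (setLIntegral_mono' measurableSet_Ioi h2).trans ?_
    rw [setLIntegral_indicator measurableSet_Ioo,
      inter_eq_left.2 (fun x hx => hx.1), ← ofReal_integral_eq_lintegral_ofReal]
    · apply ENNReal.ofReal_le_ofReal
      rw [integral_const_mul, ← integral_Ioc_eq_integral_Ioo,
        ← intervalIntegral.integral_of_le hR.le, integral_id]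
      apply le_of_eq
      ring
    · exact (Continuous.integrableOn_Icc (by fun_prop)).mono_set Ioo_subset_Icc_self
    · filter_upwards [ae_restrict_mem measurableSet_Ioo] with r hr
      have := hr.1
      simp only [Pi.zero_apply]
      positivity
  · refine Measurable.aemeasurable ?_
    have : Measurable fun p : ℝ × ℝ => F (Complex.polarCoord.symm p) :=
      hFm.comp (by
        have : ∀ p : ℝ × ℝ, Complex.polarCoord.symm p =
            (p.1 : ℂ) * (Real.cos p.2 + Real.sin p.2 * Complex.I) :=
          Complex.polarCoord_symm_apply
        rw [funext this]
        fun_prop)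
    simp only [smul_eq_mul]
    exact Measurable.mul (by fun_prop) this

end Jensen

/-! ### Smooth cutoffs at a given scale. -/

section Mollification

theorem fderiv_integral_mul_sub {f g : ℂ → ℝ} (hf : LocallyIntegrable f) (hg : ContDiff ℝ 1 g)
    (hc : HasCompactSupport g) (x v : ℂ) :
    fderiv ℝ (fun x => ∫ t, f t * g (x - t)) x v = ∫ t, f t * fderiv ℝ g (x - t) v := by
  have h := hc.hasFDerivAt_convolution_right (ContinuousLinearMap.mul ℝ ℝ) hf hg x
  have e : (fun x => ∫ t, f t * g (x - t)) = convolution f g (ContinuousLinearMap.mul ℝ ℝ) := rfl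
  rw [e, h.fderiv, convolution_precompR_apply (ContinuousLinearMap.mul ℝ ℝ) hf (hc.fderiv ℝ)
    (hg.continuous_fderiv (by norm_num))]
  rfl

theorem planeLaplacian_integral_mul_sub {f g : ℂ → ℝ} (hf : LocallyIntegrable f)
    (hg : ContDiff ℝ ∞ g) (hc : HasCompactSupport g) (x : ℂ) :
    planeLaplacian (fun x => ∫ t, f t * g (x - t)) x = ∫ t, f t * planeLaplacian g (x - t) := by
  have hd (v : ℂ) : ContDiff ℝ 1 (fun w => fderiv ℝ g w v) :=
    contDiff_iff_contDiffAt.2 fun w => contDiffAt_fderiv_apply (n := 2)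
      (contDiff_infty.1 hg 2).contDiffAt (by norm_num) v
  have key (v : ℂ) : fderiv ℝ (fun w => fderiv ℝ (fun x => ∫ t, f t * g (x - t)) w v) x v
      = ∫ t, f t * fderiv ℝ (fun w => fderiv ℝ g w v) (x - t) v := by
    simp_rw [fun w => fderiv_integral_mul_sub hf (contDiff_infty.1 hg 1) hc w v]
    exact fderiv_integral_mul_sub hf (hd v) (hc.fderiv_apply ℝ v) x v
  have hint (v : ℂ) : Integrable fun t => f t * fderiv ℝ (fun w => fderiv ℝ g w v) (x - t) v :=
    ((hc.fderiv_apply ℝ v).fderiv_apply ℝ v).convolutionExists_right (ContinuousLinearMap.mul ℝ ℝ) hf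
      (((hd v).continuous_fderiv (by norm_num)).clm_apply continuous_const) x
  simp only [planeLaplacian, mul_add]
  rw [key, key, integral_add (hint _) (hint _)]

/-- The indicator function of a set can be smoothed at any scale `h`, with a Laplacian of size
`O(h⁻²)`, uniformly in the set. -/
theorem exists_mollified_indicator : ∃ C : ℝ, 0 ≤ C ∧ ∀ (A : Set ℂ), MeasurableSet A →
    ∀ h : ℝ, 0 < h → ∃ χ : ℂ → ℝ, ContDiff ℝ ∞ χ ∧ (∀ z, 0 ≤ χ z ∧ χ z ≤ 1) ∧
      (∀ z, Metric.closedBall z h ⊆ A → χ z = 1) ∧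
      (∀ z, Disjoint (Metric.closedBall z h) A → χ z = 0) ∧
      ∀ z, |planeLaplacian χ z| ≤ C / h ^ 2 := by
  let b : ContDiffBump (0 : ℂ) := ⟨1 / 2, 1, by norm_num, by norm_num⟩
  set k : ℂ → ℝ := b.normed volume with hk
  have hks : ContDiff ℝ ∞ k := b.contDiff_normed
  have hkc : HasCompactSupport k := b.hasCompactSupport_normed
  have hk0 (z : ℂ) : 0 ≤ k z := b.nonneg_normed z
  have hkz (z : ℂ) (hz : 1 ≤ ‖z‖) : k z = 0 := by
    have : z ∉ Function.support k := by
      rw [hk, b.support_normed_eq]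
      simpa using hz
    simpa using this
  have hkint : Integrable k := hks.continuous.integrable_of_hasCompactSupport hkc
  have hk1 : ∫ z, k z = 1 := b.integral_normed
  clear_value k
  have hlc : Continuous (planeLaplacian k) := continuous_planeLaplacian hks
  have hls : HasCompactSupport (planeLaplacian k) :=
    hkc.mono' (subset_closure.trans (tsupport_planeLaplacian_subset k))
  have hlint : Integrable (planeLaplacian k) := hlc.integrable_of_hasCompactSupport hls
  -- The constant is the `L¹` norm of the Laplacian of the unit kernel, hence independent of `A` and
  -- `h`.
  refine ⟨∫ z, |planeLaplacian k z|, integral_nonneg fun z => abs_nonneg _, fun A hA h hh => ?_⟩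
  -- Rescaling `A` by `1/h` lets one kernel of radius `1` serve for every `h`.
  set B : Set ℂ := {w | h • w ∈ A} with hB
  have hBm : MeasurableSet B := hA.preimage (measurable_const_smul h)
  set f : ℂ → ℝ := B.indicator 1 with hf
  have hf01 (t : ℂ) : 0 ≤ f t ∧ f t ≤ 1 := by
    by_cases ht : t ∈ B <;> simp [hf, ht]
  have hfl : LocallyIntegrable f := (locallyIntegrable_const (1 : ℝ)).indicator hBm
  set η : ℂ → ℝ := fun x => ∫ t, f t * k (x - t) with hη
  have hηs : ContDiff ℝ ∞ η := hkc.contDiff_convolution_right (ContinuousLinearMap.mul ℝ ℝ) hfl hks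
  have hmul (g : ℂ → ℝ) (hg : Integrable g) (x : ℂ) : Integrable fun t => f t * g (x - t) :=
    (hg.comp_sub_left x).bdd_mul (c := 1) hfl.aestronglyMeasurable
      (Eventually.of_forall fun t => by rw [Real.norm_of_nonneg (hf01 t).1]; exact (hf01 t).2)
  have hη0 (x : ℂ) : 0 ≤ η x := integral_nonneg fun t => mul_nonneg (hf01 t).1 (hk0 _)
  have hη1 (x : ℂ) : η x ≤ 1 := by
    rw [← hk1, ← integral_sub_left_eq_self k volume x]
    exact integral_mono (hmul k hkint x) (hkint.comp_sub_left x)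
      fun t => mul_le_of_le_one_left (hk0 _) (hf01 t).2
  have hηl (x : ℂ) : |planeLaplacian η x| ≤ ∫ z, |planeLaplacian k z| := by
    rw [hη, planeLaplacian_integral_mul_sub hfl hks hkc]
    refine (abs_integral_le_integral_abs).trans ?_
    rw [← integral_sub_left_eq_self (fun z => |planeLaplacian k z|) volume x]
    refine integral_mono (hmul _ hlint x).abs (hlint.abs.comp_sub_left x) fun t => ?_
    simp only [abs_mul]
    exact mul_le_of_le_one_left (abs_nonneg _) (by rw [abs_of_nonneg (hf01 t).1]; exact (hf01 t).2)
  have hmem (z t : ℂ) (ht : ‖h⁻¹ • z - t‖ < 1) : h • t ∈ Metric.closedBall z h := by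
    rw [Metric.mem_closedBall, dist_comm, dist_eq_norm]
    have : z - h • t = h • (h⁻¹ • z - t) := by rw [smul_sub, smul_inv_smul₀ hh.ne']
    rw [this, norm_smul, Real.norm_of_nonneg hh.le]
    nlinarith
  refine ⟨fun z => η (h⁻¹ • (z - 0)), hηs.comp (by fun_prop), fun z => ⟨hη0 _, hη1 _⟩, ?_, ?_, ?_⟩
  · intro z hz
    simp only [sub_zero]
    rw [← hk1, ← integral_sub_left_eq_self k volume (h⁻¹ • z)]
    refine integral_congr_ae (Eventually.of_forall fun t => ?_)
    by_cases ht : ‖h⁻¹ • z - t‖ < 1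
    · have : t ∈ B := hz (hmem z t ht)
      simp [hf, this]
    · simp only [hkz _ (not_lt.1 ht), mul_zero]
  · intro z hz
    simp only [sub_zero]
    rw [← integral_zero ℂ ℝ]
    refine integral_congr_ae (Eventually.of_forall fun t => ?_)
    by_cases ht : ‖h⁻¹ • z - t‖ < 1
    · have : t ∉ B := fun h' => Set.disjoint_left.1 hz (hmem z t ht) h'
      simp [hf, this]
    · simp only [hkz _ (not_lt.1 ht), mul_zero]
  · intro z
    rw [planeLaplacian_comp_smul_sub hηs, abs_mul, abs_of_nonneg (by positivity), inv_pow,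
      div_eq_inv_mul]
    gcongr
    exact hηl _

end Mollification

/-! ### The maximum of the real parts. -/

section MaxRe

variable {N : ℕ} {φ : Fin N → ℂ → ℂ}

theorem re_le_maxRe (φ : Fin N → ℂ → ℂ) (z : ℂ) (j : Fin N) : (φ j z).re ≤ maxRe φ z :=
  le_ciSup (f := fun j => (φ j z).re) (Set.finite_range _).bddAbove j

theorem exists_re_eq_maxRe (hN : 0 < N) (φ : Fin N → ℂ → ℂ) (z : ℂ) :
    ∃ j, (φ j z).re = maxRe φ z := by
  have : Nonempty (Fin N) := ⟨⟨0, hN⟩⟩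
  exact exists_eq_ciSup_of_finite (f := fun j => (φ j z).re)

theorem maxRe_le (hN : 0 < N) {z : ℂ} {c : ℝ} (h : ∀ j, (φ j z).re ≤ c) : maxRe φ z ≤ c := by
  obtain ⟨j, hj⟩ := exists_re_eq_maxRe hN φ z
  exact hj ▸ h j

theorem maxRe_eq_of_le (hN : 0 < N) {z : ℂ} {j : Fin N} (h : ∀ l, (φ l z).re ≤ (φ j z).re) :
    maxRe φ z = (φ j z).re :=
  le_antisymm (maxRe_le hN h) (re_le_maxRe φ z j)

theorem continuousOn_maxRe (hN : 0 < N) {U : Set ℂ} (hφ : ∀ j, ContinuousOn (φ j) U) :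
    ContinuousOn (maxRe φ) U := by
  have : Nonempty (Fin N) := ⟨⟨0, hN⟩⟩
  have e : maxRe φ = fun z => Finset.univ.sup' Finset.univ_nonempty fun j => (φ j z).re := by
    ext z
    exact (Finset.sup'_univ_eq_ciSup _).symm
  rw [e]
  exact ContinuousOn.finset_sup'_apply _ fun j _ => Complex.continuous_re.comp_continuousOn (hφ j)

end MaxRe

/-! ### Subharmonicity of the maximum through log-sum-exp. -/

section Softmax

/-- The Laplacian is the variance of the gradients of the `a j` under the weights `exp(a j) / ∑
exp(a j)`: the second derivatives of the `a j` cancel by harmonicity, and Cauchy–Schwarz gives the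
sign. -/
theorem planeLaplacian_log_sum_exp_nonneg {ι : Type*} [Fintype ι] [Nonempty ι] {U : Set ℂ}
    (hU : IsOpen U) {a : ι → ℂ → ℝ} (ha : ∀ j, InnerProductSpace.HarmonicOnNhd (a j) U) {z : ℂ}
    (hz : z ∈ U) : 0 ≤ planeLaplacian (fun w => Real.log (∑ j, Real.exp (a j w))) z := by
  set E : ℂ → ℝ := fun w => ∑ j, Real.exp (a j w) with hE
  have hEpos (w : ℂ) : 0 < E w := Finset.sum_pos (fun j _ => Real.exp_pos _) Finset.univ_nonempty
  have had (j : ι) (w : ℂ) (hw : w ∈ U) : HasFDerivAt (a j) (fderiv ℝ (a j) w) w :=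
    ((ha j w hw).1.differentiableAt (by norm_num)).hasFDerivAt
  have hEd (w : ℂ) (hw : w ∈ U) :
      HasFDerivAt E (∑ j, Real.exp (a j w) • fderiv ℝ (a j) w) w :=
    HasFDerivAt.fun_sum fun j _ => (had j w hw).exp
  have h1 (v w : ℂ) (hw : w ∈ U) : fderiv ℝ (fun w => Real.log (E w)) w v
      = (∑ j, Real.exp (a j w) * fderiv ℝ (a j) w v) * (E w)⁻¹ := by
    rw [((hEd w hw).log (hEpos w).ne').fderiv]
    simp [mul_comm]
  have h2 (v : ℂ) : fderiv ℝ (fun w => fderiv ℝ (fun w => Real.log (E w)) w v) z v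
      = (∑ j, Real.exp (a j z) * ((fderiv ℝ (a j) z v) ^ 2 +
          fderiv ℝ (fun w => fderiv ℝ (a j) w v) z v)) * (E z)⁻¹
        - (∑ j, Real.exp (a j z) * fderiv ℝ (a j) z v) ^ 2 * ((E z)⁻¹) ^ 2 := by
    have hev : (fun w => fderiv ℝ (fun w => Real.log (E w)) w v) =ᶠ[𝓝 z]
        fun w => (∑ j, Real.exp (a j w) * fderiv ℝ (a j) w v) * (E w)⁻¹ :=
      by filter_upwards [hU.mem_nhds hz] with w hw using h1 v w hw
    rw [hev.fderiv_eq]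
    have hn : HasFDerivAt (fun w => ∑ j, Real.exp (a j w) * fderiv ℝ (a j) w v) _ z :=
      HasFDerivAt.fun_sum fun j _ => ((had j z hz).exp).mul
        (((contDiffAt_fderiv_apply (m := 1) (ha j z hz).1 (by norm_num) v).differentiableAt
          (by norm_num)).hasFDerivAt)
    have hi : HasFDerivAt (fun w => (E w)⁻¹) _ z :=
      (hasDerivAt_inv (hEpos z).ne').comp_hasFDerivAt z (hEd z hz)
    have hd : HasFDerivAt (fun w => (∑ j, Real.exp (a j w) * fderiv ℝ (a j) w v) * (E w)⁻¹) _ z :=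
      hn.mul hi
    rw [hd.fderiv]
    simp only [add_apply, smul_apply, sum_apply, smul_eq_mul]
    have e1 : ∀ j, Real.exp (a j z) * fderiv ℝ (fun w => fderiv ℝ (a j) w v) z v +
        fderiv ℝ (a j) z v * (Real.exp (a j z) * fderiv ℝ (a j) z v)
        = Real.exp (a j z) * ((fderiv ℝ (a j) z v) ^ 2 +
          fderiv ℝ (fun w => fderiv ℝ (a j) w v) z v) := fun j => by ring
    simp only [e1]
    ring
  have hcs (v : ℂ) : (∑ j, Real.exp (a j z) * fderiv ℝ (a j) z v) ^ 2
      ≤ E z * ∑ j, Real.exp (a j z) * (fderiv ℝ (a j) z v) ^ 2 := by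
    refine Finset.sum_sq_le_sum_mul_sum_of_sq_le_mul _ (fun j _ => (Real.exp_pos _).le)
      (fun j _ => by positivity) fun j _ => le_of_eq (by ring)
  have hharm (j : ι) : fderiv ℝ (fun w => fderiv ℝ (a j) w 1) z 1 +
      fderiv ℝ (fun w => fderiv ℝ (a j) w Complex.I) z Complex.I = 0 :=
    planeLaplacian_eq_zero_of_harmonicAt (ha j z hz)
  rw [planeLaplacian, h2, h2]
  have hsum : ∑ j, Real.exp (a j z) * fderiv ℝ (fun w => fderiv ℝ (a j) w 1) z 1 +
      ∑ j, Real.exp (a j z) * fderiv ℝ (fun w => fderiv ℝ (a j) w Complex.I) z Complex.I = 0 := by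
    rw [← Finset.sum_add_distrib]
    refine Finset.sum_eq_zero fun j _ => ?_
    rw [← mul_add, hharm, mul_zero]
  have c1 := hcs 1
  have c2 := hcs Complex.I
  simp only [mul_add, Finset.sum_add_distrib]
  have hEi : 0 < (E z)⁻¹ := inv_pos.2 (hEpos z)
  have hm : E z * (E z)⁻¹ = 1 := mul_inv_cancel₀ (hEpos z).ne'
  have key (S Q : ℝ) (h : S ^ 2 ≤ E z * Q) : 0 ≤ Q * (E z)⁻¹ - S ^ 2 * (E z)⁻¹ ^ 2 := by
    have : Q * (E z)⁻¹ - S ^ 2 * (E z)⁻¹ ^ 2 = (E z * Q - S ^ 2) * (E z)⁻¹ ^ 2 := by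
      have : Q * (E z)⁻¹ = Q * (E z)⁻¹ * (E z * (E z)⁻¹) := by rw [hm, mul_one]
      rw [this]
      ring
    rw [this]
    exact mul_nonneg (sub_nonneg.2 h) (by positivity)
  have k1 := key _ _ c1
  have k2 := key _ _ c2
  have : (E z)⁻¹ * (∑ j, Real.exp (a j z) * fderiv ℝ (fun w => fderiv ℝ (a j) w 1) z 1 +
      ∑ j, Real.exp (a j z) * fderiv ℝ (fun w => fderiv ℝ (a j) w Complex.I) z Complex.I) = 0 := by
    rw [hsum, mul_zero]
  linarith

theorem contDiffOn_log_sum_exp {ι : Type*} [Fintype ι] [Nonempty ι] {U : Set ℂ}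
    {a : ι → ℂ → ℝ} (ha : ∀ j, InnerProductSpace.HarmonicOnNhd (a j) U) :
    ContDiffOn ℝ 2 (fun w => Real.log (∑ j, Real.exp (a j w))) U :=
  ContDiffOn.log (ContDiffOn.sum fun j _ => (ha j).contDiffOn.exp) fun _ _ =>
    (Finset.sum_pos (fun _ _ => Real.exp_pos _) Finset.univ_nonempty).ne'

/-- The maximum of finitely many harmonic functions is subharmonic in the sense of
distributions. -/
theorem integral_maxRe_mul_planeLaplacian_nonneg {N : ℕ} (hN : 0 < N) {φ : Fin N → ℂ → ℂ}
    {U : Set ℂ} (hU : IsOpen U) (hφ : ∀ j, DifferentiableOn ℂ (φ j) U) {χ : ℂ → ℝ}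
    (hχ : ContDiff ℝ ∞ χ) (hc : HasCompactSupport χ) (hχU : tsupport χ ⊆ U) (h0 : ∀ z, 0 ≤ χ z) :
    0 ≤ ∫ z, maxRe φ z * planeLaplacian χ z := by
  have : Nonempty (Fin N) := ⟨⟨0, hN⟩⟩
  have hlc : Continuous (planeLaplacian χ) := continuous_planeLaplacian hχ
  have hlt := tsupport_planeLaplacian_subset χ
  have hls : HasCompactSupport (planeLaplacian χ) := hc.mono' (subset_closure.trans hlt)
  have hlint : Integrable (planeLaplacian χ) := hlc.integrable_of_hasCompactSupport hls
  set I : ℝ := ∫ z, |planeLaplacian χ z|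
  -- With `F = log ∑ exp(Re φ_j / h)` one has `Ψ ≤ hF ≤ Ψ + h log N`, so replacing `hF` by `Ψ` costs
  -- at most `h log N` times the `L¹` norm of `Δχ`.
  have key : ∀ h : ℝ, 0 < h → -(h * (Real.log N * I)) ≤ ∫ z, maxRe φ z * planeLaplacian χ z := by
    intro h hh
    set a : Fin N → ℂ → ℝ := fun j z => (φ j z / h).re with ha
    have hh' (j : Fin N) (z : ℂ) : a j z = (φ j z).re / h := Complex.div_ofReal_re _ _
    have harm (j : Fin N) : InnerProductSpace.HarmonicOnNhd (a j) U := fun z hz =>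
      (((hφ j).analyticAt (hU.mem_nhds hz)).div_const).harmonicAt_re
    set F : ℂ → ℝ := fun w => Real.log (∑ j, Real.exp (a j w)) with hF
    have hFc : ContDiffOn ℝ 2 F U := contDiffOn_log_sum_exp harm
    have hF0 : 0 ≤ ∫ z, F z * planeLaplacian χ z := by
      rw [integral_mul_planeLaplacian hU hFc hχ hc hχU]
      refine integral_nonneg fun z => ?_
      by_cases hz : z ∈ tsupport χ
      · exact mul_nonneg (planeLaplacian_log_sum_exp_nonneg hU harm (hχU hz)) (h0 z)
      · simp [image_eq_zero_of_notMem_tsupport hz]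
    have hlow (z : ℂ) : maxRe φ z ≤ h * F z := by
      refine maxRe_le hN fun j => ?_
      have : a j z ≤ F z := by
        rw [hF,
          Real.le_log_iff_exp_le (Finset.sum_pos (fun j _ => Real.exp_pos _) Finset.univ_nonempty)]
        exact Finset.single_le_sum (f := fun j => Real.exp (a j z)) (fun j _ => (Real.exp_pos _).le)
          (Finset.mem_univ j)
      rw [hh', div_le_iff₀ hh] at this
      linarith
    have hup (z : ℂ) : h * F z ≤ maxRe φ z + h * Real.log N := by
      have : F z ≤ maxRe φ z / h + Real.log N := by
        rw [hF,
          Real.log_le_iff_le_exp (Finset.sum_pos (fun j _ => Real.exp_pos _) Finset.univ_nonempty),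
          Real.exp_add, Real.exp_log (by exact_mod_cast hN)]
        refine (Finset.sum_le_card_nsmul _ _ (Real.exp (maxRe φ z / h)) fun j _ => ?_).trans ?_
        · rw [hh']
          have := re_le_maxRe φ z j
          gcongr
        · simp [mul_comm]
      calc h * F z ≤ h * (maxRe φ z / h + Real.log N) := by gcongr
        _ = _ := by field_simp
    have hi1 : Integrable fun z => maxRe φ z * planeLaplacian χ z :=
      integrable_mul_of_tsupport_subset hU (continuousOn_maxRe hN fun j => (hφ j).continuousOn) hlc
        hls (hlt.trans hχU)
    have hi2 : Integrable fun z => F z * planeLaplacian χ z :=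
      integrable_mul_of_tsupport_subset hU hFc.continuousOn hlc hls (hlt.trans hχU)
    have hb : ∫ z, (h * (F z * planeLaplacian χ z) - maxRe φ z * planeLaplacian χ z)
        ≤ ∫ z, (h * Real.log N) * |planeLaplacian χ z| := by
      refine integral_mono ((hi2.const_mul h).sub hi1) (hlint.abs.const_mul _) fun z => ?_
      have e : h * (F z * planeLaplacian χ z) - maxRe φ z * planeLaplacian χ z
        = (h * F z - maxRe φ z) * planeLaplacian χ z := by ring
      simp only [e]
      refine (le_abs_self _).trans ?_
      rw [abs_mul, abs_of_nonneg (sub_nonneg.2 (hlow z))]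
      gcongr
      linarith [hup z]
    rw [integral_sub (hi2.const_mul h) hi1, integral_const_mul, integral_const_mul] at hb
    have := mul_nonneg hh.le hF0
    linarith
  have hlim : Tendsto (fun h : ℝ => -(h * (Real.log N * I))) (𝓝[>] 0) (𝓝 0) := by
    have : Tendsto (fun h : ℝ => -(h * (Real.log N * I))) (𝓝 0) (𝓝 (-(0 * (Real.log N * I)))) :=
      Continuous.tendsto (by fun_prop) 0
    rw [zero_mul, neg_zero] at this
    exact this.mono_left nhdsWithin_le_nhds
  refine le_of_tendsto hlim ?_
  filter_upwards [self_mem_nhdsWithin] with h hh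
  exact key h hh

end Softmax

/-! ### Positive distributions are Radon measures. -/

section PositiveDistributions

open CompactlySupported

/-- The restriction of a test function on `Ω` to a compactly supported continuous function on the
subtype `Ω`. -/
noncomputable def TestFunction.toCompactlySupported (Ω : Opens ℂ) : 𝓓(Ω, ℝ) →ₗ[ℝ] C_c(Ω, ℝ) where
  toFun χ :=
    { toFun := fun x => χ x
      continuous_toFun := χ.continuous.comp continuous_subtype_val
      hasCompactSupport' := by
        refine HasCompactSupport.intro
          (K := ((↑) : Ω → ℂ) ⁻¹' tsupport χ) ?_ fun x hx => image_eq_zero_of_notMem_tsupport hx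
        exact (Topology.IsInducing.subtypeVal.isCompact_preimage_iff
          (by simpa using χ.tsupport_subset)).2 χ.hasCompactSupport }
  map_add' _ _ := rfl
  map_smul' _ _ := rfl

theorem TestFunction.toCompactlySupported_apply {Ω : Opens ℂ} (χ : 𝓓(Ω, ℝ)) (x : Ω) :
    TestFunction.toCompactlySupported Ω χ x = χ x := rfl

theorem TestFunction.toCompactlySupported_injective (Ω : Opens ℂ) :
    Function.Injective (TestFunction.toCompactlySupported Ω) := by
  intro χ₁ χ₂ h
  ext z
  by_cases hz : z ∈ Ω
  · exact DFunLike.congr_fun h (⟨z, hz⟩ : Ω)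
  · rw [image_eq_zero_of_notMem_tsupport fun h' => hz (χ₁.tsupport_subset h'),
      image_eq_zero_of_notMem_tsupport fun h' => hz (χ₂.tsupport_subset h')]

/-- Mollify the indicator of the `δ/2`-thickening of `K` at scale `δ/2`: the result is `1` on `K`
and supported in the `δ`-thickening. -/
theorem exists_smooth_cutoff {K U : Set ℂ} (hK : IsCompact K) (hU : IsOpen U) (hKU : K ⊆ U) :
    ∃ η : ℂ → ℝ, ContDiff ℝ ∞ η ∧ HasCompactSupport η ∧ tsupport η ⊆ U ∧
      (∀ z, 0 ≤ η z ∧ η z ≤ 1) ∧ ∀ z ∈ K, η z = 1 := by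
  obtain ⟨δ, hδ, hδU⟩ := hK.exists_cthickening_subset_open hU hKU
  obtain ⟨C, -, hC⟩ := exists_mollified_indicator
  obtain ⟨η, hη, h01, h1, h0, -⟩ := hC (Metric.cthickening (δ / 2) K)
    Metric.isClosed_cthickening.measurableSet (δ / 2) (by positivity)
  have hsub : tsupport η ⊆ Metric.cthickening δ K := by
    refine closure_minimal (fun z hz => ?_) Metric.isClosed_cthickening
    by_contra hzK
    refine hz (h0 z (Set.disjoint_left.2 fun w hw hwK => hzK ?_))
    have :=
      Metric.cthickening_cthickening_subset (by positivity : 0 ≤ δ / 2) (by positivity : 0 ≤ δ / 2) K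
    rw [add_halves] at this
    refine this (Metric.mem_cthickening_of_dist_le z w _ _ hwK ?_)
    rw [dist_comm]
    exact hw
  refine ⟨η, hη, hK.cthickening.of_isClosed_subset (isClosed_tsupport η) hsub, hsub.trans hδU,
    h01, fun z hz => h1 z ?_⟩
  exact fun w hw => Metric.mem_cthickening_of_dist_le w z _ _ hz hw

/-- A positive distribution is a Radon measure. -/
theorem exists_measure_of_nonneg {Ω : Opens ℂ} (Λ : 𝓓(Ω, ℝ) →ₗ[ℝ] ℝ)
    (hΛ : ∀ χ : 𝓓(Ω, ℝ), (∀ z, 0 ≤ χ z) → 0 ≤ Λ χ) :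
    ∃ μ : Measure ℂ, (∀ K : Set ℂ, IsCompact K → K ⊆ Ω → μ K < ⊤) ∧
      ∀ χ : 𝓓(Ω, ℝ), Λ χ = ∫ z, χ z ∂μ := by
  have : LocallyCompactSpace Ω := Ω.isOpen.locallyCompactSpace
  have hemb : MeasurableEmbedding ((↑) : Ω → ℂ) :=
    MeasurableEmbedding.subtype_coe Ω.isOpen.measurableSet
  let e := LinearEquiv.ofInjective (TestFunction.toCompactlySupported Ω)
    (TestFunction.toCompactlySupported_injective Ω)
  let s : PointedCone ℝ C_c(Ω, ℝ) :=
    { carrier := {f | ∀ x, 0 ≤ f x}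
      add_mem' := fun hf hg x => add_nonneg (hf x) (hg x)
      zero_mem' := fun x => le_rfl
      smul_mem' := fun c f hf x => mul_nonneg c.2 (hf x) }
  -- The functional lives on the subspace of test functions. M. Riesz's theorem extends it
  -- positively to all of `C_c(Ω, ℝ)`; positivity alone suffices, without continuity.
  let f : C_c(Ω, ℝ) →ₗ.[ℝ] ℝ :=
    ⟨LinearMap.range (TestFunction.toCompactlySupported Ω), Λ ∘ₗ e.symm.toLinearMap⟩
  have hfe (χ : 𝓓(Ω, ℝ)) : f ⟨TestFunction.toCompactlySupported Ω χ, χ, rfl⟩ = Λ χ := by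
    change Λ (e.symm (e χ)) = Λ χ
    rw [e.symm_apply_apply]
  have hnonneg : ∀ x : f.domain, (x : C_c(Ω, ℝ)) ∈ s → 0 ≤ f x := by
    rintro ⟨_, χ, rfl⟩ hx
    rw [hfe]
    refine hΛ χ fun z => ?_
    by_cases hz : z ∈ Ω
    · exact hx ⟨z, hz⟩
    · rw [image_eq_zero_of_notMem_tsupport fun h' => hz (χ.tsupport_subset h')]
  -- The cofinality condition for the extension: every `y` is bounded below by `-M η`, with `η` a
  -- smooth cutoff equal to `1` on the support of `y`.
  have hdense : ∀ y, ∃ x : f.domain, (x : C_c(Ω, ℝ)) + y ∈ s := by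
    intro y
    obtain ⟨M, hM⟩ := y.hasCompactSupport.exists_bound_of_continuous y.continuous
    obtain ⟨η, hη, hηc, hηΩ, h01, h1⟩ := exists_smooth_cutoff
      ((y.hasCompactSupport : IsCompact (tsupport y)).image continuous_subtype_val) Ω.isOpen
      (by rintro _ ⟨x, -, rfl⟩; exact x.2)
    let χ : 𝓓(Ω, ℝ) := ⟨η, hη, hηc, hηΩ⟩
    refine ⟨⟨TestFunction.toCompactlySupported Ω (M • χ), _, rfl⟩, fun x => ?_⟩
    change 0 ≤ M * η x + y x
    by_cases hx : x ∈ tsupport y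
    · rw [h1 x ⟨x, hx, rfl⟩]
      have := (abs_le.1 (hM x)).1
      linarith
    · rw [image_eq_zero_of_notMem_tsupport hx, add_zero]
      exact mul_nonneg ((norm_nonneg _).trans (hM x)) (h01 x).1
  obtain ⟨g, hg, hg0⟩ := riesz_extension s f hnonneg hdense
  let G : C_c(Ω, ℝ) →ₚ[ℝ] ℝ := PositiveLinearMap.mk₀ g fun h hh => hg0 h fun x => hh x
  -- The Riesz measure lives on the subtype `Ω`; its push-forward to the plane has no mass off `Ω`.
  refine ⟨(RealRMK.rieszMeasure G).map ((↑) : Ω → ℂ), fun K hK hKΩ => ?_, fun χ => ?_⟩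
  · rw [hemb.map_apply]
    refine IsCompact.measure_lt_top ?_
    exact (Topology.IsInducing.subtypeVal.isCompact_preimage_iff (by simpa using hKΩ)).2 hK
  · rw [hemb.integral_map]
    have := RealRMK.integral_rieszMeasure G (TestFunction.toCompactlySupported Ω χ)
    simp only [TestFunction.toCompactlySupported_apply] at this
    rw [this]
    exact ((hg ⟨_, χ, rfl⟩).trans (hfe χ)).symm

/-- The Laplacian of a maximum of harmonic functions is a positive Radon measure. -/
theorem exists_isLaplacianMeasure_maxRe {N : ℕ} (hN : 0 < N) {φ : Fin N → ℂ → ℂ} {U : Opens ℂ}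
    (hφ : ∀ j, DifferentiableOn ℂ (φ j) U) : ∃ μ, IsLaplacianMeasure U (maxRe φ) μ := by
  have hi (χ : 𝓓(U, ℝ)) : Integrable fun z => maxRe φ z * planeLaplacian χ z :=
    integrable_mul_of_tsupport_subset U.isOpen (continuousOn_maxRe hN fun j => (hφ j).continuousOn)
      (continuous_planeLaplacian χ.contDiff)
      (χ.hasCompactSupport.mono' (subset_closure.trans (tsupport_planeLaplacian_subset χ)))
      ((tsupport_planeLaplacian_subset χ).trans χ.tsupport_subset)
  have e (χ : 𝓓(U, ℝ)) : planeLaplacian χ = testLaplacian χ :=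
    funext fun z => (testLaplacian_apply χ z).symm
  have hadd (χ₁ χ₂ : 𝓓(U, ℝ)) (z : ℂ) : planeLaplacian (⇑(χ₁ + χ₂)) z
      = planeLaplacian χ₁ z + planeLaplacian χ₂ z := by
    have c (χ : 𝓓(U, ℝ)) : ContDiffAt ℝ 2 χ z := (contDiff_infty.1 χ.contDiff 2).contDiffAt
    rw [planeLaplacian_eq_laplacian (c _), planeLaplacian_eq_laplacian (c _),
      planeLaplacian_eq_laplacian (c _)]
    exact (c χ₁).laplacian_add (c χ₂)
  have hsmul (r : ℝ) (χ : 𝓓(U, ℝ)) (z : ℂ) : planeLaplacian (⇑(r • χ)) z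
      = r * planeLaplacian χ z := by
    have c (χ : 𝓓(U, ℝ)) : ContDiffAt ℝ 2 χ z := (contDiff_infty.1 χ.contDiff 2).contDiffAt
    rw [planeLaplacian_eq_laplacian (c _), planeLaplacian_eq_laplacian (c _)]
    exact InnerProductSpace.laplacian_smul r (c χ)
  let Λ : 𝓓(U, ℝ) →ₗ[ℝ] ℝ :=
    { toFun := fun χ => ∫ z, maxRe φ z * planeLaplacian χ z
      map_add' := fun χ₁ χ₂ => by
        simp only [hadd, mul_add]
        rw [integral_add (hi χ₁) (hi χ₂)]
      map_smul' := fun r χ => by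
        simp only [hsmul, mul_left_comm _ r, RingHom.id_apply, smul_eq_mul]
        rw [integral_const_mul] }
  obtain ⟨μ, hμ, hint⟩ := exists_measure_of_nonneg Λ fun χ h0 =>
    integral_maxRe_mul_planeLaplacian_nonneg hN U.isOpen hφ χ.contDiff χ.hasCompactSupport
      χ.tsupport_subset h0
  refine ⟨μ, hμ, fun χ => ?_⟩
  rw [← hint]
  change _ = ∫ z, maxRe φ z * planeLaplacian χ z
  rw [e]

end PositiveDistributions

/-! ### Transversality and dominance of one exponent near a boundary point. -/

section LocalGeometry

variable {Γ : Set ℂ} {x : ℂ} {ρ : ℂ → ℝ}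

theorem IsLocalDefiningFunction.eventually_eq_zero (hΓ : IsOpen Γ)
    (hρ : IsLocalDefiningFunction Γ x ρ) : ∀ᶠ y in 𝓝 x, y ∈ frontier Γ → ρ y = 0 := by
  obtain ⟨V, hV, hxV, hsm, hmem, -⟩ := hρ
  filter_upwards [hV.mem_nhds hxV] with y hy hyΓ
  rw [hΓ.frontier_eq] at hyΓ
  refine le_antisymm (not_lt.1 fun hpos => ?_) (not_lt.1 fun h => hyΓ.2 ((hmem y hy).2 h))
  have hc : ContinuousAt ρ y := hsm.continuousOn.continuousAt (hV.mem_nhds hy)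
  have hev : ∀ᶠ w in 𝓝 y, w ∉ Γ := by
    filter_upwards [hc.eventually (lt_mem_nhds hpos), hV.mem_nhds hy] with w hw hwV hwΓ
    exact absurd ((hmem w hwV).1 hwΓ) (not_lt.2 hw.le)
  obtain ⟨w, hwΓ, hw⟩ := (mem_closure_iff_frequently.1 hyΓ.1).and_eventually hev |>.exists
  exact hw hwΓ

theorem IsLocalDefiningFunction.differentiableAt (hρ : IsLocalDefiningFunction Γ x ρ) :
    DifferentiableAt ℝ ρ x := by
  obtain ⟨V, hV, hxV, hsm, -, -⟩ := hρ
  exact (hsm.contDiffAt (hV.mem_nhds hxV)).differentiableAt (by simp)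

theorem IsLocalDefiningFunction.fderiv_ne_zero (hρ : IsLocalDefiningFunction Γ x ρ) :
    fderiv ℝ ρ x ≠ 0 := by
  obtain ⟨V, -, -, -, -, h⟩ := hρ
  exact h

theorem IsLocalDefiningFunction.exists_isUnitTangent (hρ : IsLocalDefiningFunction Γ x ρ) :
    ∃ τ, IsUnitTangent Γ x τ := by
  set D := fderiv ℝ ρ x with hD
  have hD0 : D ≠ 0 := hρ.fderiv_ne_zero
  -- This is the gradient of `ρ` turned by a right angle.
  set v : ℂ := ⟨-D Complex.I, D 1⟩ with hv
  have hv' : v = (-D Complex.I) • (1 : ℂ) + (D 1) • Complex.I := by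
    apply Complex.ext <;> simp [hv]
  have hDv : D v = 0 := by
    rw [hv', map_add, map_smul, map_smul, smul_eq_mul, smul_eq_mul]
    ring
  have hv0 : v ≠ 0 := by
    intro h0
    have h1 : D Complex.I = 0 := by simpa [hv] using congrArg Complex.re h0
    have h2 : D 1 = 0 := by simpa [hv] using congrArg Complex.im h0
    apply hD0
    ext w
    have : w = w.re • (1 : ℂ) + w.im • Complex.I := by
      apply Complex.ext <;> simp
    rw [this, map_add, map_smul, map_smul, h1, h2]
    simp
  refine ⟨‖v‖⁻¹ • v, ?_, ρ, hρ, ?_⟩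
  · rw [norm_smul, norm_inv, norm_norm, inv_mul_cancel₀ (norm_ne_zero_iff.2 hv0)]
  · rw [← hD, map_smul, hDv, smul_zero]

/-- A function whose tangential derivative does not vanish grows linearly along the boundary. -/
theorem eventually_le_abs_of_transversal (hΓ : IsOpen Γ) (hx : x ∈ frontier Γ)
    (hρ : IsLocalDefiningFunction Γ x ρ) {d : ℂ → ℝ} (hd : DifferentiableAt ℝ d x) (hd0 : d x = 0)
    (ht : ∀ τ, IsUnitTangent Γ x τ → fderiv ℝ d x τ ≠ 0) :
    ∃ c > 0, ∀ᶠ y in 𝓝 x, y ∈ frontier Γ → c * ‖y - x‖ ≤ |d y| := by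
  set R := fderiv ℝ ρ x with hR
  set D := fderiv ℝ d x with hD
  -- The sum `|R v| + |D v|` has no zero on the unit circle, since a unit vector killed by `R` is
  -- tangent and so not killed by `D`; compactness gives the lower bound `c`.
  obtain ⟨v₀, hv₀, hmin⟩ := (isCompact_sphere (0 : ℂ) 1).exists_isMinOn
    (NormedSpace.sphere_nonempty.2 zero_le_one)
    (f := fun v => |R v| + |D v|) (by fun_prop)
  set c := |R v₀| + |D v₀| with hc
  have hc0 : 0 < c := by
    by_cases h : R v₀ = 0
    · have : D v₀ ≠ 0 := ht v₀ ⟨by simpa using hv₀, ρ, hρ, h⟩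
      have := abs_pos.2 this
      positivity
    · have := abs_pos.2 h
      positivity
  have hlow (v : ℂ) : c * ‖v‖ ≤ |R v| + |D v| := by
    by_cases hv : v = 0
    · simp [hv]
    have hn : 0 < ‖v‖ := norm_pos_iff.2 hv
    have h := hmin (show ‖v‖⁻¹ • v ∈ Metric.sphere (0 : ℂ) 1 by
      rw [mem_sphere_zero_iff_norm, norm_smul, norm_inv, norm_norm, inv_mul_cancel₀ hn.ne'])
    simp only [mem_ofPred_eq, map_smul, smul_eq_mul, abs_mul, abs_inv, abs_norm, ← mul_add] at h
    rw [← hc, le_inv_mul_iff₀ hn] at h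
    linarith
  -- On the boundary `ρ = 0`, so `R (y - x)` is only a remainder. It and the remainder of `d` cost
  -- `c/4` each, which leaves `c/2`.
  have h1 := (hρ.differentiableAt.hasFDerivAt.isLittleO).def (by positivity : 0 < c / 4)
  have h2 := (hd.hasFDerivAt.isLittleO).def (by positivity : 0 < c / 4)
  have hρx : ρ x = 0 := (hρ.eventually_eq_zero hΓ).self_of_nhds hx
  refine ⟨c / 2, by positivity, ?_⟩
  filter_upwards [h1, h2, hρ.eventually_eq_zero hΓ] with y hy1 hy2 hy3 hy
  rw [hy3 hy, hρx, sub_zero, zero_sub, norm_neg, Real.norm_eq_abs] at hy1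
  rw [hd0, sub_zero, Real.norm_eq_abs] at hy2
  have h4 := hlow (y - x)
  have h5 := abs_sub_abs_le_abs_sub (D (y - x)) (d y)
  rw [abs_sub_comm] at h5
  linarith

/-- Along the tangent line, unlike along the curve, there is a point at each prescribed small
distance from `x`; this serves `HasDominance.near_point`. -/
theorem eventually_le_abs_along_direction {d : ℂ → ℝ} {x τ : ℂ} (hτ : ‖τ‖ = 1)
    (hd : DifferentiableAt ℝ d x) (hd0 : d x = 0) (ht : fderiv ℝ d x τ ≠ 0) :
    ∃ c > 0, ∀ᶠ s : ℝ in 𝓝[>] 0, c * s ≤ |d (x + s • τ)| := by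
  set D := fderiv ℝ d x
  have hpos : 0 < |D τ| := abs_pos.2 ht
  have h2 := (hd.hasFDerivAt.isLittleO).def (by positivity : 0 < |D τ| / 2)
  have hlim : Tendsto (fun s : ℝ => x + s • τ) (𝓝[>] 0) (𝓝 x) := by
    have : Tendsto (fun s : ℝ => x + s • τ) (𝓝 0) (𝓝 (x + (0 : ℝ) • τ)) :=
      Continuous.tendsto (by fun_prop) 0
    rw [zero_smul, add_zero] at this
    exact this.mono_left nhdsWithin_le_nhds
  refine ⟨|D τ| / 2, by positivity, ?_⟩
  filter_upwards [hlim.eventually h2, self_mem_nhdsWithin] with s hs hs0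
  have hs0 : 0 < s := hs0
  rw [hd0, sub_zero, add_sub_cancel_left, map_smul, norm_smul, hτ, mul_one, smul_eq_mul,
    Real.norm_eq_abs, Real.norm_of_nonneg hs0.le] at hs
  have h5 := abs_sub_abs_le_abs_sub (s * D τ) (d (x + s • τ))
  rw [abs_sub_comm, abs_mul, abs_of_pos hs0] at h5
  linarith

variable {N : ℕ} {φ : Fin N → ℂ → ℂ}

/-- If the functions that are maximal at `x` are separated at a nearby point `w`, then one of all
the functions dominates the others at `w`. -/
theorem exists_dominant_of_separated (hN : 0 < N) (hφ : ∀ j, ContinuousAt (φ j) x) {c : ℝ}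
    (hc : 0 < c) : ∀ᶠ w in 𝓝 x,
      (∀ j k, j ≠ k → (φ j x).re = maxRe φ x → (φ k x).re = maxRe φ x →
        c * ‖w - x‖ ≤ |(φ j w).re - (φ k w).re|) →
      ∃ j, ∀ l, l ≠ j → (φ l w).re ≤ (φ j w).re - c * ‖w - x‖ := by
  obtain ⟨m, hm⟩ := exists_re_eq_maxRe hN φ x
  have h1 : ∀ l, (φ l x).re ≠ maxRe φ x → ∀ᶠ w in 𝓝 x, (φ l w).re < (φ m w).re - c * ‖w - x‖ := by
    intro l hl
    have hlt : (φ l x).re < (φ m x).re - c * ‖x - x‖ := by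
      rw [sub_self, norm_zero, mul_zero, sub_zero, hm]
      exact lt_of_le_of_ne (re_le_maxRe φ x l) hl
    have hcl := (Complex.continuous_re.continuousAt.comp (hφ l))
    have hcm := (Complex.continuous_re.continuousAt.comp (hφ m))
    exact ContinuousAt.eventually_lt hcl (hcm.sub (by fun_prop)) hlt
  have h2 : ∀ᶠ w in 𝓝 x, ∀ l, (φ l x).re ≠ maxRe φ x → (φ l w).re < (φ m w).re - c * ‖w - x‖ := by
    rw [eventually_all]
    intro l
    by_cases hl : (φ l x).re = maxRe φ x
    · exact Eventually.of_forall fun w h => absurd hl h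
    · filter_upwards [h1 l hl] with w hw _ using hw
  filter_upwards [h2] with w hw hsep
  obtain ⟨j, hj⟩ := exists_re_eq_maxRe hN φ w
  have hjm : (φ m w).re ≤ (φ j w).re := hj ▸ re_le_maxRe φ w m
  have hcn : 0 ≤ c * ‖w - x‖ := by positivity
  -- An index not maximal at `x` is strictly below `m` near `x`, so the maximiser at `w` is already
  -- maximal at `x`, and the separation hypothesis applies to it.
  have hjx : (φ j x).re = maxRe φ x := by
    by_contra h
    linarith [hw j h]
  refine ⟨j, fun l hl => ?_⟩
  by_cases hlx : (φ l x).re = maxRe φ x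
  · have h3 := hsep j l hl.symm hjx hlx
    rw [abs_of_nonneg (sub_nonneg.2 (hj ▸ re_le_maxRe φ w l))] at h3
    linarith
  · linarith [hw l hlx]

theorem exists_uniform_lipschitz {U : Set ℂ} (hU : IsOpen U) (hxU : x ∈ U)
    (hφ : ∀ j, DifferentiableOn ℂ (φ j) U) : ∃ L : ℝ, 0 ≤ L ∧ ∀ᶠ r in 𝓝[>] (0 : ℝ),
      ∀ j, ∀ z ∈ Metric.ball x r, ∀ w ∈ Metric.ball x r,
        |(φ j z).re - (φ j w).re| ≤ L * ‖z - w‖ := by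
  have h (j : Fin N) : ∃ K : NNReal, ∃ t ∈ 𝓝 x, LipschitzOnWith K (φ j) t :=
    (((hφ j).analyticAt (hU.mem_nhds hxU)).contDiffAt (n := 1)).exists_lipschitzOnWith
  choose K t ht hK using h
  refine ⟨∑ j, (K j : ℝ), Finset.sum_nonneg fun j _ => (K j).2, ?_⟩
  obtain ⟨r₀, hr₀, hsub⟩ := Metric.mem_nhds_iff.1 (Filter.iInter_mem.2 ht)
  filter_upwards [Ioo_mem_nhdsGT hr₀] with r hr j z hz w hw
  have hz' := mem_iInter.1 (hsub (Metric.ball_subset_ball hr.2.le hz)) j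
  have hw' := mem_iInter.1 (hsub (Metric.ball_subset_ball hr.2.le hw)) j
  have h1 := (hK j).dist_le_mul z hz' w hw'
  rw [dist_eq_norm, dist_eq_norm] at h1
  rw [← Complex.sub_re]
  refine (Complex.abs_re_le_norm _).trans (h1.trans ?_)
  gcongr
  exact Finset.single_le_sum (f := fun j => (K j : ℝ)) (fun j _ => (K j).2) (Finset.mem_univ j)

/-- In the ball of radius `r` around `x` the functions `Re φ_j` have the Lipschitz constant `L`, and
one of them dominates all others, with a margin that grows linearly with the distance to `x`, at
points near the curve `γ`, and also at some points arbitrarily close to `x`. -/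
structure HasDominance (φ : Fin N → ℂ → ℂ) (γ U : Set ℂ) (x : ℂ) (r c L : ℝ) : Prop where
  r_pos : 0 < r
  c_pos : 0 < c
  L_nonneg : 0 ≤ L
  ball_subset : Metric.ball x r ⊆ U
  lipschitz : ∀ j, ∀ z ∈ Metric.ball x r, ∀ w ∈ Metric.ball x r,
    |(φ j z).re - (φ j w).re| ≤ L * ‖z - w‖
  near_curve : ∀ z ∈ Metric.ball x r, ∀ y ∈ Metric.ball x r, y ∈ γ →
    ∃ j, ∀ l, l ≠ j → (φ l z).re ≤ (φ j z).re - c * ‖z - x‖ + (2 * L + c) * ‖z - y‖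
  near_point : ∀ s ∈ Ioo 0 r, ∃ z, dist z x = s ∧ ∃ j, ∀ l, l ≠ j →
    (φ l z).re ≤ (φ j z).re - c * s

/-- Each pair of indices maximal at `x` has its own separation constant. There are finitely many
pairs, so the least constant works for all on one small ball. -/
theorem exists_dominance_radius (hΓ : IsOpen Γ) (hx : x ∈ frontier Γ)
    (hρ : IsLocalDefiningFunction Γ x ρ) {U : Set ℂ} (hU : IsOpen U) (hxU : x ∈ U) (hN : 0 < N)
    (hφ : ∀ j, DifferentiableOn ℂ (φ j) U)
    (htrans : ∀ j k, j ≠ k → (φ j x).re = maxRe φ x → (φ k x).re = maxRe φ x →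
      ∀ τ, IsUnitTangent Γ x τ → fderiv ℝ (fun z => (φ j z).re - (φ k z).re) x τ ≠ 0) :
    ∃ r c L, HasDominance φ (frontier Γ) U x r c L := by
  classical
  obtain ⟨τ, hτ⟩ := hρ.exists_isUnitTangent
  have hdiff (j : Fin N) : DifferentiableAt ℝ (fun z => (φ j z).re) x :=
    Complex.reCLM.differentiableAt.comp x
      (((hφ j).differentiableAt (hU.mem_nhds hxU)).restrictScalars ℝ)
  have hpair (p : Fin N × Fin N) : ∃ c > 0, (p.1 ≠ p.2 → (φ p.1 x).re = maxRe φ x →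
      (φ p.2 x).re = maxRe φ x →
      (∀ᶠ y in 𝓝 x, y ∈ frontier Γ → c * ‖y - x‖ ≤ |(φ p.1 y).re - (φ p.2 y).re|) ∧
      ∀ᶠ s : ℝ in 𝓝[>] 0, c * s ≤ |(φ p.1 (x + s • τ)).re - (φ p.2 (x + s • τ)).re|) := by
    by_cases h : p.1 ≠ p.2 ∧ (φ p.1 x).re = maxRe φ x ∧ (φ p.2 x).re = maxRe φ x
    · obtain ⟨h1, h2, h3⟩ := h
      have hd := (hdiff p.1).fun_sub (hdiff p.2)
      have hd0 : (φ p.1 x).re - (φ p.2 x).re = 0 := by rw [h2, h3, sub_self]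
      obtain ⟨c₁, hc₁, H₁⟩ := eventually_le_abs_of_transversal hΓ hx hρ hd hd0
        (htrans p.1 p.2 h1 h2 h3)
      obtain ⟨c₂, hc₂, H₂⟩ := eventually_le_abs_along_direction hτ.1 hd hd0
        (htrans p.1 p.2 h1 h2 h3 τ hτ)
      refine ⟨min c₁ c₂, lt_min hc₁ hc₂, fun _ _ _ => ⟨?_, ?_⟩⟩
      · filter_upwards [H₁] with y hy hyΓ
        exact (mul_le_mul_of_nonneg_right (min_le_left _ _) (norm_nonneg _)).trans (hy hyΓ)
      · filter_upwards [H₂, self_mem_nhdsWithin] with s hs hs0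
        exact (mul_le_mul_of_nonneg_right (min_le_right _ _) (le_of_lt hs0)).trans hs
    -- A pair that does not tie at `x` imposes no condition; any positive constant will do.
    · exact ⟨1, one_pos, fun h1 h2 h3 => absurd ⟨h1, h2, h3⟩ h⟩
  choose C hC0 hC using hpair
  have : Nonempty (Fin N) := ⟨⟨0, hN⟩⟩
  obtain ⟨p₀, hp₀⟩ := Finite.exists_min C
  set c := C p₀ with hc
  have hc0 : 0 < c := hC0 p₀
  have hdom := exists_dominant_of_separated hN (x := x)
    (fun j => ((hφ j).differentiableAt (hU.mem_nhds hxU)).continuousAt) hc0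
  have hA : ∀ᶠ y in 𝓝 x, ∀ p : Fin N × Fin N, p.1 ≠ p.2 → (φ p.1 x).re = maxRe φ x →
      (φ p.2 x).re = maxRe φ x → y ∈ frontier Γ → c * ‖y - x‖ ≤ |(φ p.1 y).re - (φ p.2 y).re| := by
    rw [eventually_all]
    intro p
    by_cases h : p.1 ≠ p.2 ∧ (φ p.1 x).re = maxRe φ x ∧ (φ p.2 x).re = maxRe φ x
    · filter_upwards [(hC p h.1 h.2.1 h.2.2).1] with y hy _ _ _ hyΓ
      exact (mul_le_mul_of_nonneg_right (hp₀ p) (norm_nonneg _)).trans (hy hyΓ)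
    · exact Eventually.of_forall fun y h1 h2 h3 => absurd ⟨h1, h2, h3⟩ h
  have hB : ∀ᶠ s : ℝ in 𝓝[>] 0, ∀ p : Fin N × Fin N, p.1 ≠ p.2 → (φ p.1 x).re = maxRe φ x →
      (φ p.2 x).re = maxRe φ x →
      c * s ≤ |(φ p.1 (x + s • τ)).re - (φ p.2 (x + s • τ)).re| := by
    rw [eventually_all]
    intro p
    by_cases h : p.1 ≠ p.2 ∧ (φ p.1 x).re = maxRe φ x ∧ (φ p.2 x).re = maxRe φ x
    · filter_upwards [(hC p h.1 h.2.1 h.2.2).2, self_mem_nhdsWithin] with s hs hs0 _ _ _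
      exact (mul_le_mul_of_nonneg_right (hp₀ p) (le_of_lt hs0)).trans hs
    · exact Eventually.of_forall fun y h1 h2 h3 => absurd ⟨h1, h2, h3⟩ h
  obtain ⟨L, hL0, hL⟩ := exists_uniform_lipschitz hU hxU hφ
  have hball {P : ℂ → Prop} (hP : ∀ᶠ y in 𝓝 x, P y) :
      ∀ᶠ r in 𝓝[>] (0 : ℝ), ∀ y ∈ Metric.ball x r, P y := by
    obtain ⟨r₀, hr₀, h⟩ := Metric.eventually_nhds_iff_ball.1 hP
    filter_upwards [Ioo_mem_nhdsGT hr₀] with r hr y hy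
    exact h y (Metric.ball_subset_ball hr.2.le hy)
  have hinterval {P : ℝ → Prop} (hP : ∀ᶠ s in 𝓝[>] (0 : ℝ), P s) :
      ∀ᶠ r in 𝓝[>] (0 : ℝ), ∀ s ∈ Ioo 0 r, P s := by
    obtain ⟨r₀, hr₀, h⟩ := mem_nhdsGT_iff_exists_Ioo_subset.1 hP
    filter_upwards [Ioo_mem_nhdsGT hr₀] with r hr s hs
    exact h ⟨hs.1, hs.2.trans hr.2⟩
  obtain ⟨r, hr1, hr2, hr3, hr4, hr5, hr0⟩ := (hL.and ((hball (hU.mem_nhds hxU)).and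
    ((hball hdom).and ((hball hA).and ((hinterval hB).and self_mem_nhdsWithin))))).exists
  refine ⟨r, c, L, hr0, hc0, hL0, hr2, hr1, fun z hz y hy hyΓ => ?_, fun s hs => ?_⟩
  · obtain ⟨j, hj⟩ := hr3 y hy fun j k h1 h2 h3 => hr4 y hy (j, k) h1 h2 h3 hyΓ
    refine ⟨j, fun l hl => ?_⟩
    -- Moving from `y` to `z` costs `L‖z - y‖` for each of the two exponents and `c‖z - y‖` in the
    -- distance to `x`, whence the coefficient `2L + c`.
    have e1 := (abs_le.1 (hr1 l z hz y hy)).2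
    have e2 := (abs_le.1 (hr1 j z hz y hy)).1
    have e3 : c * ‖z - x‖ ≤ c * (‖z - y‖ + ‖y - x‖) := by
      gcongr
      exact norm_sub_le_norm_sub_add_norm_sub z y x
    linarith [hj l hl]
  · have hn : ‖x + s • τ - x‖ = s := by
      rw [add_sub_cancel_left, norm_smul, hτ.1, mul_one, Real.norm_of_nonneg hs.1.le]
    refine ⟨x + s • τ, by rw [dist_eq_norm, hn], ?_⟩
    have := hr3 (x + s • τ) (by rw [Metric.mem_ball, dist_eq_norm, hn]; exact hs.2)
    rw [hn] at this
    exact this fun j k h1 h2 h3 => hr5 s hs (j, k) h1 h2 h3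

end LocalGeometry

/-! ### Exponential sums with a dominant term. -/

section ExponentialSums

variable {N : ℕ} {φ : Fin N → ℂ → ℂ}

/-- The exponential sum `∑ exp (φ_j / h)`. -/
noncomputable def expSum (φ : Fin N → ℂ → ℂ) (h : ℝ) (z : ℂ) : ℂ :=
  ∑ j, Complex.exp (φ j z / h)

/-- The difference between `log |∑ exp (φ_j / h)|` and `max_j Re φ_j / h`. -/
noncomputable def logDefect (φ : Fin N → ℂ → ℂ) (h : ℝ) (z : ℂ) : ℝ :=
  Real.log ‖expSum φ h z‖ - maxRe φ z / h

theorem norm_exp_div (w : ℂ) (h : ℝ) : ‖Complex.exp (w / h)‖ = Real.exp (w.re / h) := by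
  rw [Complex.norm_exp, Complex.div_ofReal_re]

theorem norm_expSum_le (φ : Fin N → ℂ → ℂ) {h : ℝ} (hh : 0 < h) (z : ℂ) :
    ‖expSum φ h z‖ ≤ N * Real.exp (maxRe φ z / h) := by
  have key : ‖expSum φ h z‖ ≤ ∑ _j : Fin N, Real.exp (maxRe φ z / h) := by
    refine norm_sum_le_of_le _ fun j _ => ?_
    rw [norm_exp_div]
    have := re_le_maxRe φ z j
    gcongr
  simpa using key

theorem analyticOnNhd_expSum {U : Set ℂ} (hU : IsOpen U) (hφ : ∀ j, DifferentiableOn ℂ (φ j) U)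
    (h : ℝ) : AnalyticOnNhd ℂ (expSum φ h) U := by
  refine DifferentiableOn.analyticOnNhd ?_ hU
  exact DifferentiableOn.fun_sum fun j _ => ((hφ j).div_const _).cexp

theorem abs_log_norm_one_add_le {w : ℂ} {δ : ℝ} (hw : ‖w‖ ≤ δ) (hδ : δ ≤ 1 / 2) :
    |Real.log ‖1 + w‖| ≤ 2 * δ := by
  have h1 : ‖1 + w‖ ≤ 1 + δ := (norm_add_le _ _).trans (by rw [norm_one]; linarith)
  have h2 : 1 - δ ≤ ‖1 + w‖ := by
    have := norm_sub_le (1 + w) w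
    rw [add_sub_cancel_right, norm_one] at this
    linarith
  have hpos : 0 < ‖1 + w‖ := by linarith
  have hδ0 : 0 ≤ δ := (norm_nonneg w).trans hw
  have h3 := Real.log_le_sub_one_of_pos hpos
  have h4 := Real.one_sub_inv_le_log_of_pos hpos
  have h5 : ‖1 + w‖⁻¹ ≤ 1 + 2 * δ := by
    rw [inv_le_iff_one_le_mul₀ hpos]
    nlinarith
  rw [abs_le]
  constructor <;> linarith

/-- Where one exponential dominates, the exponential sum does not vanish and its logarithm is close
to the maximum of the exponents. -/
theorem logDefect_of_dominant {h m : ℝ} (hh : 0 < h) {z : ℂ} {j : Fin N}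
    (hj : ∀ l, l ≠ j → (φ l z).re ≤ (φ j z).re - m) (hm : N * Real.exp (-(m / h)) ≤ 1 / 2) :
    maxRe φ z = (φ j z).re ∧ expSum φ h z ≠ 0 ∧
      |logDefect φ h z| ≤ 2 * (N * Real.exp (-(m / h))) := by
  have hN : 0 < N := j.pos
  have hN1 : (1 : ℝ) ≤ N := by exact_mod_cast hN
  -- The smallness hypothesis forces a positive margin: otherwise the exponential would be at least
  -- `1`.
  have hm0 : 0 < m := by
    by_contra hm0
    have : 1 ≤ Real.exp (-(m / h)) := by
      rw [Real.one_le_exp_iff, neg_nonneg]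
      exact div_nonpos_of_nonpos_of_nonneg (not_lt.1 hm0) hh.le
    nlinarith
  have hmax : maxRe φ z = (φ j z).re := by
    refine maxRe_eq_of_le hN fun l => ?_
    by_cases hl : l = j
    · rw [hl]
    · linarith [hj l hl]
  set e := Complex.exp (φ j z / h) with he
  have he0 : e ≠ 0 := Complex.exp_ne_zero _
  set w := (∑ l ∈ Finset.univ.erase j, Complex.exp (φ l z / h)) / e with hw
  have hS : expSum φ h z = e * (1 + w) := by
    rw [expSum, ← Finset.add_sum_erase _ _ (Finset.mem_univ j), mul_add, mul_one, hw,
      mul_div_cancel₀ _ he0]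
  have hwn : ‖w‖ ≤ N * Real.exp (-(m / h)) := by
    rw [hw, norm_div, div_le_iff₀ (norm_pos_iff.2 he0), he, norm_exp_div, mul_assoc, ← Real.exp_add]
    have key : ‖∑ l ∈ Finset.univ.erase j, Complex.exp (φ l z / h)‖ ≤
        ∑ _l ∈ Finset.univ.erase j, Real.exp (-(m / h) + (φ j z).re / h) := by
      refine norm_sum_le_of_le _ fun l hl => ?_
      rw [norm_exp_div]
      have := hj l (Finset.ne_of_mem_erase hl)
      apply Real.exp_le_exp.2
      rw [← neg_div, ← add_div]
      gcongr
      linarith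
    refine key.trans ?_
    rw [Finset.sum_const, nsmul_eq_mul]
    gcongr
    simp
  have hlog := abs_log_norm_one_add_le hwn hm
  have h1w : 1 + w ≠ 0 := by
    intro h0
    have : w = -1 := by linear_combination h0
    rw [this, norm_neg, norm_one] at hwn
    linarith
  refine ⟨hmax, hS ▸ mul_ne_zero he0 h1w, ?_⟩
  rw [logDefect, hS, norm_mul, Real.log_mul (norm_ne_zero_iff.2 he0) (norm_ne_zero_iff.2 h1w), he,
    norm_exp_div, Real.log_exp, hmax, add_sub_cancel_left]
  exact hlog

end ExponentialSums

/-! ### Integral bounds for the logarithmic defect near a boundary point. -/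

section LocalEstimates

variable {N : ℕ} {φ : Fin N → ℂ → ℂ} {γ U : Set ℂ} {x : ℂ} {r c L : ℝ}

theorem HasDominance.pos (H : HasDominance φ γ U x r c L) : 0 < N := by
  obtain ⟨z, -, j, -⟩ := H.near_point (r / 2) ⟨by linarith [H.r_pos], by linarith [H.r_pos]⟩
  exact j.pos

theorem HasDominance.abs_maxRe_sub_le (H : HasDominance φ γ U x r c L) {z w : ℂ}
    (hz : z ∈ Metric.ball x r) (hw : w ∈ Metric.ball x r) :
    |maxRe φ z - maxRe φ w| ≤ L * ‖z - w‖ := by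
  have key : ∀ z ∈ Metric.ball x r, ∀ w ∈ Metric.ball x r, maxRe φ z ≤ maxRe φ w + L * ‖z - w‖ := by
    intro z hz w hw
    refine maxRe_le H.pos fun j => ?_
    linarith [(abs_le.1 (H.lipschitz j z hz w hw)).2, re_le_maxRe φ w j]
  rw [abs_le]
  have h1 := key z hz w hw
  have h2 := key w hw z hz
  rw [norm_sub_rev] at h2
  constructor <;> linarith

theorem HasDominance.continuousOn_maxRe (H : HasDominance φ γ U x r c L) :
    ContinuousOn (maxRe φ) (Metric.ball x r) := by
  refine LipschitzOnWith.continuousOn (K := ⟨L, H.L_nonneg⟩) ?_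
  refine LipschitzOnWith.of_dist_le_mul fun z hz w hw => ?_
  rw [Real.dist_eq, dist_eq_norm]
  exact H.abs_maxRe_sub_le hz hw

theorem eventually_mul_lt (K : ℝ) {r : ℝ} (hr : 0 < r) : ∀ᶠ h in 𝓝[>] (0 : ℝ), K * h < r := by
  have : Tendsto (fun h : ℝ => K * h) (𝓝 0) (𝓝 (K * 0)) := Continuous.tendsto (by fun_prop) 0
  rw [mul_zero] at this
  exact (this.mono_left nhdsWithin_le_nhds).eventually (gt_mem_nhds hr)

/-- At distance `O(h)` from `x` there is a point where the exponential sum is not small. -/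
theorem HasDominance.exists_large_point (H : HasDominance φ γ U x r c L) :
    ∃ K > 0, ∀ᶠ h in 𝓝[>] (0 : ℝ), K * h < r ∧ ∃ z, dist z x = K * h ∧ expSum φ h z ≠ 0 ∧
      |logDefect φ h z| ≤ 1 := by
  have hN : (1 : ℝ) ≤ N := by exact_mod_cast H.pos
  have hlog : 0 < Real.log (2 * N) := Real.log_pos (by linarith)
  have hc := H.c_pos
  -- At distance `Kh` the margin is `cKh = h log(2N)`, so `N exp(-margin/h) = 1/2`, the threshold in
  -- `logDefect_of_dominant`.
  refine ⟨Real.log (2 * N) / c, by positivity, ?_⟩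
  filter_upwards [eventually_mul_lt (Real.log (2 * N) / c) H.r_pos, self_mem_nhdsWithin] with h hhr hh
  have hh : 0 < h := hh
  refine ⟨hhr, ?_⟩
  obtain ⟨z, hz, j, hj⟩ := H.near_point (Real.log (2 * N) / c * h) ⟨by positivity, hhr⟩
  have e : N * Real.exp (-(c * (Real.log (2 * N) / c * h) / h)) = 1 / 2 := by
    have : c * (Real.log (2 * N) / c * h) / h = Real.log (2 * N) := by field_simp
    rw [this, Real.exp_neg, Real.exp_log (by positivity)]
    field_simp
  obtain ⟨-, h1, h2⟩ := logDefect_of_dominant hh hj e.le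
  rw [e] at h2
  exact ⟨z, hz, h1, by linarith⟩

/-- If the sum vanished near one point of the ball it would vanish on the whole ball, against
`exists_large_point`. -/
theorem HasDominance.eventually_order_ne_top (H : HasDominance φ γ U x r c L) (hU : IsOpen U)
    (hφ : ∀ j, DifferentiableOn ℂ (φ j) U) :
    ∀ᶠ h in 𝓝[>] (0 : ℝ), ∀ z ∈ Metric.ball x r, analyticOrderAt (expSum φ h) z ≠ ⊤ := by
  obtain ⟨K, -, hK⟩ := H.exists_large_point
  filter_upwards [hK] with h hh z hz htop
  obtain ⟨hKr, w, hw, hw0, -⟩ := hh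
  refine hw0 ?_
  have han := (analyticOnNhd_expSum hU hφ h).mono H.ball_subset
  refine han.eqOn_zero_of_preconnected_of_eventuallyEq_zero (convex_ball x r).isPreconnected hz
    (analyticOrderAt_eq_top.1 htop) ?_
  rw [Metric.mem_ball, hw]
  exact hKr

theorem ae_restrict_ne_zero {K : Set ℂ} (hK : IsCompact K) {u : ℂ → ℂ}
    (hu : AnalyticOnNhd ℂ u K) (hord : ∀ z ∈ K, analyticOrderAt u z ≠ ⊤) :
    ∀ᵐ z ∂(volume.restrict K), u z ≠ 0 := by
  obtain ⟨Z, -, hZ, -⟩ := exists_log_norm_ae_eq hK hu hord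
  have h1 : ∀ᵐ z ∂(volume.restrict K), z ∉ (Z : Set ℂ) :=
    ae_restrict_of_ae (measure_eq_zero_iff_ae_notMem.1 (Z.finite_toSet.measure_zero _))
  filter_upwards [h1, ae_restrict_mem hK.measurableSet] with z hz hzK h0
  exact hz ((hZ z).2 ⟨hzK, h0⟩)

/-- On the disc of radius `O(h)` the function `logDefect φ h` has an average of size `O(1)`. -/
theorem HasDominance.lintegral_ball_logDefect_le (H : HasDominance φ γ U x r c L) (hU : IsOpen U)
    (hφ : ∀ j, DifferentiableOn ℂ (φ j) U) (K : ℝ) (hK : 0 < K) : ∃ C, 0 ≤ C ∧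
      ∀ᶠ h in 𝓝[>] (0 : ℝ), ∫⁻ z in Metric.ball x (K * h), ‖logDefect φ h z‖ₑ
        ≤ ENNReal.ofReal (C * h ^ 2) := by
  obtain ⟨K', hK', hlarge⟩ := H.exists_large_point
  have hN : (1 : ℝ) ≤ N := by exact_mod_cast H.pos
  have hlogN : 0 ≤ Real.log N := Real.log_nonneg hN
  have hL := H.L_nonneg
  have hpi := Real.pi_pos
  set M := L * (K + K') + Real.log N with hM
  have hM0 : 0 ≤ M := by positivity
  -- The disc about `z₀` has area `π(K + K')²h²`. Jensen's inequality contributes `M + 1` per unit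
  -- area and the pointwise remainder `2M`.
  refine ⟨Real.pi * (K + K') ^ 2 * (3 * M + 1), by positivity, ?_⟩
  filter_upwards [hlarge, eventually_mul_lt (K + 2 * K') H.r_pos, self_mem_nhdsWithin,
    H.eventually_order_ne_top hU hφ] with h ⟨hKr, z₀, hz₀, hS₀, hE₀⟩ hr hh hord
  have hh : 0 < h := hh
  set R := (K + K') * h with hR
  have hRpos : 0 < R := by positivity
  have hsub : Metric.closedBall z₀ R ⊆ Metric.ball x r := by
    refine Metric.closedBall_subset_ball' ?_
    rw [hz₀, hR]
    linarith
  have hsub' : Metric.ball x (K * h) ⊆ Metric.ball z₀ R := by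
    refine Metric.ball_subset_ball' ?_
    rw [dist_comm, hz₀, hR]
    linarith
  have hz₀r : z₀ ∈ Metric.ball x r := hsub (Metric.mem_closedBall_self hRpos.le)
  have han : AnalyticOnNhd ℂ (expSum φ h) (Metric.closedBall z₀ R) :=
    (analyticOnNhd_expSum hU hφ h).mono (hsub.trans H.ball_subset)
  -- Normalised by the size of the dominant term at `z₀`: then `log|u| ≤ M` on the disc, as `Ψ/h`
  -- varies there by at most `L(K + K')`, while `log|u(z₀)| ≥ -1`.
  set u : ℂ → ℂ := fun z => (Real.exp (-(maxRe φ z₀ / h)) : ℂ) * expSum φ h z with hu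
  have hun (z : ℂ) : ‖u z‖ = Real.exp (-(maxRe φ z₀ / h)) * ‖expSum φ h z‖ := by
    rw [hu, norm_mul, Complex.norm_real, Real.norm_of_nonneg (Real.exp_pos _).le]
  have hulog (z : ℂ) (hz : expSum φ h z ≠ 0) :
      Real.log ‖u z‖ = Real.log ‖expSum φ h z‖ - maxRe φ z₀ / h := by
    rw [hun, Real.log_mul (Real.exp_pos _).ne' (norm_ne_zero_iff.2 hz), Real.log_exp]
    ring
  have hua : AnalyticOnNhd ℂ u (Metric.closedBall z₀ R) := analyticOnNhd_const.mul han
  have hdist (z : ℂ) (hz : z ∈ Metric.closedBall z₀ R) :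
      |maxRe φ z - maxRe φ z₀| / h ≤ L * (K + K') := by
    rw [div_le_iff₀ hh]
    refine (H.abs_maxRe_sub_le (hsub hz) hz₀r).trans ?_
    rw [mul_assoc]
    gcongr
    rw [← dist_eq_norm]
    exact hz
  have huM (z : ℂ) (hz : z ∈ Metric.closedBall z₀ R) : Real.log ‖u z‖ ≤ M := by
    by_cases h0 : expSum φ h z = 0
    -- At a zero the convention `log 0 = 0` makes the bound a matter of `M ≥ 0`.
    · rw [hun, h0, norm_zero, mul_zero, Real.log_zero]
      exact hM0
    · rw [hulog z h0]
      have h1 : Real.log ‖expSum φ h z‖ ≤ Real.log N + maxRe φ z / h := by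
        rw [← Real.log_exp (maxRe φ z / h), ← Real.log_mul (by positivity) (Real.exp_pos _).ne']
        exact Real.log_le_log (norm_pos_iff.2 h0) (norm_expSum_le φ hh z)
      have h2 := hdist z hz
      have h3 := le_abs_self (maxRe φ z - maxRe φ z₀)
      have h4 : (maxRe φ z - maxRe φ z₀) / h ≤ L * (K + K') := le_trans (by gcongr) h2
      rw [sub_div] at h4
      linarith
  have hu₀ : u z₀ ≠ 0 := mul_ne_zero (by exact_mod_cast (Real.exp_pos _).ne') hS₀
  have hjen := setLIntegral_ball_sub_log_norm_le hRpos hua hu₀ huM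
  have hlogu₀ : -1 ≤ Real.log ‖u z₀‖ := by
    rw [hulog z₀ hS₀]
    exact (abs_le.1 hE₀).1
  -- From `log|u| ≤ M` one gets `|log|u|| ≤ (M - log|u|) + M`; the variation of `Ψ/h` adds another
  -- `M`.
  have hae : ∀ᵐ z ∂(volume.restrict (Metric.ball z₀ R)), ‖logDefect φ h z‖ₑ ≤
      ENNReal.ofReal (M - Real.log ‖u z‖) + ENNReal.ofReal (2 * M) := by
    have h1 := ae_restrict_ne_zero (isCompact_closedBall z₀ R) han fun z hz => hord z (hsub hz)
    filter_upwards [ae_restrict_of_ae_restrict_of_subset Metric.ball_subset_closedBall h1,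
      ae_restrict_mem Metric.isOpen_ball.measurableSet] with z hz0 hz
    have hz' := Metric.ball_subset_closedBall hz
    have h2 := huM z hz'
    rw [← ENNReal.ofReal_add (by linarith) (by linarith), ← ofReal_norm]
    apply ENNReal.ofReal_le_ofReal
    have h3 : logDefect φ h z = Real.log ‖u z‖ - (maxRe φ z - maxRe φ z₀) / h := by
      rw [logDefect, hulog z hz0]
      ring
    have h4 : |(maxRe φ z - maxRe φ z₀) / h| ≤ M := by
      rw [abs_div, abs_of_pos hh]
      exact (hdist z hz').trans (by linarith)
    rw [h3, Real.norm_eq_abs, abs_le]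
    have h5 := abs_le.1 h4
    constructor <;> linarith
  calc ∫⁻ z in Metric.ball x (K * h), ‖logDefect φ h z‖ₑ
      ≤ ∫⁻ z in Metric.ball z₀ R, ‖logDefect φ h z‖ₑ := lintegral_mono_set hsub'
    _ ≤ ∫⁻ z in Metric.ball z₀ R, (ENNReal.ofReal (M - Real.log ‖u z‖) + ENNReal.ofReal (2 * M)) :=
        lintegral_mono_ae hae
    _ = (∫⁻ z in Metric.ball z₀ R, ENNReal.ofReal (M - Real.log ‖u z‖))
        + ENNReal.ofReal (2 * M) * volume (Metric.ball z₀ R) := by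
        rw [lintegral_add_right _ measurable_const, setLIntegral_const]
    _ ≤ ENNReal.ofReal (Real.pi * R ^ 2 * (M + 1)) +
        ENNReal.ofReal (2 * M) * ENNReal.ofReal (Real.pi * R ^ 2) := by
        gcongr
        · refine hjen.trans (ENNReal.ofReal_le_ofReal ?_)
          gcongr
          linarith
        · rw [Complex.volume_ball, ← ENNReal.ofReal_pow hRpos.le, mul_comm Real.pi,
            ENNReal.ofReal_mul (by positivity)]
          gcongr
          rw [← ENNReal.ofReal_coe_nnreal]
          exact le_of_eq rfl
    _ = _ := by
        rw [← ENNReal.ofReal_mul (by positivity),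
          ← ENNReal.ofReal_add (by positivity) (by positivity)]
        congr 1
        rw [hR]
        ring

/-- With `b = c/h` the value is `2πh²/c²`, the order of magnitude needed against `Δχ = O(h⁻²)`. -/
theorem lintegral_exp_neg_mul_norm_sub {b : ℝ} (hb : 0 < b) (x : ℂ) :
    ∫⁻ z : ℂ, ENNReal.ofReal (Real.exp (-(b * ‖z - x‖))) = ENNReal.ofReal (2 * Real.pi / b ^ 2) := by
  have h := Complex.integral_exp_neg_mul_rpow (p := 1) le_rfl hb
  have e : Real.pi * b ^ (-2 / 1 : ℝ) * Real.Gamma (2 / 1 + 1) = 2 * Real.pi / b ^ 2 := by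
    have : Real.Gamma (2 / 1 + 1) = 2 := by
      have := Real.Gamma_nat_eq_factorial 2
      norm_num at this ⊢
    rw [this, div_one, Real.rpow_neg hb.le]
    norm_cast
    ring
  rw [e] at h
  simp only [Real.rpow_one, neg_mul] at h
  have hint : Integrable fun z : ℂ => Real.exp (-(b * ‖z‖)) := by
    apply Integrable.of_integral_ne_zero
    rw [h]
    have := Real.pi_pos
    positivity
  rw [lintegral_sub_right_eq_self (fun z : ℂ => ENNReal.ofReal (Real.exp (-(b * ‖z‖)))) x, ← h,
    ofReal_integral_eq_lintegral_ofReal hint (Eventually.of_forall fun z => (Real.exp_pos _).le)]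

/-- The part of the boundary layer of width `3 h` that is close to `x`. -/
def boundaryLayer (γ : Set ℂ) (x : ℂ) (r h : ℝ) : Set ℂ :=
  {z ∈ Metric.ball x (r / 2) | ∃ y ∈ γ, dist z y ≤ 3 * h}

/-- In the boundary layer, zeros can occur only at distance `O(h)` from `x`, and the logarithmic
defect decays exponentially with the distance to `x`. -/
theorem HasDominance.boundaryLayer_dominant (H : HasDominance φ γ U x r c L) :
    ∃ K > 0, ∃ B, 0 ≤ B ∧ ∀ᶠ h in 𝓝[>] (0 : ℝ), ∀ z ∈ boundaryLayer γ x r h,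
      z ∉ Metric.ball x (K * h) → expSum φ h z ≠ 0 ∧
        |logDefect φ h z| ≤ B * Real.exp (-(c / h * ‖z - x‖)) ∧
        ∃ j, ∀ l, l ≠ j → (φ l z).re < (φ j z).re := by
  have hN : (1 : ℝ) ≤ N := by exact_mod_cast H.pos
  have hc := H.c_pos
  have hL := H.L_nonneg
  have hlog : 0 < Real.log (2 * N) := Real.log_pos (by linarith)
  set A := 2 * L + c with hA
  -- The margin at `z` is at least `m = c‖z - x‖ - 3Ah`. This `K` makes `m ≥ h log(2N)` outside the
  -- disc, and the factor `exp(3A)` comes from the loss `3Ah`.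
  refine ⟨(3 * A + Real.log (2 * N)) / c, by positivity, 2 * (N * Real.exp (3 * A)), by positivity,
    ?_⟩
  -- With `6h < r`, a point within `3h` of the half-radius ball still lies in the ball of radius
  -- `r`.
  filter_upwards [eventually_mul_lt 6 H.r_pos, self_mem_nhdsWithin] with h hr hh z ⟨hz, y, hyγ, hzy⟩ hzK
  have hh : 0 < h := hh
  have hz' : dist z x < r / 2 := hz
  have hzr : z ∈ Metric.ball x r := by
    rw [Metric.mem_ball]
    linarith [H.r_pos]
  have hyr : y ∈ Metric.ball x r := by
    rw [Metric.mem_ball]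
    have := dist_triangle y z x
    rw [dist_comm y z] at this
    linarith
  obtain ⟨j, hj⟩ := H.near_curve z hzr y hyr hyγ
  rw [← dist_eq_norm z y] at hj
  have hzK' : (3 * A + Real.log (2 * N)) / c * h ≤ ‖z - x‖ := by
    rw [← dist_eq_norm]
    exact not_lt.1 hzK
  rw [div_mul_eq_mul_div, div_le_iff₀ hc] at hzK'
  set m := c * ‖z - x‖ - A * (3 * h) with hm
  have hj' : ∀ l, l ≠ j → (φ l z).re ≤ (φ j z).re - m := by
    intro l hl
    have : A * dist z y ≤ A * (3 * h) := by gcongr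
    linarith [hj l hl]
  have hmh : Real.log (2 * N) ≤ m / h := by
    rw [le_div_iff₀ hh]
    linarith
  have hsmall : N * Real.exp (-(m / h)) ≤ 1 / 2 := by
    have : Real.exp (-(m / h)) ≤ (2 * N : ℝ)⁻¹ := by
      rw [← Real.exp_log (by positivity : (0 : ℝ) < 2 * N), ← Real.exp_neg]
      gcongr
    calc (N : ℝ) * Real.exp (-(m / h)) ≤ N * (2 * N : ℝ)⁻¹ := by gcongr
      _ = 1 / 2 := by field_simp
  obtain ⟨-, h1, h2⟩ := logDefect_of_dominant hh hj' hsmall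
  refine ⟨h1, h2.trans (le_of_eq ?_), j, fun l hl => ?_⟩
  · rw [mul_assoc, mul_assoc, ← Real.exp_add]
    congr 3
    rw [hm]
    field_simp
    ring
  · have : 0 < m := by
      by_contra hm0
      have := div_nonpos_of_nonpos_of_nonneg (not_lt.1 hm0) hh.le
      linarith
    linarith [hj' l hl]

/-- The disc of radius `Kh` is covered by Jensen's inequality, the rest of the layer by exponential
decay. -/
theorem HasDominance.lintegral_boundaryLayer_le (H : HasDominance φ γ U x r c L) (hU : IsOpen U)
    (hφ : ∀ j, DifferentiableOn ℂ (φ j) U) : ∃ C, 0 ≤ C ∧ ∀ᶠ h in 𝓝[>] (0 : ℝ),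
      ∫⁻ z in boundaryLayer γ x r h, ‖logDefect φ h z‖ₑ ≤ ENNReal.ofReal (C * h ^ 2) := by
  obtain ⟨K, hK, B, hB, hlay⟩ := H.boundaryLayer_dominant
  obtain ⟨C, hC, hball⟩ := H.lintegral_ball_logDefect_le hU hφ K hK
  have hc := H.c_pos
  have hpi := Real.pi_pos
  refine ⟨C + B * (2 * Real.pi / c ^ 2), by positivity, ?_⟩
  filter_upwards [hlay, hball, self_mem_nhdsWithin] with h hlay hball hh
  have hh : 0 < h := hh
  have hsub : boundaryLayer γ x r h ⊆ Metric.ball x (K * h) ∪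
      (boundaryLayer γ x r h \ Metric.ball x (K * h)) := by
    rw [union_sdiff_self]
    exact subset_union_right
  have h2 : ∫⁻ z in boundaryLayer γ x r h \ Metric.ball x (K * h), ‖logDefect φ h z‖ₑ
      ≤ ENNReal.ofReal (B * (2 * Real.pi / c ^ 2) * h ^ 2) := by
    calc _ ≤ ∫⁻ z in boundaryLayer γ x r h \ Metric.ball x (K * h),
          ENNReal.ofReal B * ENNReal.ofReal (Real.exp (-(c / h * ‖z - x‖))) := by
          refine setLIntegral_mono (by fun_prop) fun z hz => ?_
          rw [← ofReal_norm, Real.norm_eq_abs, ← ENNReal.ofReal_mul hB]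
          exact ENNReal.ofReal_le_ofReal (hlay z hz.1 hz.2).2.1
      _ ≤ ∫⁻ z, ENNReal.ofReal B * ENNReal.ofReal (Real.exp (-(c / h * ‖z - x‖))) :=
          setLIntegral_le_lintegral _ _
      _ = _ := by
          rw [lintegral_const_mul' _ _ ENNReal.ofReal_ne_top,
            lintegral_exp_neg_mul_norm_sub (by positivity), ← ENNReal.ofReal_mul hB]
          congr 1
          field_simp
  calc _ ≤ _ := lintegral_mono_set hsub
    _ ≤ _ := lintegral_union_le _ _ _
    _ ≤ ENNReal.ofReal (C * h ^ 2) + ENNReal.ofReal (B * (2 * Real.pi / c ^ 2) * h ^ 2) :=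
        add_le_add hball h2
    _ = _ := by
        rw [← ENNReal.ofReal_add (by positivity) (by positivity)]
        congr 1
        ring

end LocalEstimates

/-! ### The measure `ΔΨ` on test functions and near dominated points. -/

section LaplacianMeasure

variable {N : ℕ} {φ : Fin N → ℂ → ℂ} {U : Opens ℂ} {μ : Measure ℂ}

theorem integrable_of_measure_tsupport_lt_top {χ : ℂ → ℝ} (hχ : Continuous χ)
    (hc : HasCompactSupport χ) (hμ : μ (tsupport χ) < ⊤) : Integrable χ μ := by
  obtain ⟨C, hC⟩ := hc.exists_bound_of_continuous hχ
  rw [← integrableOn_iff_integrable_of_support_subset (subset_tsupport χ)]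
  exact Measure.integrableOn_of_bounded hμ.ne hχ.aestronglyMeasurable (Eventually.of_forall hC)

theorem IsLaplacianMeasure.integral_eq {Ψ : ℂ → ℝ} (hμ : IsLaplacianMeasure U Ψ μ) {χ : ℂ → ℝ}
    (hχ : ContDiff ℝ ∞ χ) (hc : HasCompactSupport χ) (hU : tsupport χ ⊆ U) :
    ∫ z, Ψ z * planeLaplacian χ z = ∫ z, χ z ∂μ := by
  have h := hμ.2 ⟨χ, hχ, hc, hU⟩
  simp only [testLaplacian_apply] at h
  exact h

theorem IsLaplacianMeasure.integrable {Ψ : ℂ → ℝ} (hμ : IsLaplacianMeasure U Ψ μ) {χ : ℂ → ℝ}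
    (hχ : Continuous χ) (hc : HasCompactSupport χ) (hU : tsupport χ ⊆ U) : Integrable χ μ :=
  integrable_of_measure_tsupport_lt_top hχ hc (hμ.1 _ hc hU)

/-- A Laplacian measure is bounded by its values on test functions. -/
theorem IsLaplacianMeasure.measure_le {Ψ : ℂ → ℝ} (hμ : IsLaplacianMeasure U Ψ μ) {χ : ℂ → ℝ}
    (hχ : ContDiff ℝ ∞ χ) (hc : HasCompactSupport χ) (hU : tsupport χ ⊆ U) (h0 : ∀ z, 0 ≤ χ z)
    {A : Set ℂ} (hA : ∀ z ∈ A, χ z = 1) :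
    μ A ≤ ENNReal.ofReal (∫ z, Ψ z * planeLaplacian χ z) := by
  rw [hμ.integral_eq hχ hc hU, ofReal_integral_eq_lintegral_ofReal
    (hμ.integrable hχ.continuous hc hU) (Eventually.of_forall h0)]
  calc μ A ≤ μ {z | 1 ≤ ENNReal.ofReal (χ z)} := measure_mono fun z hz => by simp [hA z hz]
    _ ≤ _ := by
      have := meas_ge_le_lintegral_div (μ := μ) (f := fun z => ENNReal.ofReal (χ z))
        hχ.continuous.measurable.ennreal_ofReal.aemeasurable one_ne_zero ENNReal.one_ne_top
      simpa using this

/-- A strict maximum persists nearby, so `Ψ` coincides there with the harmonic function `Re φ_j`. -/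
theorem IsLaplacianMeasure.exists_null_nhds (hμ : IsLaplacianMeasure U (maxRe φ) μ)
    (hφ : ∀ j, DifferentiableOn ℂ (φ j) U) {z : ℂ} (hz : z ∈ U) {j : Fin N}
    (hj : ∀ l, l ≠ j → (φ l z).re < (φ j z).re) : ∃ W ∈ 𝓝 z, μ W = 0 := by
  have hU : (U : Set ℂ) ∈ 𝓝 z := U.isOpen.mem_nhds hz
  have hcont (l : Fin N) : ContinuousAt (fun w => (φ l w).re) z :=
    Complex.continuous_re.continuousAt.comp ((hφ l).differentiableAt hU).continuousAt
  have hev : ∀ᶠ w in 𝓝 z, w ∈ U ∧ ∀ l, l ≠ j → (φ l w).re < (φ j w).re := by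
    refine (eventually_mem_set.2 hU).and (eventually_all.2 fun l => ?_)
    by_cases hl : l = j
    · exact Eventually.of_forall fun w h => absurd hl h
    · filter_upwards [(hcont l).eventually_lt (hcont j) (hj l hl)] with w hw _ using hw
  obtain ⟨V, hV, hVo, hzV⟩ := eventually_nhds_iff.1 hev
  obtain ⟨δ, hδ, hδV⟩ := Metric.mem_nhds_iff.1 (hVo.mem_nhds hzV)
  obtain ⟨χ, hχ, hc, hχV, h01, h1⟩ := exists_smooth_cutoff
    (isCompact_closedBall z (δ / 2)) hVo ((Metric.closedBall_subset_ball (by linarith)).trans hδV)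
  refine ⟨Metric.closedBall z (δ / 2), Metric.closedBall_mem_nhds z (by positivity), ?_⟩
  have hle := hμ.measure_le hχ hc (hχV.trans fun w hw => (hV w hw).1) (fun w => (h01 w).1) h1
  have hzero : ∫ w, maxRe φ w * planeLaplacian χ w = 0 := by
    have harm : InnerProductSpace.HarmonicOnNhd (fun w => (φ j w).re) V := fun w hw =>
      ((hφ j).analyticAt (U.isOpen.mem_nhds (hV w hw).1)).harmonicAt_re
    rw [← integral_mul_planeLaplacian_eq_zero hVo harm hχ hc hχV]
    refine integral_congr_ae (Eventually.of_forall fun w => ?_)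
    by_cases hw : w ∈ tsupport (planeLaplacian χ)
    · have hwV := hχV (tsupport_planeLaplacian_subset χ hw)
      have : maxRe φ w = (φ j w).re := maxRe_eq_of_le j.pos fun l => by
        by_cases hl : l = j
        · rw [hl]
        · exact ((hV w hwV).2 l hl).le
      simp only [this]
    · simp only [image_eq_zero_of_notMem_tsupport hw, mul_zero]
  rw [hzero, ENNReal.ofReal_zero] at hle
  exact le_antisymm hle zero_le

end LaplacianMeasure

/-! ### Zeros and mass near a boundary point. -/

section LocalCounting

/-- The `L¹`–`L^∞` bound, phrased with a lower integral so that `f` and `A` need not be measurable.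
-/
theorem abs_integral_mul_le {f g : ℂ → ℝ} {A : Set ℂ} {I D : ℝ} (hI : 0 ≤ I) (hD : 0 ≤ D)
    (hf : ∫⁻ z in A, ‖f z‖ₑ ≤ ENNReal.ofReal I) (hg : ∀ z, |g z| ≤ D) (hgA : ∀ z ∉ A, g z = 0) :
    |∫ z, f z * g z| ≤ I * D := by
  have h1 : ‖∫ z, f z * g z‖ₑ ≤ ENNReal.ofReal (I * D) := by
    calc ‖∫ z, f z * g z‖ₑ ≤ ∫⁻ z, ‖f z * g z‖ₑ := enorm_integral_le_lintegral_enorm _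
      _ ≤ ∫⁻ z, A.indicator (fun z => ‖f z‖ₑ * ENNReal.ofReal D) z := by
          refine lintegral_mono fun z => ?_
          by_cases hz : z ∈ A
          · rw [indicator_of_mem hz, enorm_mul]
            gcongr
            rw [← ofReal_norm]
            exact ENNReal.ofReal_le_ofReal (hg z)
          · simp [hgA z hz]
      _ ≤ ∫⁻ z in A, ‖f z‖ₑ * ENNReal.ofReal D := lintegral_indicator_le _ _
      _ ≤ _ := by
          rw [lintegral_mul_const' _ _ ENNReal.ofReal_ne_top, ENNReal.ofReal_mul hI]
          gcongr
  rw [← ofReal_norm, ENNReal.ofReal_le_ofReal_iff (by positivity)] at h1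
  exact h1

variable {N : ℕ} {φ : Fin N → ℂ → ℂ} {γ : Set ℂ} {U : Opens ℂ} {x : ℂ} {r c L : ℝ}

/-- A bump function at the scale `h`. -/
theorem HasDominance.exists_bump (H : HasDominance φ γ U x r c L) (K : ℝ) (hK : 0 < K) :
    ∃ C, 0 ≤ C ∧ ∀ᶠ h in 𝓝[>] (0 : ℝ), ∃ θ : ℂ → ℝ, ContDiff ℝ ∞ θ ∧ HasCompactSupport θ ∧
      (∀ z, 0 ≤ θ z) ∧ (∀ z ∈ Metric.ball x (K * h), θ z = 1) ∧
      tsupport θ ⊆ Metric.closedBall x (3 * (K * h)) ∧ Metric.closedBall x (3 * (K * h)) ⊆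
        Metric.ball x r ∧ (∀ z, |planeLaplacian θ z| ≤ C / h ^ 2) ∧
      |∫ z, maxRe φ z * planeLaplacian θ z| ≤ C * h := by
  obtain ⟨C, hC, hmol⟩ := exists_mollified_indicator
  have hL := H.L_nonneg
  have hpi := Real.pi_pos
  refine ⟨C / K ^ 2 + L * (3 * K) * (Real.pi * (3 * K) ^ 2) * (C / K ^ 2), by positivity, ?_⟩
  filter_upwards [eventually_mul_lt (3 * K) H.r_pos, self_mem_nhdsWithin] with h hhr hh
  have hh : 0 < h := hh
  have hKh : 0 < K * h := by positivity
  -- Mollifying the disc of radius `2Kh` at scale `Kh` gives `1` on radius `Kh` and support within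
  -- radius `3Kh`.
  obtain ⟨θ, hθ, h01, h1, h0, hlap⟩ := hmol (Metric.ball x (2 * (K * h)))
    Metric.isOpen_ball.measurableSet (K * h) hKh
  have hts : tsupport θ ⊆ Metric.closedBall x (3 * (K * h)) := by
    refine closure_minimal (fun z hz => ?_) Metric.isClosed_closedBall
    by_contra hzb
    refine hz (h0 z (Set.disjoint_left.2 fun w hw hw' => hzb ?_))
    rw [Metric.mem_closedBall] at hw ⊢
    rw [Metric.mem_ball] at hw'
    have := dist_triangle z w x
    rw [dist_comm z w] at this
    linarith
  have hc : HasCompactSupport θ :=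
    (isCompact_closedBall _ _).of_isClosed_subset (isClosed_tsupport θ) hts
  have hsub : Metric.closedBall x (3 * (K * h)) ⊆ Metric.ball x r :=
    Metric.closedBall_subset_ball (by linarith)
  have hlc := continuous_planeLaplacian hθ
  have hlt := tsupport_planeLaplacian_subset θ
  have hls : HasCompactSupport (planeLaplacian θ) := hc.mono' (subset_closure.trans hlt)
  have e : C / (K * h) ^ 2 = C / K ^ 2 / h ^ 2 := by rw [mul_pow, div_div]
  have hxr : x ∈ Metric.ball x r := Metric.mem_ball_self H.r_pos
  refine ⟨θ, hθ, hc, fun z => (h01 z).1, fun z hz => h1 z ?_, hts, hsub, fun z => ?_, ?_⟩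
  · refine Metric.closedBall_subset_ball' ?_
    rw [Metric.mem_ball] at hz
    linarith
  · refine (hlap z).trans ?_
    rw [e]
    gcongr
    exact le_add_of_nonneg_right (by positivity)
  -- Since `∫ Δθ = 0`, `Ψ` may be replaced by `Ψ - Ψ(x) = O(h)`. The disc has area `O(h²)` and `Δθ =
  -- O(h⁻²)`, so the integral is `O(h)`.
  · have hconst : ∫ z, maxRe φ x * planeLaplacian θ z = 0 :=
      integral_mul_planeLaplacian_eq_zero isOpen_univ
        (InnerProductSpace.harmonicOnNhd_const (maxRe φ x)) hθ hc (subset_univ _)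
    have hint1 : Integrable fun z => maxRe φ z * planeLaplacian θ z :=
      integrable_mul_of_tsupport_subset Metric.isOpen_ball H.continuousOn_maxRe hlc hls
        ((hlt.trans hts).trans hsub)
    have hint2 : Integrable fun z => maxRe φ x * planeLaplacian θ z :=
      (hlc.integrable_of_hasCompactSupport hls).const_mul _
    have heq : ∫ z, maxRe φ z * planeLaplacian θ z
        = ∫ z, (maxRe φ z - maxRe φ x) * planeLaplacian θ z := by
      simp only [sub_mul]
      rw [integral_sub hint1 hint2, hconst, sub_zero]
    rw [heq]
    have hI : ∫⁻ z in Metric.closedBall x (3 * (K * h)), ‖maxRe φ z - maxRe φ x‖ₑ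
        ≤ ENNReal.ofReal (L * (3 * (K * h)) * (Real.pi * (3 * (K * h)) ^ 2)) := by
      calc _ ≤ ∫⁻ z in Metric.closedBall x (3 * (K * h)), ENNReal.ofReal (L * (3 * (K * h))) := by
            refine setLIntegral_mono measurable_const fun z hz => ?_
            rw [← ofReal_norm]
            apply ENNReal.ofReal_le_ofReal
            refine (H.abs_maxRe_sub_le (hsub hz) hxr).trans ?_
            gcongr
            rw [← dist_eq_norm]
            exact hz
        _ = ENNReal.ofReal (L * (3 * (K * h))) * volume (Metric.closedBall x (3 * (K * h))) :=
            setLIntegral_const _ _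
        _ = _ := by
            rw [Complex.volume_closedBall, ENNReal.ofReal_mul (p := L * (3 * (K * h)))
              (by positivity), ENNReal.ofReal_mul hpi.le, ENNReal.ofReal_pow (by positivity),
              mul_comm (ENNReal.ofReal Real.pi)]
            congr 2
            rw [← NNReal.coe_real_pi, ENNReal.ofReal_coe_nnreal]
    refine (abs_integral_mul_le (by positivity) (by positivity) hI hlap fun z hz => ?_).trans ?_
    · exact image_eq_zero_of_notMem_tsupport fun h' => hz (hts (hlt h'))
    · have : L * (3 * (K * h)) * (Real.pi * (3 * (K * h)) ^ 2) * (C / (K * h) ^ 2)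
          = L * (3 * K) * (Real.pi * (3 * K) ^ 2) * (C / K ^ 2) * h := by
        field_simp
      rw [this]
      gcongr
      exact le_add_of_nonneg_left (by positivity)

/-- There are `O(1)` zeros at distance `O(h)` from `x`. -/
theorem HasDominance.sum_order_le (H : HasDominance φ γ U x r c L)
    (hφ : ∀ j, DifferentiableOn ℂ (φ j) U) (K : ℝ) (hK : 0 < K) :
    ∃ C, 0 ≤ C ∧ ∀ᶠ h in 𝓝[>] (0 : ℝ), ∀ Z : Finset ℂ, (∀ a ∈ Z, a ∈ Metric.ball x (K * h)) →
      ∑ a ∈ Z, (analyticOrderNatAt (expSum φ h) a : ℝ) ≤ C := by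
  obtain ⟨C₁, hC₁, hbump⟩ := H.exists_bump K hK
  -- The open disc of radius `4Kh` contains the support of the bump, which lies in the closed disc
  -- of radius `3Kh`.
  obtain ⟨C₂, hC₂, hL1⟩ := H.lintegral_ball_logDefect_le U.isOpen hφ (4 * K) (by positivity)
  refine ⟨C₂ * C₁ + C₁, by positivity, ?_⟩
  filter_upwards [hbump, hL1, H.eventually_order_ne_top U.isOpen hφ, self_mem_nhdsWithin] with
    h ⟨θ, hθ, hc, h0, h1, hts, hsub, hlap, hint⟩ hL1 hord hh Z hZ
  have hh : 0 < h := hh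
  have htr : tsupport θ ⊆ Metric.ball x r := hts.trans hsub
  have han : AnalyticOnNhd ℂ (expSum φ h) (tsupport θ) :=
    (analyticOnNhd_expSum U.isOpen hφ h).mono (htr.trans H.ball_subset)
  have hord' : ∀ z ∈ tsupport θ, analyticOrderAt (expSum φ h) z ≠ ⊤ := fun z hz => hord z (htr hz)
  have hK' : IsCompact (tsupport θ) := hc
  obtain ⟨Z₀, -, hZ₀, -⟩ := exists_log_norm_ae_eq hK' han hord'
  classical
  -- The counting formula needs all zeros on the support, while `Z` is an arbitrary finite set; the
  -- union serves both, and nonnegative terms allow restriction to `Z`.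
  have hcount := integral_log_norm_mul_planeLaplacian_eq_sum hθ hc han hord' (Z ∪ Z₀)
    fun a ha h0 => Finset.mem_union_right _ ((hZ₀ a).2 ⟨ha, h0⟩)
  have hlc := continuous_planeLaplacian hθ
  have hlt := tsupport_planeLaplacian_subset θ
  have hls : HasCompactSupport (planeLaplacian θ) := hc.mono' (subset_closure.trans hlt)
  have hi1 : Integrable fun z => Real.log ‖expSum φ h z‖ * planeLaplacian θ z :=
    integrable_mul_of_integrableOn hlc hls ((integrableOn_log_norm hK' han hord').mono_set hlt)
  have hi2 : Integrable fun z => maxRe φ z * planeLaplacian θ z :=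
    integrable_mul_of_tsupport_subset Metric.isOpen_ball H.continuousOn_maxRe hlc hls (hlt.trans htr)
  have hsplit : ∫ z, Real.log ‖expSum φ h z‖ * planeLaplacian θ z
      = (∫ z, logDefect φ h z * planeLaplacian θ z) + h⁻¹ * ∫ z, maxRe φ z * planeLaplacian θ z := by
    have e : ∀ z, logDefect φ h z * planeLaplacian θ z = Real.log ‖expSum φ h z‖ * planeLaplacian θ z
        - h⁻¹ * (maxRe φ z * planeLaplacian θ z) := fun z => by rw [logDefect]; ring
    simp only [e]
    rw [integral_sub hi1 (hi2.const_mul _), integral_const_mul]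
    ring
  have hE : |∫ z, logDefect φ h z * planeLaplacian θ z| ≤ C₂ * h ^ 2 * (C₁ / h ^ 2) := by
    refine abs_integral_mul_le (by positivity) (by positivity) hL1 hlap fun z hz => ?_
    refine image_eq_zero_of_notMem_tsupport fun h' => hz ?_
    have := hts (hlt h')
    rw [Metric.mem_closedBall] at this
    rw [Metric.mem_ball]
    have : 0 < K * h := by positivity
    linarith
  have e1 : C₂ * h ^ 2 * (C₁ / h ^ 2) = C₂ * C₁ := by field_simp
  rw [e1] at hE
  have hM : h⁻¹ * ∫ z, maxRe φ z * planeLaplacian θ z ≤ C₁ := by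
    rw [inv_mul_le_iff₀ hh, mul_comm]
    exact (le_abs_self _).trans hint
  have hpi := Real.pi_gt_three
  have hsum : ∑ a ∈ Z, (analyticOrderNatAt (expSum φ h) a : ℝ)
      ≤ ∑ a ∈ Z ∪ Z₀, (analyticOrderNatAt (expSum φ h) a : ℝ) * θ a := by
    calc _ = ∑ a ∈ Z, (analyticOrderNatAt (expSum φ h) a : ℝ) * θ a :=
          Finset.sum_congr rfl fun a ha => by rw [h1 a (hZ a ha), mul_one]
      _ ≤ _ := Finset.sum_le_sum_of_subset_of_nonneg Finset.subset_union_left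
          fun a _ _ => mul_nonneg (Nat.cast_nonneg _) (h0 a)
  have hpos : 0 ≤ ∑ a ∈ Z ∪ Z₀, (analyticOrderNatAt (expSum φ h) a : ℝ) * θ a :=
    Finset.sum_nonneg fun a _ => mul_nonneg (Nat.cast_nonneg _) (h0 a)
  rw [hsplit] at hcount
  have := (abs_le.1 hE).2
  nlinarith

/-- Off the disc of radius `Kh` one exponent is strictly maximal, so the layer is `μ`-null there;
the disc has mass at most `∫ θ dμ = ∫ Ψ Δθ = O(h)`. -/
theorem HasDominance.measure_boundaryLayer_le (H : HasDominance φ γ U x r c L)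
    (hφ : ∀ j, DifferentiableOn ℂ (φ j) U) {μ : Measure ℂ}
    (hμ : IsLaplacianMeasure U (maxRe φ) μ) : ∃ C, 0 ≤ C ∧ ∀ᶠ h in 𝓝[>] (0 : ℝ),
      μ (boundaryLayer γ x r h) ≤ ENNReal.ofReal (C * h) := by
  obtain ⟨K, hK, B, hB, hlay⟩ := H.boundaryLayer_dominant
  obtain ⟨C, hC, hbump⟩ := H.exists_bump K hK
  refine ⟨C, hC, ?_⟩
  filter_upwards [hlay, hbump] with h hlay ⟨θ, hθ, hc, h0, h1, hts, hsub, hlap, hint⟩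
  have hnull : μ (boundaryLayer γ x r h \ Metric.ball x (K * h)) = 0 := by
    refine measure_null_of_locally_null _ fun z hz => ?_
    obtain ⟨-, -, j, hj⟩ := hlay z hz.1 hz.2
    have hzU : z ∈ U := by
      refine H.ball_subset (Metric.ball_subset_ball ?_ hz.1.1)
      linarith [H.r_pos]
    obtain ⟨W, hW, hW0⟩ := hμ.exists_null_nhds hφ hzU hj
    exact ⟨W, mem_nhdsWithin_of_mem_nhds hW, hW0⟩
  calc μ (boundaryLayer γ x r h)
      ≤ μ (Metric.ball x (K * h) ∪ (boundaryLayer γ x r h \ Metric.ball x (K * h))) := by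
        rw [union_sdiff_self]
        exact measure_mono subset_union_right
    _ ≤ μ (Metric.ball x (K * h)) + 0 := (measure_union_le _ _).trans_eq (by rw [hnull])
    _ ≤ ENNReal.ofReal (∫ z, maxRe φ z * planeLaplacian θ z) := by
        rw [add_zero]
        exact hμ.measure_le hθ hc ((hts.trans hsub).trans H.ball_subset) h0 h1
    _ ≤ _ := ENNReal.ofReal_le_ofReal ((le_abs_self _).trans hint)

/-- There are `O(1)` zeros in the boundary layer. -/
theorem HasDominance.sum_order_boundaryLayer_le (H : HasDominance φ γ U x r c L)
    (hφ : ∀ j, DifferentiableOn ℂ (φ j) U) : ∃ C, 0 ≤ C ∧ ∀ᶠ h in 𝓝[>] (0 : ℝ), ∀ Z : Finset ℂ,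
      (∀ a ∈ Z, a ∈ boundaryLayer γ x r h ∧ expSum φ h a = 0) →
      ∑ a ∈ Z, (analyticOrderNatAt (expSum φ h) a : ℝ) ≤ C := by
  obtain ⟨K, hK, B, hB, hlay⟩ := H.boundaryLayer_dominant
  obtain ⟨C, hC, hsum⟩ := H.sum_order_le hφ K hK
  refine ⟨C, hC, ?_⟩
  filter_upwards [hlay, hsum] with h hlay hsum Z hZ
  refine hsum Z fun a ha => ?_
  by_contra hab
  exact (hlay a (hZ a ha).1 hab).1 (hZ a ha).2

end LocalCounting

/-! ### From local bounds to the whole collar. -/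

section Collar

variable {N : ℕ} {φ : Fin N → ℂ → ℂ} {γ : Set ℂ} {U : Opens ℂ}

/-- Finitely many half-radius balls cover `γ`, hence also a thickening of `γ`; once `3h` is below
its width the boundary layers cover the collar. -/
theorem exists_finite_dominance_cover (hγ : IsCompact γ)
    (H : ∀ x ∈ γ, ∃ r c L, HasDominance φ γ U x r c L) :
    ∃ (t : Finset ℂ) (r c L : ℂ → ℝ), (∀ x ∈ t, HasDominance φ γ U x (r x) (c x) (L x)) ∧
      ∀ᶠ h in 𝓝[>] (0 : ℝ), Metric.cthickening (3 * h) γ ⊆ ⋃ x ∈ t, boundaryLayer γ x (r x) h := by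
  choose! r c L H using H
  obtain ⟨t, ht, hcov⟩ := hγ.elim_nhds_subcover (fun x => Metric.ball x (r x / 2))
    fun x hx => Metric.ball_mem_nhds x (half_pos (H x hx).r_pos)
  obtain ⟨δ, hδ, hδV⟩ := hγ.exists_cthickening_subset_open
    (isOpen_biUnion fun x _ => Metric.isOpen_ball) hcov
  refine ⟨t, r, c, L, fun x hx => H x (ht x hx), ?_⟩
  filter_upwards [eventually_mul_lt 3 hδ, self_mem_nhdsWithin] with h hhδ hh z hz
  have hh : 0 < h := hh
  have hzV := hδV (Metric.cthickening_mono hhδ.le γ hz)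
  rw [hγ.cthickening_eq_biUnion_closedBall (by positivity)] at hz
  simp only [mem_iUnion, exists_prop] at hzV hz ⊢
  obtain ⟨x, hx, hzx⟩ := hzV
  obtain ⟨y, hy, hzy⟩ := hz
  exact ⟨x, hx, hzx, y, hy, hzy⟩

/-- The bounds in the collar of width `3 * h` around a compact curve. -/
theorem exists_collar_bounds (hγ : IsCompact γ)
    (H : ∀ x ∈ γ, ∃ r c L, HasDominance φ γ U x r c L) (hφ : ∀ j, DifferentiableOn ℂ (φ j) U)
    {μ : Measure ℂ} (hμ : IsLaplacianMeasure U (maxRe φ) μ) :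
    ∃ C, 0 ≤ C ∧ ∀ᶠ h in 𝓝[>] (0 : ℝ), Metric.cthickening (3 * h) γ ⊆ U ∧
      (∀ z ∈ Metric.cthickening (3 * h) γ, analyticOrderAt (expSum φ h) z ≠ ⊤) ∧
      ∫⁻ z in Metric.cthickening (3 * h) γ, ‖logDefect φ h z‖ₑ ≤ ENNReal.ofReal (C * h ^ 2) ∧
      μ (Metric.cthickening (3 * h) γ) ≤ ENNReal.ofReal (C * h) ∧
      ∀ Z : Finset ℂ, (∀ a ∈ Z, a ∈ Metric.cthickening (3 * h) γ ∧ expSum φ h a = 0) →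
        ∑ a ∈ Z, (analyticOrderNatAt (expSum φ h) a : ℝ) ≤ C := by
  obtain ⟨t, r, c, L, H, hcov⟩ := exists_finite_dominance_cover hγ H
  have h1 (x : ℂ) : ∃ C, 0 ≤ C ∧ (x ∈ t → ∀ᶠ h in 𝓝[>] (0 : ℝ),
      ∫⁻ z in boundaryLayer γ x (r x) h, ‖logDefect φ h z‖ₑ ≤ ENNReal.ofReal (C * h ^ 2) ∧
      μ (boundaryLayer γ x (r x) h) ≤ ENNReal.ofReal (C * h) ∧
      ∀ Z : Finset ℂ, (∀ a ∈ Z, a ∈ boundaryLayer γ x (r x) h ∧ expSum φ h a = 0) →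
        ∑ a ∈ Z, (analyticOrderNatAt (expSum φ h) a : ℝ) ≤ C) := by
    by_cases hx : x ∈ t
    · obtain ⟨C₁, h₁, e₁⟩ := (H x hx).lintegral_boundaryLayer_le U.isOpen hφ
      obtain ⟨C₂, h₂, e₂⟩ := (H x hx).measure_boundaryLayer_le hφ hμ
      obtain ⟨C₃, h₃, e₃⟩ := (H x hx).sum_order_boundaryLayer_le hφ
      refine ⟨C₁ + C₂ + C₃, by positivity, fun _ => ?_⟩
      filter_upwards [e₁, e₂, e₃, self_mem_nhdsWithin] with h e₁ e₂ e₃ hh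
      have hh : 0 < h := hh
      refine ⟨e₁.trans ?_, e₂.trans ?_, fun Z hZ => (e₃ Z hZ).trans (by linarith)⟩
      · gcongr; linarith
      · gcongr; linarith
    · exact ⟨0, le_rfl, fun h => absurd h hx⟩
  choose C hC hb using h1
  have hb' := (Filter.eventually_all_finset t).2 hb
  have ho := (Filter.eventually_all_finset t).2
    fun x hx => (H x hx).eventually_order_ne_top U.isOpen hφ
  refine ⟨∑ x ∈ t, C x, Finset.sum_nonneg fun x _ => hC x, ?_⟩
  filter_upwards [hcov, hb', ho, self_mem_nhdsWithin] with h hcov hb ho hh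
  have hh : 0 < h := hh
  have hmem : ∀ z ∈ Metric.cthickening (3 * h) γ, ∃ x ∈ t, z ∈ boundaryLayer γ x (r x) h := by
    intro z hz
    simpa using hcov hz
  have hball : ∀ x ∈ t, ∀ z ∈ boundaryLayer γ x (r x) h, z ∈ Metric.ball x (r x) := fun x hx z hz =>
    Metric.ball_subset_ball (by linarith [(H x hx).r_pos]) hz.1
  refine ⟨fun z hz => ?_, fun z hz => ?_, ?_, ?_, fun Z hZ => ?_⟩
  · obtain ⟨x, hx, hzx⟩ := hmem z hz
    exact (H x hx).ball_subset (hball x hx z hzx)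
  · obtain ⟨x, hx, hzx⟩ := hmem z hz
    exact ho x hx z (hball x hx z hzx)
  · calc _ ≤ ∫⁻ z in ⋃ x ∈ t, boundaryLayer γ x (r x) h, ‖logDefect φ h z‖ₑ :=
          lintegral_mono_set hcov
      _ ≤ ∑ x ∈ t, ∫⁻ z in boundaryLayer γ x (r x) h, ‖logDefect φ h z‖ₑ := by
          -- Subadditivity of the lower integral over the cover is subadditivity of the measure with
          -- this density.
          have := measure_biUnion_finset_le (μ := volume.withDensity fun z => ‖logDefect φ h z‖ₑ) t
            (fun x => boundaryLayer γ x (r x) h)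
          simpa only [withDensity_apply'] using this
      _ ≤ ∑ x ∈ t, ENNReal.ofReal (C x * h ^ 2) := Finset.sum_le_sum fun x hx => (hb x hx).1
      _ = _ := by
          rw [Finset.sum_mul, ENNReal.ofReal_sum_of_nonneg]
          exact fun x _ => mul_nonneg (hC x) (by positivity)
  · calc _ ≤ μ (⋃ x ∈ t, boundaryLayer γ x (r x) h) := measure_mono hcov
      _ ≤ ∑ x ∈ t, μ (boundaryLayer γ x (r x) h) := measure_biUnion_finset_le _ _
      _ ≤ ∑ x ∈ t, ENNReal.ofReal (C x * h) := Finset.sum_le_sum fun x hx => (hb x hx).2.1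
      _ = _ := by
          rw [Finset.sum_mul, ENNReal.ofReal_sum_of_nonneg]
          exact fun x _ => mul_nonneg (hC x) hh.le
  · classical
    -- Each zero lies in at least one layer, so counting it once for every layer containing it only
    -- increases the sum.
    calc _ ≤ ∑ a ∈ Z, ∑ x ∈ t, if a ∈ boundaryLayer γ x (r x) h then
            (analyticOrderNatAt (expSum φ h) a : ℝ) else 0 := by
          refine Finset.sum_le_sum fun a ha => ?_
          obtain ⟨x, hx, hax⟩ := hmem a (hZ a ha).1
          calc _ = if a ∈ boundaryLayer γ x (r x) h then
                (analyticOrderNatAt (expSum φ h) a : ℝ) else 0 := (if_pos hax).symm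
            _ ≤ _ := Finset.single_le_sum (f := fun x => if a ∈ boundaryLayer γ x (r x) h then
                (analyticOrderNatAt (expSum φ h) a : ℝ) else 0)
                (fun y _ => by positivity) hx
      _ = ∑ x ∈ t, ∑ a ∈ Z.filter (· ∈ boundaryLayer γ x (r x) h),
            (analyticOrderNatAt (expSum φ h) a : ℝ) := by
          rw [Finset.sum_comm]
          simp only [Finset.sum_filter]
      _ ≤ _ := by
          refine Finset.sum_le_sum fun x hx => (hb x hx).2.2 _ fun a ha => ?_
          rw [Finset.mem_filter] at ha
          exact ⟨ha.2, (hZ a ha.1).2⟩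

end Collar

/-! ### Cutoff functions that switch inside the collar. -/

section CollarCutoff

variable {Γ : Set ℂ}

/-- The segment from `z` to a nearest point of the complement must cross the boundary, by
connectedness. -/
theorem mem_cthickening_frontier {z : ℂ} {δ : ℝ} (hΓ : IsOpen Γ) (hb : Bornology.IsBounded Γ)
    (hz : z ∈ Γ) (hd : Metric.infDist z Γᶜ ≤ δ) : z ∈ Metric.cthickening δ (frontier Γ) := by
  -- Boundedness is needed: the distance to an empty complement would be `0` by convention.
  have hne : (Γᶜ).Nonempty := by
    rw [nonempty_compl]
    rintro rfl
    exact NormedSpace.unbounded_univ ℂ ℂ hb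
  obtain ⟨w, hw, hzw⟩ := hΓ.isClosed_compl.exists_infDist_eq_dist hne z
  have hseg : (segment ℝ z w ∩ frontier Γ).Nonempty := by
    by_contra hemp
    have hpre : IsPreconnected (segment ℝ z w) := (convex_segment z w).isPreconnected
    have hcov : segment ℝ z w ⊆ Γ ∪ (closure Γ)ᶜ := fun y hy => by
      by_contra hcon
      simp only [mem_union, mem_compl_iff, not_or, not_not] at hcon
      exact hemp ⟨y, hy, by rw [hΓ.frontier_eq]; exact ⟨hcon.2, hcon.1⟩⟩
    obtain ⟨y, -, hy1, hy2⟩ := hpre Γ (closure Γ)ᶜ hΓ isClosed_closure.isOpen_compl hcov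
      ⟨z, left_mem_segment ℝ z w, hz⟩
      ⟨w, right_mem_segment ℝ z w, (hcov (right_mem_segment ℝ z w)).resolve_left hw⟩
    exact hy2 (subset_closure hy1)
  obtain ⟨y, hy, hyf⟩ := hseg
  refine Metric.mem_cthickening_of_dist_le z y δ _ hyf ?_
  have h1 := segment_subset_closedBall_left z w hy
  rw [Metric.mem_closedBall, dist_comm] at h1
  linarith

/-- `χ` is a cutoff function in `Γ` that switches at distance between `h` and `3 * h` from the
boundary. -/
structure IsCollarCutoff (Γ : Set ℂ) (D h : ℝ) (χ : ℂ → ℝ) : Prop where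
  contDiff : ContDiff ℝ ∞ χ
  hasCompactSupport : HasCompactSupport χ
  tsupport_subset : tsupport χ ⊆ Γ
  nonneg : ∀ z, 0 ≤ χ z
  le_one : ∀ z, χ z ≤ 1
  eq_one : ∀ z ∈ Γ, z ∉ Metric.cthickening (3 * h) (frontier Γ) → χ z = 1
  abs_planeLaplacian_le : ∀ z, |planeLaplacian χ z| ≤ D / h ^ 2

/-- Mollifying the indicator of the points at distance at least `2h` from the complement, at scale
`h`, gives `0` below distance `h` and `1` beyond `3h`. -/
theorem exists_isCollarCutoff (hΓ : IsOpen Γ) (hb : Bornology.IsBounded Γ) :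
    ∃ D, 0 ≤ D ∧ ∀ h, 0 < h → ∃ χ, IsCollarCutoff Γ D h χ := by
  obtain ⟨D, hD, hmol⟩ := exists_mollified_indicator
  refine ⟨D, hD, fun h hh => ?_⟩
  have hcont : Continuous fun z => Metric.infDist z Γᶜ := Metric.continuous_infDist_pt _
  obtain ⟨χ, hχ, h01, h1, h0, hlap⟩ := hmol {z | 2 * h ≤ Metric.infDist z Γᶜ}
    (isClosed_le continuous_const hcont).measurableSet h hh
  have hts : tsupport χ ⊆ {z | h ≤ Metric.infDist z Γᶜ} := by
    refine closure_minimal (fun z hz => ?_) (isClosed_le continuous_const hcont)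
    by_contra hzb
    refine hz (h0 z (Set.disjoint_left.2 fun w hw hw' => hzb ?_))
    have := Metric.infDist_le_infDist_add_dist (s := Γᶜ) (x := w) (y := z)
    rw [Metric.mem_closedBall] at hw
    simp only [mem_ofPred_eq] at hw' ⊢
    linarith
  have hsub : tsupport χ ⊆ Γ := fun z hz => by
    by_contra hzΓ
    have h2 := hts hz
    rw [mem_ofPred_eq, Metric.infDist_zero_of_mem (show z ∈ Γᶜ from hzΓ)] at h2
    linarith
  refine ⟨χ, hχ, (hb.isCompact_closure).of_isClosed_subset (isClosed_tsupport χ)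
    (hsub.trans subset_closure), hsub, fun z => (h01 z).1, fun z => (h01 z).2,
    fun z hz hzc => h1 z fun w hw => ?_, hlap⟩
  have h3 : 3 * h < Metric.infDist z Γᶜ := by
    by_contra hcon
    exact hzc (mem_cthickening_frontier hΓ hb hz (not_lt.1 hcon))
  have := Metric.infDist_le_infDist_add_dist (s := Γᶜ) (x := z) (y := w)
  rw [Metric.mem_closedBall, dist_comm] at hw
  simp only [mem_ofPred_eq]
  linarith

variable {D h : ℝ} {χ : ℂ → ℝ}

theorem IsCollarCutoff.eq_zero (hχ : IsCollarCutoff Γ D h χ) {z : ℂ} (hz : z ∉ Γ) : χ z = 0 :=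
  image_eq_zero_of_notMem_tsupport fun h' => hz (hχ.tsupport_subset h')

theorem IsCollarCutoff.planeLaplacian_eq_zero (hχ : IsCollarCutoff Γ D h χ) (hΓ : IsOpen Γ) {z : ℂ}
    (hz : z ∉ Metric.cthickening (3 * h) (frontier Γ)) : planeLaplacian χ z = 0 := by
  by_cases hzΓ : z ∈ Γ
  · have : χ =ᶠ[𝓝 z] fun _ => 1 := by
      filter_upwards [hΓ.mem_nhds hzΓ, Metric.isClosed_cthickening.isOpen_compl.mem_nhds hz] with
        w h1 h2 using hχ.eq_one w h1 h2
    rw [planeLaplacian_congr this, planeLaplacian_const, Pi.zero_apply]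
  · exact image_eq_zero_of_notMem_tsupport fun h' =>
      hzΓ (hχ.tsupport_subset (tsupport_planeLaplacian_subset χ h'))

theorem IsCollarCutoff.tsupport_planeLaplacian_subset_cthickening (hχ : IsCollarCutoff Γ D h χ)
    (hΓ : IsOpen Γ) : tsupport (planeLaplacian χ) ⊆ Metric.cthickening (3 * h) (frontier Γ) :=
  closure_minimal (fun _ hz => by_contra fun h' => hz (hχ.planeLaplacian_eq_zero hΓ h'))
    Metric.isClosed_cthickening

theorem IsCollarCutoff.integrableOn_one_sub (hχ : IsCollarCutoff Γ D h χ) (hΓ : IsOpen Γ)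
    {μ : Measure ℂ} (hμ : μ (Metric.cthickening (3 * h) (frontier Γ)) < ⊤) :
    IntegrableOn (fun z => 1 - χ z) Γ μ := by
  have hm : MeasurableSet (Metric.cthickening (3 * h) (frontier Γ)) :=
    Metric.isClosed_cthickening.measurableSet
  have h1 : IntegrableOn (fun z => 1 - χ z) (Γ ∩ Metric.cthickening (3 * h) (frontier Γ)) μ := by
    refine Measure.integrableOn_of_bounded (M := 1) ((measure_mono inter_subset_right).trans_lt hμ).ne
      (continuous_const.sub hχ.contDiff.continuous).aestronglyMeasurable
      (Eventually.of_forall fun z => ?_)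
    rw [Real.norm_eq_abs, abs_le]
    constructor <;> linarith [hχ.nonneg z, hχ.le_one z]
  refine h1.of_forall_sdiff_eq_zero hΓ.measurableSet fun z hz => ?_
  rw [hχ.eq_one z hz.1 fun h' => hz.2 ⟨hz.1, h'⟩, sub_self]

theorem IsCollarCutoff.setIntegral_one_sub_mem_Icc (hχ : IsCollarCutoff Γ D h χ) (hΓ : IsOpen Γ)
    {μ : Measure ℂ} {I : ℝ} (hI : 0 ≤ I)
    (hμ : μ (Metric.cthickening (3 * h) (frontier Γ)) ≤ ENNReal.ofReal I) :
    ∫ z in Γ, (1 - χ z) ∂μ ∈ Icc 0 I := by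
  refine ⟨integral_nonneg fun z => sub_nonneg.2 (hχ.le_one z), ?_⟩
  have hm : MeasurableSet (Metric.cthickening (3 * h) (frontier Γ)) :=
    Metric.isClosed_cthickening.measurableSet
  have hle : μ (Γ ∩ Metric.cthickening (3 * h) (frontier Γ)) ≤ ENNReal.ofReal I :=
    (measure_mono inter_subset_right).trans hμ
  rw [setIntegral_eq_of_subset_of_forall_sdiff_eq_zero hΓ.measurableSet
    (inter_subset_left (t := Metric.cthickening (3 * h) (frontier Γ))) fun _ hz => by
      rw [hχ.eq_one _ hz.1 fun h' => hz.2 ⟨hz.1, h'⟩, sub_self]]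
  have := norm_setIntegral_le_of_norm_le_const (μ := μ) (C := 1) (f := fun z => 1 - χ z)
    (hle.trans_lt ENNReal.ofReal_lt_top) fun z _ => by
      rw [Real.norm_eq_abs, abs_le]
      constructor <;> linarith [hχ.nonneg z, hχ.le_one z]
  rw [one_mul] at this
  exact ((le_abs_self _).trans this).trans (ENNReal.toReal_le_of_le_ofReal hI hle)

end CollarCutoff

/-! ### Counting zeros up to a bounded error. -/

section Counting

variable {N : ℕ} {φ : Fin N → ℂ → ℂ} {Γ : Set ℂ} {U : Opens ℂ}

/-- An analytic function that vanishes near an interior point of a bounded set vanishes near some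
boundary point. -/
theorem analyticOrderAt_ne_top_of_frontier (hΓ : IsOpen Γ) (hb : Bornology.IsBounded Γ) {u : ℂ → ℂ}
    (hu : AnalyticOnNhd ℂ u (closure Γ)) (hf : ∀ z ∈ frontier Γ, analyticOrderAt u z ≠ ⊤) :
    ∀ z ∈ closure Γ, analyticOrderAt u z ≠ ⊤ := by
  -- No boundary point has infinite order, so the points of infinite order in `Γ` and in its closure
  -- are the same. The set is therefore open and closed in the plane, and, being bounded, empty.
  have hA : {z ∈ Γ | analyticOrderAt u z = ⊤} = {z ∈ closure Γ | analyticOrderAt u z = ⊤} := by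
    ext z
    refine ⟨fun hz => ⟨subset_closure hz.1, hz.2⟩, fun hz => ⟨?_, hz.2⟩⟩
    by_contra hzΓ
    exact hf z (by rw [hΓ.frontier_eq]; exact ⟨hz.1, hzΓ⟩) hz.2
  have ho : IsOpen {z ∈ Γ | analyticOrderAt u z = ⊤} := by
    refine hΓ.inter ?_
    simp only [analyticOrderAt_eq_top]
    exact isOpen_setOfPred_eventually_nhds
  have hc : IsClosed {z ∈ Γ | analyticOrderAt u z = ⊤} := by
    refine isClosed_of_closure_subset fun z hz => ?_
    rw [hA] at hz ⊢
    have hzΓ : z ∈ closure Γ := closure_minimal (fun w hw => hw.1) isClosed_closure hz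
    refine ⟨hzΓ, analyticOrderAt_eq_top.2 ?_⟩
    refine (hu z hzΓ).eventually_eq_zero_or_eventually_ne_zero.elim id fun hne => ?_
    rw [eventually_nhdsWithin_iff] at hne
    obtain ⟨w, hw, hwW⟩ := mem_closure_iff_nhds.1 hz _ hne
    have hev := analyticOrderAt_eq_top.1 hwW.2
    by_cases hwz : w = z
    · exact hwz ▸ hev
    · exact absurd hev.self_of_nhds (hw hwz)
  rcases isClopen_iff.1 ⟨hc, ho⟩ with h | h
  · intro z hz htop
    have : z ∈ {z ∈ closure Γ | analyticOrderAt u z = ⊤} := ⟨hz, htop⟩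
    rw [← hA, h] at this
    exact this
  · exact absurd (hb.subset (fun z (hz : z ∈ (univ : Set ℂ)) => (h ▸ hz :
      z ∈ {z ∈ Γ | analyticOrderAt u z = ⊤}).1)) (NormedSpace.unbounded_univ ℂ ℂ)

theorem zeroCount_eq_sum {u : ℂ → ℂ} {Z : Finset ℂ} (hZ : ∀ a, a ∈ Z ↔ a ∈ Γ ∧ u a = 0) :
    zeroCount u Γ = ∑ a ∈ Z, analyticOrderNatAt u a := by
  have e : {z ∈ Γ | u z = 0} = (Z : Set ℂ) := by
    ext a
    exact (hZ a).symm
  rw [zeroCount, e, finsum_mem_coe_finset]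

/-- The number of zeros, for a fixed value of the parameter. -/
theorem abs_zeroCount_sub_le (hΓ : IsOpen Γ) (hb : Bornology.IsBounded Γ) (hN : 0 < N)
    (hφ : ∀ j, DifferentiableOn ℂ (φ j) U) {C D h : ℝ} (hC : 0 ≤ C) (hD : 0 ≤ D) (hh : 0 < h)
    (hcU : Metric.cthickening (3 * h) (frontier Γ) ⊆ U)
    (hord : ∀ z ∈ Metric.cthickening (3 * h) (frontier Γ), analyticOrderAt (expSum φ h) z ≠ ⊤)
    (hL : ∫⁻ z in Metric.cthickening (3 * h) (frontier Γ), ‖logDefect φ h z‖ₑ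
      ≤ ENNReal.ofReal (C * h ^ 2))
    (hsum : ∀ Z : Finset ℂ,
      (∀ a ∈ Z, a ∈ Metric.cthickening (3 * h) (frontier Γ) ∧ expSum φ h a = 0) →
        ∑ a ∈ Z, (analyticOrderNatAt (expSum φ h) a : ℝ) ≤ C)
    {χ : ℂ → ℝ} (hχ : IsCollarCutoff Γ D h χ) {u : ℂ → ℂ}
    (hu : AnalyticOnNhd ℂ u (closure Γ)) (huU : EqOn u (expSum φ h) U) :
    {z ∈ Γ | u z = 0}.Finite ∧
      |(zeroCount u Γ : ℝ) - 1 / (2 * Real.pi * h) * ∫ z, maxRe φ z * planeLaplacian χ z|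
        ≤ C * D + C := by
  have hueq : ∀ z ∈ Metric.cthickening (3 * h) (frontier Γ), u =ᶠ[𝓝 z] expSum φ h :=
    fun z hz => huU.eventuallyEq_of_mem (U.isOpen.mem_nhds (hcU hz))
  have hfr : ∀ z ∈ frontier Γ, analyticOrderAt u z ≠ ⊤ := fun z hz => by
    have hz' := Metric.self_subset_cthickening (frontier Γ) (δ := 3 * h) hz
    rw [analyticOrderAt_congr (hueq z hz')]
    exact hord z hz'
  have hordu := analyticOrderAt_ne_top_of_frontier hΓ hb hu hfr
  obtain ⟨Z₀, -, hZ₀, -⟩ := exists_log_norm_ae_eq hb.isCompact_closure hu hordu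
  classical
  set Z := Z₀.filter (· ∈ Γ) with hZdef
  have hZ : ∀ a, a ∈ Z ↔ a ∈ Γ ∧ u a = 0 := fun a => by
    rw [hZdef, Finset.mem_filter, hZ₀]
    exact ⟨fun h' => ⟨h'.2, h'.1.2⟩, fun h' => ⟨⟨subset_closure h'.1, h'.2⟩, h'.1⟩⟩
  refine ⟨Z.finite_toSet.subset fun a ha => (hZ a).2 ha, ?_⟩
  have htc : tsupport χ ⊆ closure Γ := hχ.tsupport_subset.trans subset_closure
  have hcount := integral_log_norm_mul_planeLaplacian_eq_sum hχ.contDiff hχ.hasCompactSupport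
    (hu.mono htc) (fun z hz => hordu z (htc hz)) Z
    fun a ha h0 => (hZ a).2 ⟨hχ.tsupport_subset ha, h0⟩
  have hlc := continuous_planeLaplacian hχ.contDiff
  have hlt := tsupport_planeLaplacian_subset χ
  have hls : HasCompactSupport (planeLaplacian χ) :=
    hχ.hasCompactSupport.mono' (subset_closure.trans hlt)
  have hlcol := hχ.tsupport_planeLaplacian_subset_cthickening hΓ
  have hi1 : Integrable fun z => Real.log ‖u z‖ * planeLaplacian χ z :=
    integrable_mul_of_integrableOn hlc hls
      ((integrableOn_log_norm hb.isCompact_closure hu hordu).mono_set (hlt.trans htc))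
  have hi2 : Integrable fun z => maxRe φ z * planeLaplacian χ z :=
    integrable_mul_of_tsupport_subset U.isOpen
      (continuousOn_maxRe hN fun j => (hφ j).continuousOn) hlc hls (hlcol.trans hcU)
  -- Only the collar matters, because `Δχ` vanishes elsewhere; in the collar `u` is the exponential
  -- sum.
  have hsplit : ∫ z, logDefect φ h z * planeLaplacian χ z
      = (∫ z, Real.log ‖u z‖ * planeLaplacian χ z) - h⁻¹ * ∫ z, maxRe φ z * planeLaplacian χ z := by
    rw [← integral_const_mul, ← integral_sub hi1 (hi2.const_mul _)]
    refine integral_congr_ae (Eventually.of_forall fun z => ?_)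
    by_cases hz : z ∈ Metric.cthickening (3 * h) (frontier Γ)
    · simp only [logDefect, huU (hcU hz)]
      ring
    · simp only [hχ.planeLaplacian_eq_zero hΓ hz, mul_zero, sub_zero]
  have hE : |∫ z, logDefect φ h z * planeLaplacian χ z| ≤ C * h ^ 2 * (D / h ^ 2) :=
    abs_integral_mul_le (by positivity) (by positivity) hL hχ.abs_planeLaplacian_le
      fun z hz => hχ.planeLaplacian_eq_zero hΓ hz
  have e1 : C * h ^ 2 * (D / h ^ 2) = C * D := by field_simp
  rw [e1, hsplit, hcount] at hE
  -- The weight `1 - χ` is zero at points of `Γ` outside the collar, so this sum sees only the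
  -- `O(1)` zeros in the collar.
  have hrest : ∑ a ∈ Z, (analyticOrderNatAt u a : ℝ) * (1 - χ a) ∈ Icc 0 C := by
    refine ⟨Finset.sum_nonneg fun a _ => mul_nonneg (Nat.cast_nonneg _)
      (sub_nonneg.2 (hχ.le_one a)), ?_⟩
    calc _ = ∑ a ∈ Z.filter (· ∈ Metric.cthickening (3 * h) (frontier Γ)),
            (analyticOrderNatAt u a : ℝ) * (1 - χ a) := by
          refine (Finset.sum_filter_of_ne fun a ha hne => ?_).symm
          by_contra hac
          exact hne (by rw [hχ.eq_one a ((hZ a).1 ha).1 hac, sub_self, mul_zero])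
      _ ≤ ∑ a ∈ Z.filter (· ∈ Metric.cthickening (3 * h) (frontier Γ)),
            (analyticOrderNatAt (expSum φ h) a : ℝ) := by
          refine Finset.sum_le_sum fun a ha => ?_
          rw [Finset.mem_filter] at ha
          rw [analyticOrderNatAt, analyticOrderAt_congr (hueq a ha.2), ← analyticOrderNatAt]
          exact mul_le_of_le_one_right (Nat.cast_nonneg _) (by linarith [hχ.nonneg a])
      _ ≤ C := by
          refine hsum _ fun a ha => ?_
          rw [Finset.mem_filter] at ha
          exact ⟨ha.2, by rw [← huU (hcU ha.2)]; exact ((hZ a).1 ha.1).2⟩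
  have hzc : (zeroCount u Γ : ℝ) = ∑ a ∈ Z, (analyticOrderNatAt u a : ℝ) * χ a
      + ∑ a ∈ Z, (analyticOrderNatAt u a : ℝ) * (1 - χ a) := by
    rw [zeroCount_eq_sum hZ, ← Finset.sum_add_distrib]
    push_cast
    exact Finset.sum_congr rfl fun a _ => by ring
  rw [hzc]
  have hpi := Real.pi_gt_three
  set S := ∑ a ∈ Z, (analyticOrderNatAt u a : ℝ) * χ a
  set M := ∫ z, maxRe φ z * planeLaplacian χ z
  have e2 : S + ∑ a ∈ Z, (analyticOrderNatAt u a : ℝ) * (1 - χ a) - 1 / (2 * Real.pi * h) * M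
      = (2 * Real.pi * S - h⁻¹ * M) / (2 * Real.pi)
        + ∑ a ∈ Z, (analyticOrderNatAt u a : ℝ) * (1 - χ a) := by
    field_simp
    ring
  rw [e2]
  refine (abs_add_le _ _).trans (add_le_add ?_ ?_)
  · rw [abs_div, abs_of_pos (by positivity : 0 < 2 * Real.pi), div_le_iff₀ (by positivity)]
    nlinarith [mul_nonneg hC hD]
  · rw [abs_of_nonneg hrest.1]
    exact hrest.2

/-- The number of zeros is `(2πh)⁻¹ ∫ Ψ Δχ` up to a bounded error, where `χ` is a cutoff function
that switches in the collar of width `3 * h`. -/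
theorem exists_zeroCount_bound (hΓ : IsOpen Γ) (hb : Bornology.IsBounded Γ)
    (hΓs : HasSmoothBoundary Γ) (hΓU : frontier Γ ⊆ U) (hN : 0 < N)
    (hφ : ∀ j, DifferentiableOn ℂ (φ j) U)
    (htrans : ∀ x ∈ frontier Γ, ∀ j k, j ≠ k →
      (φ j x).re = maxRe φ x → (φ k x).re = maxRe φ x →
      ∀ τ, IsUnitTangent Γ x τ → fderiv ℝ (fun z => (φ j z).re - (φ k z).re) x τ ≠ 0)
    {μ : Measure ℂ} (hμ : IsLaplacianMeasure U (maxRe φ) μ) :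
    ∃ C D : ℝ, 0 ≤ C ∧ ∃ h₀ : ℝ, 0 < h₀ ∧ ∀ h ∈ Ioc 0 h₀,
      Metric.cthickening (3 * h) (frontier Γ) ⊆ U ∧
      μ (Metric.cthickening (3 * h) (frontier Γ)) ≤ ENNReal.ofReal (C * h) ∧
      ∃ χ, IsCollarCutoff Γ D h χ ∧ ∀ u : ℂ → ℂ, AnalyticOnNhd ℂ u (closure Γ) →
        EqOn u (expSum φ h) U → {z ∈ Γ | u z = 0}.Finite ∧
        |(zeroCount u Γ : ℝ) - 1 / (2 * Real.pi * h) * ∫ z, maxRe φ z * planeLaplacian χ z| ≤ C := by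
  have hγ : IsCompact (frontier Γ) :=
    hb.isCompact_closure.of_isClosed_subset isClosed_frontier frontier_subset_closure
  obtain ⟨D, hD, hχ⟩ := exists_isCollarCutoff hΓ hb
  obtain ⟨C, hC, hev⟩ := exists_collar_bounds hγ (fun x hx => by
    obtain ⟨ρ, hρ⟩ := hΓs x hx
    exact exists_dominance_radius hΓ hx hρ U.isOpen (hΓU hx) hN hφ (htrans x hx)) hφ hμ
  obtain ⟨h₀, hh₀, hev⟩ := mem_nhdsGT_iff_exists_Ioc_subset.1 hev
  refine ⟨C * D + C, D, by positivity, h₀, hh₀, fun h hh => ?_⟩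
  obtain ⟨h1, h2, h3, h4, h5⟩ := hev hh
  obtain ⟨χ, hχ⟩ := hχ h hh.1
  refine ⟨h1, h4.trans (ENNReal.ofReal_le_ofReal ?_), χ, hχ, fun u hu huU =>
    abs_zeroCount_sub_le hΓ hb hN hφ hC hD hh.1 h1 h2 h3 h5 hχ hu huU⟩
  have := hh.1
  gcongr
  exact le_add_of_nonneg_left (by positivity)

end Counting

/-! ### The mass of `ΔT` and its independence of the cutoff. -/

section DistributionMass

variable {N : ℕ} {φ : Fin N → ℂ → ℂ} {Γ : Set ℂ} {U Ω : Opens ℂ} {μ : Measure ℂ} {T : 𝓓'(Ω, ℝ)}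
  {D h : ℝ} {χ : ℂ → ℝ}

/-- Only the support of `Δζ` has to lie in `U`. This covers collar cutoffs, which equal `1` deep
inside `Γ` where `T` is arbitrary. -/
theorem distLaplacian_eq_integral {Ψ : ℂ → ℝ} (hT : T.EqFunctionOn U Ψ) {ζ : 𝓓(Ω, ℝ)}
    (hζ : tsupport (planeLaplacian ζ) ⊆ U) :
    distLaplacian T ζ = ∫ z, Ψ z * planeLaplacian ζ z := by
  have e : (testLaplacian ζ : ℂ → ℝ) = planeLaplacian ζ := funext fun z => testLaplacian_apply ζ z
  rw [distLaplacian_apply, hT _ (by rwa [e]), e]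

theorem distLaplacian_eqMeasureOn {Ψ : ℂ → ℝ} (hT : T.EqFunctionOn U Ψ)
    (hμ : IsLaplacianMeasure U Ψ μ) : (distLaplacian T).EqMeasureOn U μ :=
  ⟨hμ.1, fun ζ hζ => by
    rw [distLaplacian_eq_integral hT ((tsupport_planeLaplacian_subset ζ).trans hζ),
      hμ.integral_eq ζ.contDiff ζ.hasCompactSupport hζ]⟩

/-- A collar cutoff as a test function on a neighbourhood of the closure. -/
def IsCollarCutoff.toTestFunction (hχ : IsCollarCutoff Γ D h χ) (hΩ : closure Γ ⊆ Ω) : 𝓓(Ω, ℝ) :=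
  ⟨χ, hχ.contDiff, hχ.hasCompactSupport, (hχ.tsupport_subset.trans subset_closure).trans hΩ⟩

theorem IsCollarCutoff.hasMassOn (hχ : IsCollarCutoff Γ D h χ) (hΓ : IsOpen Γ)
    (hΓU : frontier Γ ⊆ U) (hUΩ : U ≤ Ω) (hΩ : closure Γ ⊆ Ω) {Ψ : ℂ → ℝ}
    (hT : T.EqFunctionOn U Ψ) (hμ : IsLaplacianMeasure U Ψ μ)
    (hcU : Metric.cthickening (3 * h) (frontier Γ) ⊆ U) :
    (distLaplacian T).HasMassOn Γ
      (distLaplacian T (hχ.toTestFunction hΩ) + ∫ z in Γ, (1 - χ z) ∂μ) := by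
  refine ⟨U, μ, hχ.toTestFunction hΩ, U.isOpen, hΓU, hUΩ, distLaplacian_eqMeasureOn hT hμ,
    hχ.tsupport_subset, ?_, rfl⟩
  refine eventually_nhdsSet_iff_exists.2 ⟨Γ ∩ (Metric.cthickening (3 * h) (frontier Γ))ᶜ,
    hΓ.inter Metric.isClosed_cthickening.isOpen_compl, fun z hz => ⟨hz.1, fun h' => hz.2 (hcU h')⟩,
    fun z hz => hχ.eq_one z hz.1 hz.2⟩

/-- The mass does not depend on the cutoff function. -/
theorem IsCollarCutoff.mass_eq (hχ : IsCollarCutoff Γ D h χ) {D' h' : ℝ} {χ' : ℂ → ℝ}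
    (hχ' : IsCollarCutoff Γ D' h' χ') (hΓ : IsOpen Γ) (hΩ : closure Γ ⊆ Ω)
    {Ψ : ℂ → ℝ} (hT : T.EqFunctionOn U Ψ) (hμ : IsLaplacianMeasure U Ψ μ)
    (hcU : Metric.cthickening (3 * h) (frontier Γ) ⊆ U)
    (hcU' : Metric.cthickening (3 * h') (frontier Γ) ⊆ U)
    (hm : μ (Metric.cthickening (3 * h) (frontier Γ)) < ⊤)
    (hm' : μ (Metric.cthickening (3 * h') (frontier Γ)) < ⊤) :
    distLaplacian T (hχ'.toTestFunction hΩ) + ∫ z in Γ, (1 - χ' z) ∂μ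
      = (∫ z, Ψ z * planeLaplacian χ z) + ∫ z in Γ, (1 - χ z) ∂μ := by
  -- The two cutoffs differ only inside the collars, hence inside `U`, where `ΔT` is the measure
  -- `μ`.
  have hζ : tsupport (⇑(hχ.toTestFunction hΩ - hχ'.toTestFunction hΩ)) ⊆ U := by
    have hsub : tsupport (⇑(hχ.toTestFunction hΩ - hχ'.toTestFunction hΩ)) ⊆
        Metric.cthickening (3 * h) (frontier Γ) ∪ Metric.cthickening (3 * h') (frontier Γ) := by
      refine closure_minimal (fun z hz => by_contra fun hcon => hz ?_)
        (Metric.isClosed_cthickening.union Metric.isClosed_cthickening)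
      rw [mem_union, not_or] at hcon
      change χ z - χ' z = 0
      by_cases hzΓ : z ∈ Γ
      · rw [hχ.eq_one z hzΓ hcon.1, hχ'.eq_one z hzΓ hcon.2, sub_self]
      · rw [hχ.eq_zero hzΓ, hχ'.eq_zero hzΓ, sub_self]
    exact hsub.trans (union_subset hcU hcU')
  have h1 := (distLaplacian_eqMeasureOn hT hμ).2 _ hζ
  have h2 : ∫ z, (hχ.toTestFunction hΩ - hχ'.toTestFunction hΩ) z ∂μ
      = (∫ z in Γ, (1 - χ' z) ∂μ) - ∫ z in Γ, (1 - χ z) ∂μ := by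
    rw [← integral_sub (hχ'.integrableOn_one_sub hΓ hm') (hχ.integrableOn_one_sub hΓ hm),
      ← setIntegral_eq_integral_of_forall_compl_eq_zero (s := Γ)]
    · refine integral_congr_ae (Eventually.of_forall fun z => ?_)
      change χ z - χ' z = 1 - χ' z - (1 - χ z)
      ring
    · intro z hz
      change χ z - χ' z = 0
      rw [hχ.eq_zero hz, hχ'.eq_zero hz, sub_self]
  have h3 : distLaplacian T (hχ.toTestFunction hΩ) = ∫ z, Ψ z * planeLaplacian χ z :=
    distLaplacian_eq_integral hT ((hχ.tsupport_planeLaplacian_subset_cthickening hΓ).trans hcU)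
  rw [map_sub, h2, h3] at h1
  linarith

/-- Here `M` is `∫ Ψ Δχ` and `R` the mass `∫_Γ (1 - χ) dμ` of order `h` left in the collar; after
division by `2πh` it costs at most another `C`. -/
theorem abs_sub_div_two_pi_le {n M R C h : ℝ} (hh : 0 < h) (hn : |n - 1 / (2 * Real.pi * h) * M| ≤ C)
    (hR : R ∈ Icc 0 (C * h)) : |n - 1 / (2 * Real.pi * h) * (M + R)| ≤ 2 * C := by
  have hpi := Real.pi_gt_three
  have h1 : 1 / (2 * Real.pi * h) * R ≤ C := by
    rw [one_div, inv_mul_le_iff₀ (by positivity)]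
    nlinarith [hR.1, hR.2]
  have h2 : 0 ≤ 1 / (2 * Real.pi * h) * R := mul_nonneg (by positivity) hR.1
  rw [mul_add, ← sub_sub]
  rw [abs_le] at hn ⊢
  constructor <;> linarith

end DistributionMass

theorem proposition4p1
    -- the bounded open set `Γ` with smooth boundary
    (Γ : Set ℂ) (hΓo : IsOpen Γ) (hΓb : Bornology.IsBounded Γ) (hΓs : HasSmoothBoundary Γ)
    -- the exponents, holomorphic on a neighbourhood `U` of the boundary
    (U : Opens ℂ) (hΓU : frontier Γ ⊆ U)
    (N : ℕ) (hN : 0 < N) (φ : Fin N → ℂ → ℂ) (hφ : ∀ j, DifferentiableOn ℂ (φ j) U)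
    -- on the boundary the maximum is attained for at most two indices, with a transversal switch
    (hmax : ∀ x ∈ frontier Γ, {j | (φ j x).re = maxRe φ x}.ncard ≤ 2)
    (htrans : ∀ x ∈ frontier Γ, ∀ j k, j ≠ k →
      (φ j x).re = maxRe φ x → (φ k x).re = maxRe φ x →
      ∀ τ, IsUnitTangent Γ x τ → fderiv ℝ (fun z => (φ j z).re - (φ k z).re) x τ ≠ 0) :
    -- the exponents are holomorphic on a neighbourhood of the closure of `Γ`
    (closure Γ ⊆ U →
      ∃ μ : Measure ℂ, IsLaplacianMeasure U (maxRe φ) μ ∧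
        ∃ C : ℝ, ∃ h₀ : ℝ, 0 < h₀ ∧ ∀ h ∈ Ioc 0 h₀,
          {z ∈ Γ | ∑ j, Complex.exp (φ j z / h) = 0}.Finite ∧
          |(zeroCount (fun z => ∑ j, Complex.exp (φ j z / h)) Γ : ℝ)
            - 1 / (2 * Real.pi * h) * (μ Γ).toReal| ≤ C) ∧
    -- `u` is holomorphic on a neighbourhood `Ω` of the closure of `Γ`, and it is a sum of
    -- exponentials only on `U`; `T` is any distribution extension of `max_j Re φ_j`
    (∀ Ω : Opens ℂ, closure Γ ⊆ Ω → U ≤ Ω →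
      ∀ (h₁ : ℝ) (u : ℝ → ℂ → ℂ), 0 < h₁ →
        (∀ h ∈ Ioc 0 h₁, DifferentiableOn ℂ (u h) Ω) →
        (∀ h ∈ Ioc 0 h₁, ∀ z ∈ U, u h z = ∑ j, Complex.exp (φ j z / h)) →
        ∀ T : 𝓓'(Ω, ℝ), T.EqFunctionOn U (maxRe φ) →
          ∃ m : ℝ, (distLaplacian T).HasMassOn Γ m ∧
            ∃ C : ℝ, ∃ h₀ : ℝ, 0 < h₀ ∧ h₀ ≤ h₁ ∧ ∀ h ∈ Ioc 0 h₀,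
              {z ∈ Γ | u h z = 0}.Finite ∧
              |(zeroCount (u h) Γ : ℝ) - 1 / (2 * Real.pi * h) * m| ≤ C) := by
  obtain ⟨μ, hμ⟩ := exists_isLaplacianMeasure_maxRe hN hφ
  obtain ⟨C, D, hC, h₀, hh₀, H⟩ := exists_zeroCount_bound hΓo hΓb hΓs hΓU hN hφ htrans hμ
  refine ⟨fun hΓU' => ⟨μ, hμ, 2 * C, h₀, hh₀, fun h hh => ?_⟩, ?_⟩
  · obtain ⟨hcU, hμc, χ, hχ, hcount⟩ := H h hh
    obtain ⟨hfin, hle⟩ := hcount (expSum φ h)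
      ((analyticOnNhd_expSum U.isOpen hφ h).mono hΓU') fun z _ => rfl
    refine ⟨hfin, ?_⟩
    have hμΓ : μ Γ < ⊤ :=
      (measure_mono subset_closure).trans_lt (hμ.1 _ hΓb.isCompact_closure hΓU')
    have hχU : tsupport χ ⊆ U := (hχ.tsupport_subset.trans subset_closure).trans hΓU'
    -- The indicator of `Γ` is split as `χ + (1 - χ) 1_Γ`, and the first part is turned into `∫ Ψ
    -- Δχ`.
    have hmass : (μ Γ).toReal
        = (∫ z, maxRe φ z * planeLaplacian χ z) + ∫ z in Γ, (1 - χ z) ∂μ := by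
      have hint : Integrable χ μ :=
        hμ.integrable hχ.contDiff.continuous hχ.hasCompactSupport hχU
      rw [hμ.integral_eq hχ.contDiff hχ.hasCompactSupport hχU, integral_sub
        (integrableOn_const (C := (1 : ℝ)) hμΓ.ne).integrable hint.integrableOn,
        setIntegral_eq_integral_of_forall_compl_eq_zero fun z hz => hχ.eq_zero hz,
        setIntegral_const, smul_eq_mul, mul_one, add_sub_cancel]
      rfl
    rw [hmass]
    exact abs_sub_div_two_pi_le hh.1 hle
      (hχ.setIntegral_one_sub_mem_Icc hΓo (mul_nonneg hC hh.1.le) hμc)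
  · intro Ω hΩ hUΩ h₁ u hh₁ hu huU T hT
    -- The mass must not depend on `h`, so it is defined by the cutoff at the fixed scale `h₀`;
    -- `mass_eq` rewrites it by the cutoff at each scale `h`.
    obtain ⟨hcU₀, hμc₀, χ₀, hχ₀, -⟩ := H h₀ ⟨hh₀, le_rfl⟩
    refine ⟨_, hχ₀.hasMassOn hΓo hΓU hUΩ hΩ hT hμ hcU₀, 2 * C, min h₀ h₁, lt_min hh₀ hh₁,
      min_le_right _ _, fun h hh => ?_⟩
    have hh0 : h ∈ Ioc 0 h₀ := ⟨hh.1, hh.2.trans (min_le_left _ _)⟩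
    have hh1 : h ∈ Ioc 0 h₁ := ⟨hh.1, hh.2.trans (min_le_right _ _)⟩
    obtain ⟨hcU, hμc, χ, hχ, hcount⟩ := H h hh0
    obtain ⟨hfin, hle⟩ := hcount (u h)
      (((hu h hh1).analyticOnNhd Ω.isOpen).mono hΩ) (huU h hh1)
    refine ⟨hfin, ?_⟩
    rw [hχ.mass_eq hχ₀ hΓo hΩ hT hμ hcU hcU₀ (hμc.trans_lt ENNReal.ofReal_lt_top)
      (hμc₀.trans_lt ENNReal.ofReal_lt_top)]
    exact abs_sub_div_two_pi_le hh.1 hle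
      (hχ.setIntegral_one_sub_mem_Icc hΓo (mul_nonneg hC hh.1.le) hμc)
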